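/- **Setting.** Let $d\ge 2$, let $E_{d+1}=\mathbb R^{d+1}$ carry the form $(x,y)=x^0y^0+x^dy^d-x^1y^1-\dots-x^{d-1}y^{d-1}$, and let $X_d=\{x:(x,x)=1\}$ be the anti-de Sitter quadric. Let $\widetilde X_d$ be its covering space with global coordinates $(t,\vec x)\in\mathbb R\times\mathbb R^{d-1}$ and covering map $x^0=\sqrt{1+\vec x^2}\sin t$, $x^d=\sqrt{1+\vec x^2}\cos t$, $\vec x$ unchanged. Both carry the invariant measure $d\sigma=dt\,d\vec x$. Let $G_0$ be the connected component of the identity in the group $O(2,d-1)$ of the form, with Lie algebra $\mathcal G$, and let $\widetilde G_0$ be the connected covering group of $G_0$ acting on $\widetilde X_d$ by lifts. Put $\ell(a\wedge b)x=(b,x)a-(a,x)b$, $M_{\mu\nu}=\ell(e_\mu\wedge e_\nu)$, $\mathcal C_1=\{\ell(a\wedge b):(a,a)=(b,b)=1,\ (a,b)=0,\ a^0b^d-a^db^0>0\}$, $\mathcal C_+=\bigcup_{\rho>0}\rho\,\mathcal C_1$, and $\mathbb C_+=\{\operatorname{Im}\tau>0\}$. All statements below are made for $X_d$ with the group $G_0$,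 and equally for $\widetilde X_d$ with the group $\widetilde G_0$. Let $\mathcal B_0=\mathbb C$, let $\mathcal B_n=\mathcal S(X_d^n)$ (resp. $\mathcal S(\widetilde X_d^n)$) for $n\ge1$, and let $\mathcal B$ be the Borchers algebra of terminating sequences $f=(f_0,f_1,\dots)$, $f_n\in\mathcal B_n$, with product $(fg)_n=\sum_{p+q=n}f_p\otimes g_q$, involution $(f^\star)_n(x_1,\dots,x_n)=\overline{f_n(x_n,\dots,x_1)}$, and group action $f_{\{\Lambda\}}$, $(f_{\{\Lambda\}})_n(x_1,\dots,x_n)=f_n(\Lambda^{-1}x_1,\dots,\Lambda^{-1}x_n)$; write also $f_{n\{\Lambda_1,\dots,\Lambda_n\}}(x_1,\dots,x_n)=f_n(\Lambda_1^{-1}x_1,\dots,\Lambda_n^{-1}x_n)$. Let $\mathcal W=(\mathcal W_n)$ be a continuous linear functional on $\mathcal B$, normalized by $\langle\mathcal W,1\rangle=1$, such that: 1. (Covariance) $\langle\mathcal W_n,f_{n\{\Lambda\}}\rangle=\langle\mathcal W_n,f_n\rangle$ for all $n$, $f_n\in\mathcal B_n$ and all $\Lambda$ in the group. 2. (Locality)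 $\mathcal W_n(\dots,x_j,x_{j+1},\dots)=\mathcal W_n(\dots,x_{j+1},x_j,\dots)$ where $x_j,x_{j+1}$ are space-like separated. On $X_d$, $x$ and $y$ are space-like separated if $(x-y,x-y)<0$; on $\widetilde X_d$, if this holds for their projections and their time coordinates differ by less than $\pi$. 3. (Positive definiteness) $\langle\mathcal W,f^\star f\rangle\ge0$ for all $f\in\mathcal B$. The GNS construction then gives a Hilbert space $\mathcal H$, the Hausdorff completion of $\mathcal B$ for the semi-inner product $(\boldsymbol\Phi(f)\Omega,\boldsymbol\Phi(g)\Omega)=\langle\mathcal W,f^\star g\rangle$, where $\boldsymbol\Phi(f)\Omega$ denotes the class of $f$ and $\Omega$ that of $1$, and a unitary representation $U$ of the group with $U(\Lambda)\boldsymbol\Phi(f)\Omega=\boldsymbol\Phi(f_{\{\Lambda\}})\Omega$. Assume moreover: 4. (Strong spectral condition) For all $M\in\mathcal C_+$, $\Psi\in\mathcal H$ and $\widetilde\varphi\in C_c^\infty(\mathbb R)$ with support in $(-\infty,0)$, $\int_{\mathbb R}\big(\int\widetilde\varphi(p)e^{-itp}dp\big)U(\exp tM)\Psi\,dt=0$.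 5. (Tempered spectral condition) Let $G_0^+$ be the set of finite products of one or more elements $\exp(\tau M)$, $\tau\in\mathbb C_+$, $M\in\mathcal C_+$, let $\mathcal T_{n+}=\{(z_1,\dots,z_n):z_j=\Lambda_1\cdots\Lambda_jc_j,\ \Lambda_j\in G_0^+,\ c_j\in X_d\}$, and let $\mathcal T_{n-}$ be its complex conjugate; for $\widetilde X_d$ these are replaced by their coverings, obtained by adjoining for each $j$ a logarithm of $z_j^d-iz_j^0$ (for $\mathcal T_{n-}$, the conjugate construction). For all $m,n\ge0$, $\mathcal W_{m+n}(w_m,\dots,w_1,z_1,\dots,z_n)$ is the boundary value, in the sense of tempered distributions, of a function of $(w,z)$ holomorphic and of tempered growth (polynomial growth at infinity and in the inverse distance to the boundary) in $\mathcal T_{m-}\times\mathcal T_{n+}$. Moreover for all $n$, $f_n\in\mathcal B_n$ and $M_1,\dots,M_n\in\mathcal C_1$ the function $(\tau_1,\dots,\tau_n)\mapsto\langle\mathcal W_n,f_{n\{\Lambda_1,\dots,\Lambda_n\}}\rangle$, $\Lambda_j=e^{\tau_1M_1}\cdots e^{\tau_jM_j}$, on $\mathbb R^n$ extends to a function on $\overline{\mathbb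 C_+}^{\,n}$ that is $C^\infty$, holomorphic in $\mathbb C_+^n$, and of at most polynomial growth. **Lemma.** Under these assumptions, the vacuum is unique, i.e. $\{\Psi\in\mathcal H: U(\Lambda)\Psi=\Psi\text{ for all }\Lambda\}=\mathbb C\,\Omega$, if and only if $$\forall f,g\in\mathcal B:\qquad\lim_{T\to+\infty}\frac1T\int_0^T\Big(\langle\mathcal W,\ f^\star g_{\{\exp(tM_{d(d-1)})\}}\rangle-\langle\mathcal W,f^\star\rangle\langle\mathcal W,g\rangle\Big)dt=0.$$ -/

import Mathlib

noncomputable section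
open scoped ContDiff Topology SchwartzMap Matrix
open MeasureTheory Filter

namespace AdS
/-- Indices `1, …, d - 1` of the space-like coordinates; the time-like ones are `0` and `d`. -/
abbrev Spatial (d : ℕ) : Type := {μ : Fin (d + 1) // μ ≠ 0 ∧ μ ≠ Fin.last d}
/-- The ambient space `E_{d+1} = ℝ^{d+1}`. -/
abbrev Amb (d : ℕ) : Type := Fin (d + 1) → ℝ
/-- The complexified ambient space `ℂ^{d+1}`. -/
abbrev AmbC (d : ℕ) : Type := Fin (d + 1) → ℂ
/-- Diagonal entries of the metric `diag(+, -, …, -, +)`. -/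
def sgn (d : ℕ) (μ : Fin (d + 1)) : ℝ := if μ = 0 ∨ μ = Fin.last d then 1 else -1
/-- The bilinear form `(x, y) = x⁰y⁰ + x^d y^d - x¹y¹ - … - x^{d-1}y^{d-1}`. -/
def form {d : ℕ} (x y : Amb d) : ℝ := ∑ μ, sgn d μ * x μ * y μ
/-- The complex bilinear extension of `form`. -/
def formC {d : ℕ} (z w : AmbC d) : ℂ := ∑ μ, (sgn d μ : ℂ) * z μ * w μ
/-- The Gram matrix of `form`. -/
def eta (d : ℕ) : Matrix (Fin (d + 1)) (Fin (d + 1)) ℝ := Matrix.diagonal (sgn d)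

/-- The pseudo-orthogonal group `O(2, d-1)` of `form`. -/
def fullGroup (d : ℕ) : Subgroup (GL (Fin (d + 1)) ℝ) where
  carrier := {Λ | ∀ x y : Amb d, form (Λ.1 *ᵥ x) (Λ.1 *ᵥ y) = form x y}
  one_mem' := by intro x y; simp
  mul_mem' := by
    intro a b ha hb x y
    simp only [Units.val_mul, ← Matrix.mulVec_mulVec] 
    rw [ha, hb]
  inv_mem' := by
    intro a ha x y
    rw [← ha (a⁻¹.1 *ᵥ x)]
    simp [Matrix.mulVec_mulVec]

/-- `G₀`: the connected component of the identity of `O(2, d-1)`. -/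
def properGroup (d : ℕ) : Subgroup (GL (Fin (d + 1)) ℝ) :=
  (Subgroup.connectedComponentOfOne (fullGroup d)).map (fullGroup d).subtype

/-- The Lie algebra of `G₀`, as matrices `M` with `(Mx, y) = -(x, My)`. -/
def lieAlg (d : ℕ) : Submodule ℝ (Matrix (Fin (d + 1)) (Fin (d + 1)) ℝ) where
  carrier := {M | Mᵀ * eta d = -(eta d * M)}
  zero_mem' := by simp
  add_mem' := by
    intro a b ha hb
    simp only [Set.mem_ofPred_eq] at *
    rw [Matrix.transpose_add, add_mul, ha, hb, mul_add]; abel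
  smul_mem' := by
    intro c a ha
    simp only [Set.mem_ofPred_eq] at *
    rw [Matrix.transpose_smul, Matrix.smul_mul, ha, Matrix.mul_smul, smul_neg]

/-- `ℓ(a ∧ b) x = (b, x) a - (a, x) b`. -/
def wedge {d : ℕ} (a b : Amb d) : lieAlg d :=
  ⟨Matrix.of fun ρ σ => a ρ * (sgn d σ * b σ) - b ρ * (sgn d σ * a σ), by
    show _ = _
    ext i j
    simp [eta]; ring⟩

/-- The generator `M_{μν} = ℓ(e_μ ∧ e_ν)`. -/
def stdGen {d : ℕ} (μ ν : Fin (d + 1)) : lieAlg d := wedge (Pi.single μ 1) (Pi.single ν 1)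

/-- `𝒞₁`: all `ℓ(a ∧ b)` with `a, b` orthonormal, time-like and `(e₀ ∧ e_d, a ∧ b) > 0`. -/
def coneOne (d : ℕ) : Set (lieAlg d) :=
  {M | ∃ a b : Amb d, form a a = 1 ∧ form b b = 1 ∧ form a b = 0 ∧
    0 < a 0 * b (Fin.last d) - a (Fin.last d) * b 0 ∧ M = wedge a b}

/-- `𝒞₊ = ⋃_{ρ > 0} ρ 𝒞₁`. -/
def conePlus (d : ℕ) : Set (lieAlg d) := {M | ∃ ρ : ℝ, 0 < ρ ∧ ∃ L ∈ coneOne d, M = ρ • L}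

lemma form_eq {d : ℕ} (x y : Amb d) : form x y = x ⬝ᵥ (eta d *ᵥ y) := by
  simp only [form, eta, dotProduct, Matrix.mulVec_diagonal]
  exact Finset.sum_congr rfl fun _ _ => by ring

lemma eta_mul_eta (d : ℕ) : eta d * eta d = 1 := by
  rw [eta, Matrix.diagonal_mul_diagonal, ← Matrix.diagonal_one]
  congr 1; ext μ; simp only [sgn]; split_ifs <;> norm_num

lemma exp_form {d : ℕ} (M : lieAlg d) (x y : Amb d) :
    form (NormedSpace.exp M.1 *ᵥ x) (NormedSpace.exp M.1 *ᵥ y) = form x y := by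
  have hinv : (eta d)⁻¹ = eta d := Matrix.inv_eq_left_inv (eta_mul_eta d)
  have hu : IsUnit (eta d) := IsUnit.of_mul_eq_one _ (eta_mul_eta d)
  have hM : M.1ᵀ = eta d * (-M.1) * (eta d)⁻¹ := by
    have h : M.1ᵀ * eta d = -(eta d * M.1) := M.2
    rw [hinv, mul_neg, ← h, mul_assoc, eta_mul_eta, mul_one]
  have key : (NormedSpace.exp M.1)ᵀ * eta d * NormedSpace.exp M.1 = eta d := by
    rw [← Matrix.exp_transpose, hM, Matrix.exp_conj _ _ hu, hinv, mul_assoc _ (eta d) (eta d),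
      eta_mul_eta, mul_one, mul_assoc,
      ← Matrix.exp_add_of_commute _ _ (Commute.neg_left (Commute.refl M.1))]
    simp
  rw [form_eq, form_eq, Matrix.mulVec_mulVec, Matrix.dotProduct_mulVec, Matrix.vecMul_mulVec,
    ← Matrix.dotProduct_mulVec, ← mul_assoc, key]

/-- The matrix exponential of a Lie algebra element, as an invertible matrix. -/
def expGL {d : ℕ} (M : lieAlg d) : GL (Fin (d + 1)) ℝ where
  val := NormedSpace.exp M.1
  inv := NormedSpace.exp (-M.1)
  val_inv := by
    rw [← Matrix.exp_add_of_commute _ _ (Commute.neg_right (Commute.refl M.1))]; simp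
  inv_val := by
    rw [← Matrix.exp_add_of_commute _ _ (Commute.neg_left (Commute.refl M.1))]; simp

section
attribute [local instance] Matrix.linftyOpNormedRing Matrix.linftyOpNormedAlgebra

lemma continuous_exp_smul {d : ℕ} (M : Matrix (Fin (d + 1)) (Fin (d + 1)) ℝ) :
    Continuous fun s : ℝ => NormedSpace.exp (s • M) := by
  let : NormedAlgebra ℚ (Matrix (Fin (d + 1)) (Fin (d + 1)) ℝ) := .restrictScalars ℚ ℝ _
  exact NormedSpace.exp_continuous.comp (continuous_id.smul continuous_const)

lemma hasDerivAt_exp_smul_mulVec {d : ℕ} (M : Matrix (Fin (d + 1)) (Fin (d + 1)) ℝ) (x : Amb d)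
    (s : ℝ) (μ : Fin (d + 1)) :
    HasDerivAt (fun s : ℝ => (NormedSpace.exp (s • M) *ᵥ x) μ)
      ((M *ᵥ (NormedSpace.exp (s • M) *ᵥ x)) μ) s := by
  have h := hasDerivAt_exp_smul_const' (𝕂 := ℝ) M s
  have hL : Continuous fun A : Matrix (Fin (d + 1)) (Fin (d + 1)) ℝ => (A *ᵥ x) μ := by fun_prop
  let L : Matrix (Fin (d + 1)) (Fin (d + 1)) ℝ →L[ℝ] ℝ :=
    ⟨{ toFun := fun A => (A *ᵥ x) μ
       map_add' := fun A B => by simp [Matrix.add_mulVec]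
       map_smul' := fun c A => by simp [Matrix.smul_mulVec] }, hL⟩
  have := L.hasFDerivAt.comp_hasDerivAt s h
  rw [Matrix.mulVec_mulVec]
  exact this

end

lemma expGL_mem {d : ℕ} (M : lieAlg d) : expGL M ∈ properGroup d := by
  have hfull : ∀ N : lieAlg d, expGL N ∈ fullGroup d := fun N x y => exp_form N x y
  refine ⟨⟨expGL M, hfull M⟩, ?_, rfl⟩
  let γ : ℝ → fullGroup d := fun s => ⟨expGL (s • M), hfull _⟩
  have hγ : Continuous γ := by
    refine Continuous.subtype_mk (Units.continuous_iff.2 ⟨continuous_exp_smul M.1, ?_⟩) _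
    have : Continuous fun s : ℝ => NormedSpace.exp (s • (-M.1)) := continuous_exp_smul _
    refine this.congr fun s => ?_
    simp [expGL]
  have h0 : γ 0 = 1 := by
    ext1; ext1; simp [γ, expGL]
  have h1 : γ 1 = ⟨expGL M, hfull M⟩ := by simp [γ]
  rw [← h1]
  have : (1 : fullGroup d) ∈ Set.range γ := ⟨0, h0⟩
  exact (isPreconnected_range hγ).subset_connectedComponent this ⟨1, rfl⟩

/-- The homeomorphisms of `P` which cover the action of some `Λ ∈ G₀` on the ambient space.
For the quadric this is `G₀`; for its covering space it is the connected covering group formed by all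
lifts of elements of `G₀`. -/
def isometries {d : ℕ} {P : Type} [TopologicalSpace P] (proj : P → Amb d) : Subgroup (P ≃ₜ P) where
  carrier := {φ | ∃ Λ ∈ properGroup d, ∀ p, proj (φ p) = Λ.1 *ᵥ proj p}
  one_mem' := ⟨1, one_mem _, fun p => by simp⟩
  mul_mem' := by
    rintro φ ψ ⟨Λ, hΛ, h⟩ ⟨Λ', hΛ', h'⟩
    exact ⟨Λ * Λ', mul_mem hΛ hΛ', fun p => by
      show proj (φ (ψ p)) = _
      rw [h, h', Units.val_mul, Matrix.mulVec_mulVec]⟩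
  inv_mem' := by
    rintro φ ⟨Λ, hΛ, h⟩
    refine ⟨Λ⁻¹, inv_mem hΛ, fun p => ?_⟩
    have := h (φ⁻¹ p)
    rw [show φ (φ⁻¹ p) = p from φ.apply_symm_apply p] at this
    rw [this]; simp [Matrix.mulVec_mulVec]


/-! ### temperate growth helpers -/

lemma HasTemperateGrowth_fderiv {E F : Type*} [NormedAddCommGroup E] [NormedSpace ℝ E]
    [NormedAddCommGroup F] [NormedSpace ℝ F] {f : E → F} (hf : f.HasTemperateGrowth) :
    (fderiv ℝ f).HasTemperateGrowth := by
  refine ⟨hf.1.fderiv_right (by simp), fun n => ?_⟩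
  obtain ⟨k, C, h⟩ := hf.2 (n + 1)
  exact ⟨k, C, fun x => by rw [norm_iteratedFDeriv_fderiv]; exact h x⟩

lemma temperate_sin_cos :
    (Real.sin).HasTemperateGrowth ∧ (Real.cos).HasTemperateGrowth := by
  have key : ∀ n : ℕ, (∀ x, |iteratedDeriv n Real.sin x| ≤ 1) ∧
      ∀ x, |iteratedDeriv n Real.cos x| ≤ 1 := by
    intro n
    induction n with
    | zero => simp [Real.abs_sin_le_one, Real.abs_cos_le_one]
    | succ n ih =>
      refine ⟨fun x => ?_, fun x => ?_⟩
      · rw [Real.iteratedDeriv_add_one_sin]; exact ih.2 x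
      · rw [Real.iteratedDeriv_add_one_cos]; simpa using ih.1 x
  refine ⟨⟨Real.contDiff_sin, fun n => ⟨0, 1, fun x => ?_⟩⟩,
    ⟨Real.contDiff_cos, fun n => ⟨0, 1, fun x => ?_⟩⟩⟩
  · rw [norm_iteratedFDeriv_eq_norm_iteratedDeriv]; simpa using (key n).1 x
  · rw [norm_iteratedFDeriv_eq_norm_iteratedDeriv]; simpa using (key n).2 x

lemma temperate_bound_of_fderiv {E F : Type*} [NormedAddCommGroup E] [NormedSpace ℝ E]
    [NormedAddCommGroup F] [NormedSpace ℝ F] {f : E → F} (hf : Differentiable ℝ f)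
    (h : (fderiv ℝ f).HasTemperateGrowth) : f.HasTemperateGrowth := by
  obtain ⟨k, C, hC⟩ := h.2 0
  simp only [norm_iteratedFDeriv_zero] at hC
  have hC0 : 0 ≤ C := by
    have := (norm_nonneg _).trans (hC 0)
    simpa using this
  refine Function.HasTemperateGrowth.of_fderiv h hf (k := k + 1) (C := ‖f 0‖ + C) fun x => ?_
  have h1 : ‖f x - f 0‖ ≤ C * (1 + ‖x‖) ^ k * ‖x - 0‖ := by
    refine Convex.norm_image_sub_le_of_norm_fderiv_le (𝕜 := ℝ) (s := Metric.closedBall 0 ‖x‖)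
      (fun y _ => hf y) (fun y hy => ?_) (convex_closedBall _ _) (by simp) (by simp)
    refine (hC y).trans ?_
    have : ‖y‖ ≤ ‖x‖ := by simpa using hy
    gcongr
  have h2 : ‖f x‖ ≤ ‖f 0‖ + ‖f x - f 0‖ := by
    simpa using norm_add_le (f 0) (f x - f 0)
  have h3 : (1 : ℝ) ≤ (1 + ‖x‖) ^ (k + 1) := one_le_pow₀ (by simp)
  have h4 : C * (1 + ‖x‖) ^ k * ‖x - 0‖ ≤ C * (1 + ‖x‖) ^ (k + 1) := by
    rw [pow_succ, ← mul_assoc, sub_zero]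
    gcongr
    linarith [norm_nonneg x]
  have h5 : ‖f 0‖ ≤ ‖f 0‖ * (1 + ‖x‖) ^ (k + 1) := le_mul_of_one_le_right (norm_nonneg _) h3
  linarith

lemma temperate_angle {E : Type*} [NormedAddCommGroup E] [NormedSpace ℝ E] {T : E → ℝ}
    (hT : Continuous T) (hs : (fun x => Real.sin (T x)).HasTemperateGrowth)
    (hc : (fun x => Real.cos (T x)).HasTemperateGrowth) : T.HasTemperateGrowth := by
  have hds := (hs.1.differentiable (by simp))
  have hdc := (hc.1.differentiable (by simp))
  have hder : ∀ x, HasFDerivAt T (Real.cos (T x) • fderiv ℝ (fun x => Real.sin (T x)) x -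
      Real.sin (T x) • fderiv ℝ (fun x => Real.cos (T x)) x) x := by
    intro x
    have hS : HasFDerivAt (fun y => Real.cos (T x) * Real.sin (T y) - Real.sin (T x) * Real.cos (T y))
        (Real.cos (T x) • fderiv ℝ (fun x => Real.sin (T x)) x -
      Real.sin (T x) • fderiv ℝ (fun x => Real.cos (T x)) x) x :=
      ((hds x).hasFDerivAt.const_mul _).sub ((hdc x).hasFDerivAt.const_mul _)
    have h0 : Real.cos (T x) * Real.sin (T x) - Real.sin (T x) * Real.cos (T x) = 0 := by ring
    have harc : HasDerivAt Real.arcsin 1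
        (Real.cos (T x) * Real.sin (T x) - Real.sin (T x) * Real.cos (T x)) := by
      rw [h0]
      simpa using Real.hasDerivAt_arcsin (x := 0) (by norm_num) (by norm_num)
    have h1 := (harc.comp_hasFDerivAt x hS).add_const (T x)
    rw [one_smul] at h1
    refine h1.congr_of_eventuallyEq ?_
    have hnear : ∀ᶠ y in 𝓝 x, |T y - T x| < Real.pi / 2 := by
      have : Tendsto (fun y => |T y - T x|) (𝓝 x) (𝓝 0) := by
        have := ((hT.sub continuous_const).abs).tendsto x (f := fun y => |T y - T x|)
        simpa using this
      exact this.eventually (gt_mem_nhds (by positivity))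
    filter_upwards [hnear] with y hy
    have : Real.cos (T x) * Real.sin (T y) - Real.sin (T x) * Real.cos (T y)
        = Real.sin (T y - T x) := by rw [Real.sin_sub]; ring
    simp only [Function.comp]
    rw [this, Real.arcsin_sin (by linarith [(abs_lt.1 hy).1]) (by linarith [(abs_lt.1 hy).2])]
    ring
  refine temperate_bound_of_fderiv (fun x => (hder x).differentiableAt) ?_
  have : fderiv ℝ T = fun x => Real.cos (T x) • fderiv ℝ (fun x => Real.sin (T x)) x -
      Real.sin (T x) • fderiv ℝ (fun x => Real.cos (T x)) x := funext fun x => (hder x).fderiv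
  rw [this]
  exact (hc.fun_smul (HasTemperateGrowth_fderiv hs)).fun_sub (hs.fun_smul (HasTemperateGrowth_fderiv hc))

/-! ### covering -/

/-- The covering space of the anti-de Sitter quadric in its global chart `(t, x¹, …, x^{d-1})`. -/
abbrev CoverPt (d : ℕ) : Type := ℝ × EuclideanSpace ℝ (Spatial d)

/-- The covering map: `x⁰ = √(1 + |x|²) sin t`, `x^d = √(1 + |x|²) cos t`, other coordinates unchanged. -/
def chi (d : ℕ) (p : CoverPt d) : Amb d := fun μ =>
  if h₀ : μ = 0 then √(1 + ‖p.2‖ ^ 2) * Real.sin p.1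
  else if h₁ : μ = Fin.last d then √(1 + ‖p.2‖ ^ 2) * Real.cos p.1
  else p.2 ⟨μ, h₀, h₁⟩

lemma sum_split {d : ℕ} (hd : 2 ≤ d) (f : Fin (d + 1) → ℝ) :
    ∑ μ, f μ = f 0 + f (Fin.last d) + ∑ i : Spatial d, f i := by
  have h0 : (Fin.last d) ≠ 0 := by
    intro h; have := congrArg Fin.val h; simp at this; omega
  rw [← Finset.add_sum_erase Finset.univ f (Finset.mem_univ 0),
    ← Finset.add_sum_erase (Finset.univ.erase 0) f (a := Fin.last d) (by simp [h0]), add_assoc]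
  congr 2
  rw [Finset.sum_subtype (p := fun μ => μ ≠ 0 ∧ μ ≠ Fin.last d)]
  intro x; simp [and_comm]

lemma last_ne_zero {d : ℕ} (hd : 2 ≤ d) : Fin.last d ≠ 0 := by
  intro h; have := congrArg Fin.val h; simp at this; omega

lemma form_self_split {d : ℕ} (hd : 2 ≤ d) (x : Amb d) :
    form x x = x 0 ^ 2 + x (Fin.last d) ^ 2 - ∑ i : Spatial d, x i ^ 2 := by
  rw [form, sum_split hd]
  have : ∀ i : Spatial d, sgn d i * x i * x i = - x i ^ 2 := fun i => by
    simp [sgn, i.2.1, i.2.2]; ring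
  simp only [this, Finset.sum_neg_distrib]
  simp [sgn]; ring

lemma chi_zero {d : ℕ} (p : CoverPt d) : chi d p 0 = √(1 + ‖p.2‖ ^ 2) * Real.sin p.1 := by
  simp [chi]
lemma chi_last {d : ℕ} (hd : 2 ≤ d) (p : CoverPt d) :
    chi d p (Fin.last d) = √(1 + ‖p.2‖ ^ 2) * Real.cos p.1 := by
  simp [chi, last_ne_zero hd]
lemma chi_spatial {d : ℕ} (p : CoverPt d) (i : Spatial d) : chi d p i = p.2 i := by
  simp [chi, i.2.1, i.2.2]

lemma form_chi {d : ℕ} (hd : 2 ≤ d) (p : CoverPt d) : form (chi d p) (chi d p) = 1 := by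
  rw [form_self_split hd, chi_zero, chi_last hd]
  simp only [chi_spatial]
  have h1 : √(1 + ‖p.2‖ ^ 2) ^ 2 = 1 + ‖p.2‖ ^ 2 := Real.sq_sqrt (by positivity)
  have h2 : ‖p.2‖ ^ 2 = ∑ i, p.2 i ^ 2 := by simp [EuclideanSpace.norm_sq_eq]
  have h3 := Real.sin_sq_add_cos_sq p.1
  rw [mul_pow, mul_pow, h1, ← h2]
  linear_combination (1 + ‖p.2‖ ^ 2) * h3

lemma continuous_chi (d : ℕ) : Continuous (chi d) := by
  refine continuous_pi fun μ => ?_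
  by_cases h₀ : μ = 0
  · simp only [chi, h₀, dif_pos]; fun_prop
  by_cases h₁ : μ = Fin.last d
  · simp only [chi, h₁, dif_pos]
    split_ifs <;> fun_prop
  · simp only [chi, h₀, h₁, dif_neg, not_false_eq_true]; fun_prop

/-- The function `z^d - i z⁰`, equal to `√(1 + |x|²) exp(-it)` at the real point `(t, x)`. -/
def clock {d : ℕ} (z : AmbC d) : ℂ := z (Fin.last d) - Complex.I * z 0

/-- A real vector seen as a complex one. -/
def toC {d : ℕ} (x : Amb d) : AmbC d := fun μ => (x μ : ℂ)

/-- A real matrix seen as a complex one. -/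
def matC {d : ℕ} (M : Matrix (Fin (d + 1)) (Fin (d + 1)) ℝ) :
    Matrix (Fin (d + 1)) (Fin (d + 1)) ℂ := M.map Complex.ofReal

/-- The change of `ζ`, where `exp(-iζ) = z^d - i z⁰`, along the path `u ↦ exp(uA) z`,
`0 ≤ u ≤ 1`, on which `z^d - i z⁰` does not vanish. -/
def clockShift {d : ℕ} (A : Matrix (Fin (d + 1)) (Fin (d + 1)) ℂ) (z : AmbC d) : ℂ :=
  Complex.I * ∫ u in (0 : ℝ)..1, clock (A *ᵥ (NormedSpace.exp ((u : ℂ) • A) *ᵥ z)) /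
    clock (NormedSpace.exp ((u : ℂ) • A) *ᵥ z)

section
attribute [local instance] Matrix.linftyOpNormedRing Matrix.linftyOpNormedAlgebra

lemma map_exp_matrix {d : ℕ} (f : Matrix (Fin (d + 1)) (Fin (d + 1)) ℝ →+*
    Matrix (Fin (d + 1)) (Fin (d + 1)) ℂ) (hf : Continuous f)
    (M : Matrix (Fin (d + 1)) (Fin (d + 1)) ℝ) :
    f (NormedSpace.exp M) = NormedSpace.exp (f M) := by
  let : NormedAlgebra ℚ (Matrix (Fin (d + 1)) (Fin (d + 1)) ℝ) := .restrictScalars ℚ ℝ _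
  exact NormedSpace.map_exp f hf M

end

lemma toC_mulVec {d : ℕ} (M : Matrix (Fin (d + 1)) (Fin (d + 1)) ℝ) (x : Amb d) :
    matC M *ᵥ toC x = toC (M *ᵥ x) := by
  ext μ; simp [matC, toC, Matrix.mulVec, dotProduct]

lemma exp_matC {d : ℕ} (M : Matrix (Fin (d + 1)) (Fin (d + 1)) ℝ) :
    NormedSpace.exp (matC M) = matC (NormedSpace.exp M) := by
  have hc : Continuous (Complex.ofRealHom.mapMatrix (m := Fin (d + 1))) :=
    continuous_id.matrix_map Complex.continuous_ofReal
  exact (map_exp_matrix (Complex.ofRealHom.mapMatrix (m := Fin (d + 1))) hc M).symm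

lemma clockShift_toC {d : ℕ} (M : Matrix (Fin (d + 1)) (Fin (d + 1)) ℝ) (x : Amb d) :
    clockShift (matC M) (toC x) = Complex.I * ∫ u in (0 : ℝ)..1,
      clock (toC (M *ᵥ (NormedSpace.exp (u • M) *ᵥ x))) /
        clock (toC (NormedSpace.exp (u • M) *ᵥ x)) := by
  have : ∀ u : ℝ, (u : ℂ) • matC M = matC (u • M) := fun u => by ext i j; simp [matC]
  simp only [clockShift, this, exp_matC, toC_mulVec]

lemma clock_ne_zero {d : ℕ} (hd : 2 ≤ d) {x : Amb d} (hx : form x x = 1) :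
    clock (toC x) ≠ 0 := by
  intro h
  have h1 : x (Fin.last d) = 0 := by simpa [clock, toC] using congrArg Complex.re h
  have h2 : x 0 = 0 := by simpa [clock, toC] using congrArg Complex.im h
  rw [form_self_split hd, h1, h2] at hx
  have : 0 ≤ ∑ i : Spatial d, x i ^ 2 := Finset.sum_nonneg fun _ _ => sq_nonneg _
  linarith

lemma form_exp_smul {d : ℕ} (M : lieAlg d) (s : ℝ) (x : Amb d) :
    form (NormedSpace.exp (s • M.1) *ᵥ x) (NormedSpace.exp (s • M.1) *ᵥ x) = form x x :=
  exp_form (s • M) x x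

/-- `exp M` on the covering space: the endpoint of the lift of `u ↦ exp(uM) x`, `0 ≤ u ≤ 1`. -/
def coverFlow {d : ℕ} (M : lieAlg d) (p : CoverPt d) : CoverPt d :=
  (p.1 + (clockShift (matC M.1) (toC (chi d p))).re,
    WithLp.toLp 2 fun i => (NormedSpace.exp M.1 *ᵥ chi d p) i)

lemma continuous_clock {d : ℕ} : Continuous fun x : Amb d => clock (toC x) := by
  unfold clock toC; fun_prop

lemma continuous_exp_smul_mulVec {d : ℕ} (M : Matrix (Fin (d + 1)) (Fin (d + 1)) ℝ) :
    Continuous fun q : Amb d × ℝ => NormedSpace.exp (q.2 • M) *ᵥ q.1 :=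
  Continuous.matrix_mulVec ((continuous_exp_smul M).comp continuous_snd) continuous_fst

lemma continuous_rate {d : ℕ} (hd : 2 ≤ d) (M : lieAlg d) :
    Continuous fun q : CoverPt d × ℝ =>
      clock (toC (M.1 *ᵥ (NormedSpace.exp (q.2 • M.1) *ᵥ chi d q.1))) /
        clock (toC (NormedSpace.exp (q.2 • M.1) *ᵥ chi d q.1)) := by
  have h : Continuous fun q : CoverPt d × ℝ => NormedSpace.exp (q.2 • M.1) *ᵥ chi d q.1 :=
    (continuous_exp_smul_mulVec M.1).comp
      (((continuous_chi d).comp continuous_fst).prodMk continuous_snd)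
  refine (continuous_clock.comp (continuous_const.matrix_mulVec h)).div (continuous_clock.comp h)
    fun q => clock_ne_zero hd ?_
  rw [form_exp_smul, form_chi hd]

lemma continuous_coverFlow {d : ℕ} (hd : 2 ≤ d) (M : lieAlg d) : Continuous (coverFlow M) := by
  have h1 := intervalIntegral.continuous_parametric_intervalIntegral_of_continuous'
    (μ := volume) (f := fun (p : CoverPt d) (u : ℝ) =>
      clock (toC (M.1 *ᵥ (NormedSpace.exp (u • M.1) *ᵥ chi d p))) /
        clock (toC (NormedSpace.exp (u • M.1) *ᵥ chi d p))) (continuous_rate hd M) 0 1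
  unfold coverFlow
  simp only [clockShift_toC]
  have h2 : Continuous fun p : CoverPt d => NormedSpace.exp M.1 *ᵥ chi d p :=
    continuous_const.matrix_mulVec (continuous_chi d)
  refine Continuous.prodMk (continuous_fst.add (Complex.continuous_re.comp
    (continuous_const.mul h1))) ?_
  exact (PiLp.continuous_toLp 2 _).comp (continuous_pi fun i => (continuous_apply _).comp h2)

lemma clock_chi {d : ℕ} (hd : 2 ≤ d) (p : CoverPt d) :
    clock (toC (chi d p)) = √(1 + ‖p.2‖ ^ 2) * Complex.exp (-Complex.I * p.1) := by
  rw [show -Complex.I * (p.1 : ℂ) = ((-p.1 : ℝ) : ℂ) * Complex.I by push_cast; ring,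
    Complex.exp_mul_I, ← Complex.ofReal_cos, ← Complex.ofReal_sin]
  simp only [clock, toC, chi_zero, chi_last hd, Real.cos_neg, Real.sin_neg]
  push_cast; ring

lemma clock_exp {d : ℕ} (hd : 2 ≤ d) (M : lieAlg d) {x : Amb d} (hx : form x x = 1) :
    clock (toC (NormedSpace.exp M.1 *ᵥ x)) =
      clock (toC x) * Complex.exp (-Complex.I * clockShift (matC M.1) (toC x)) := by
  rw [clockShift_toC]
  set w : ℝ → ℂ := fun s => clock (toC (NormedSpace.exp (s • M.1) *ᵥ x)) with hw
  set w' : ℝ → ℂ := fun s => clock (toC (M.1 *ᵥ (NormedSpace.exp (s • M.1) *ᵥ x))) with hw'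
  have hne : ∀ s, w s ≠ 0 := fun s => clock_ne_zero hd (by rw [form_exp_smul, hx])
  have hder : ∀ s, HasDerivAt w (w' s) s := fun s => by
    have h1 := (hasDerivAt_exp_smul_mulVec M.1 x s (Fin.last d)).ofReal_comp
    have h2 := (hasDerivAt_exp_smul_mulVec M.1 x s 0).ofReal_comp
    exact h1.sub (h2.const_mul Complex.I)
  have hcy : Continuous fun s : ℝ => NormedSpace.exp (s • M.1) *ᵥ x :=
    (continuous_exp_smul_mulVec M.1).comp (continuous_const.prodMk continuous_id)
  have hcont : Continuous fun s => w' s / w s :=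
    (continuous_clock.comp (continuous_const.matrix_mulVec hcy)).div
      (continuous_clock.comp hcy) hne
  have hZ : ∀ s, HasDerivAt (fun s => ∫ u in (0 : ℝ)..s, w' u / w u) (w' s / w s) s := fun s =>
    intervalIntegral.integral_hasDerivAt_right (hcont.intervalIntegrable _ _)
      (hcont.stronglyMeasurableAtFilter _ _) hcont.continuousAt
  have hH : ∀ s, HasDerivAt (fun s => w s * Complex.exp (-∫ u in (0 : ℝ)..s, w' u / w u)) 0 s := by
    intro s
    refine ((hder s).mul ((hZ s).neg.cexp)).congr_deriv ?_
    have h := div_mul_cancel₀ (w' s) (hne s)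
    simp only [Pi.neg_apply]
    linear_combination (-Complex.exp (-∫ u in (0 : ℝ)..s, w' u / w u)) * h
  have hconst := is_const_of_deriv_eq_zero (fun s => (hH s).differentiableAt)
    (fun s => (hH s).deriv) 1 0
  simp only [intervalIntegral.integral_same, neg_zero, Complex.exp_zero, mul_one] at hconst
  have e1 : w 1 = clock (toC (NormedSpace.exp M.1 *ᵥ x)) := by simp [hw]
  have e0 : w 0 = clock (toC x) := by simp [hw]
  rw [← e1, ← e0, ← hconst, mul_assoc, ← Complex.exp_add]
  have : -(∫ u in (0 : ℝ)..1, w' u / w u) + -Complex.I * (Complex.I * ∫ u in (0 : ℝ)..1, w' u / w u)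
      = 0 := by
    linear_combination -(∫ u in (0 : ℝ)..1, w' u / w u) * Complex.I_mul_I
  rw [this]; simp

lemma chi_coverFlow {d : ℕ} (hd : 2 ≤ d) (M : lieAlg d) (p : CoverPt d) :
    chi d (coverFlow M p) = NormedSpace.exp M.1 *ᵥ chi d p := by
  set y := NormedSpace.exp M.1 *ᵥ chi d p with hy
  have hform : form y y = 1 := by rw [hy, exp_form, form_chi hd]
  have hsp : ∀ i : Spatial d, (coverFlow M p).2 i = y i := fun i => rfl
  have hr : √(1 + ‖(coverFlow M p).2‖ ^ 2) = ‖clock (toC y)‖ := by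
    rw [EuclideanSpace.norm_sq_eq]
    have h1 : ‖clock (toC y)‖ ^ 2 = y 0 ^ 2 + y (Fin.last d) ^ 2 := by
      rw [← Complex.normSq_eq_norm_sq, Complex.normSq_apply]
      simp [clock, toC]; ring
    rw [form_self_split hd] at hform
    rw [← Real.sqrt_sq (norm_nonneg (clock (toC y))), h1]
    congr 1
    simp only [hsp, Real.norm_eq_abs, sq_abs]
    linarith
  have hpol : clock (toC y) = ‖clock (toC y)‖ *
      Complex.exp (-Complex.I * (coverFlow M p).1) := by
    have h := clock_exp hd M (form_chi hd p)
    rw [← hy, clock_chi hd, mul_assoc, ← Complex.exp_add] at h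
    set Z := clockShift (matC M.1) (toC (chi d p)) with hZ
    have e : -Complex.I * (p.1 : ℂ) + -Complex.I * Z =
        ((Z.im : ℝ) : ℂ) + -Complex.I * ((p.1 + Z.re : ℝ) : ℂ) := by
      conv_lhs => rw [← Complex.re_add_im Z]
      push_cast
      linear_combination -(Z.im : ℂ) * Complex.I_mul_I
    have hn : ‖clock (toC y)‖ = √(1 + ‖p.2‖ ^ 2) * Real.exp Z.im := by
      rw [h, e, Complex.exp_add, norm_mul, norm_mul, Complex.norm_exp, Complex.norm_exp,
        Complex.norm_real, Real.norm_of_nonneg (Real.sqrt_nonneg _)]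
      simp
    rw [hn, h, e, Complex.exp_add]
    push_cast
    simp only [coverFlow]
    push_cast
    ring
  rw [← hr, ← clock_chi hd] at hpol
  ext μ
  by_cases h₀ : μ = 0
  · subst h₀
    have := congrArg Complex.im hpol
    simpa [clock, toC] using this.symm
  by_cases h₁ : μ = Fin.last d
  · subst h₁
    have := congrArg Complex.re hpol
    simpa [clock, toC] using this.symm
  · exact (chi_spatial _ ⟨μ, h₀, h₁⟩).trans (hsp ⟨μ, h₀, h₁⟩)

lemma coverFlow_neg {d : ℕ} (hd : 2 ≤ d) (M : lieAlg d) (p : CoverPt d) :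
    coverFlow (-M) (coverFlow M p) = p := by
  have hinv : ∀ x : Amb d, NormedSpace.exp (-M.1) *ᵥ (NormedSpace.exp M.1 *ᵥ x) = x := fun x => by
    rw [Matrix.mulVec_mulVec,
      ← Matrix.exp_add_of_commute _ _ (Commute.neg_left (Commute.refl M.1))]; simp
  ext i
  · show (coverFlow M p).1 + (clockShift (matC (-M.1)) (toC (chi d (coverFlow M p)))).re = p.1
    rw [chi_coverFlow hd]
    show p.1 + (clockShift (matC M.1) (toC (chi d p))).re + _ = p.1
    rw [clockShift_toC, clockShift_toC]
    set k : ℝ → ℂ := fun u => clock (toC (M.1 *ᵥ (NormedSpace.exp (u • M.1) *ᵥ chi d p))) /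
        clock (toC (NormedSpace.exp (u • M.1) *ᵥ chi d p)) with hk
    have h1 : ∀ u : ℝ, NormedSpace.exp (u • -M.1) *ᵥ (NormedSpace.exp M.1 *ᵥ chi d p) =
        NormedSpace.exp ((1 - u) • M.1) *ᵥ chi d p := fun u => by
      rw [Matrix.mulVec_mulVec, ← Matrix.exp_add_of_commute]
      · congr 2; module
      · exact ((Commute.refl M.1).neg_left).smul_left u
    have h2 : ∀ x : Amb d, clock (toC ((-M.1) *ᵥ x)) = - clock (toC (M.1 *ᵥ x)) := fun x => by
      simp [clock, toC, Matrix.neg_mulVec]; ring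
    have h3 : (∫ u in (0 : ℝ)..1, clock (toC ((-M.1) *ᵥ (NormedSpace.exp (u • -M.1) *ᵥ
        (NormedSpace.exp M.1 *ᵥ chi d p)))) / clock (toC (NormedSpace.exp (u • -M.1) *ᵥ
        (NormedSpace.exp M.1 *ᵥ chi d p)))) = - ∫ u in (0 : ℝ)..1, k u := by
      simp only [h1, h2, neg_div, intervalIntegral.integral_neg]
      congr 1
      exact (intervalIntegral.integral_comp_sub_left k (1 : ℝ) (a := 0) (b := 1)).trans (by simp)
    rw [h3]
    simp
  · show (NormedSpace.exp (-M.1) *ᵥ chi d (coverFlow M p)) i = p.2 i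
    rw [chi_coverFlow hd, hinv, chi_spatial]

/-- The exponential map into the group acting on the covering space. -/
def coverExp {d : ℕ} (hd : 2 ≤ d) (M : lieAlg d) : isometries (chi d) :=
  ⟨{ toFun := coverFlow M
     invFun := coverFlow (-M)
     left_inv := coverFlow_neg hd M
     right_inv := fun p => by simpa using coverFlow_neg hd (-M) p
     continuous_toFun := continuous_coverFlow hd M
     continuous_invFun := continuous_coverFlow hd (-M) },
   expGL M, expGL_mem M, chi_coverFlow hd M⟩


lemma temperate_radius (r : ℝ) {E : Type*} [NormedAddCommGroup E] [NormedSpace ℝ E] {d : ℕ}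
    {X : E → EuclideanSpace ℝ (Spatial d)} (hX : X.HasTemperateGrowth) :
    (fun e => (1 + ‖X e‖ ^ 2) ^ r).HasTemperateGrowth :=
  (Function.hasTemperateGrowth_one_add_norm_sq_rpow (EuclideanSpace ℝ (Spatial d)) r).comp hX

lemma temperate_chi {d : ℕ} (μ : Fin (d + 1)) :
    (fun p : CoverPt d => chi d p μ).HasTemperateGrowth := by
  have h2 : (fun p : CoverPt d => p.2).HasTemperateGrowth :=
    (ContinuousLinearMap.snd ℝ ℝ (EuclideanSpace ℝ (Spatial d))).hasTemperateGrowth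
  have h1 : (fun p : CoverPt d => p.1).HasTemperateGrowth :=
    (ContinuousLinearMap.fst ℝ ℝ (EuclideanSpace ℝ (Spatial d))).hasTemperateGrowth
  have hr : (fun p : CoverPt d => √(1 + ‖p.2‖ ^ 2)).HasTemperateGrowth := by
    simp only [Real.sqrt_eq_rpow]
    exact temperate_radius _ h2
  by_cases h₀ : μ = 0
  · simp only [chi, h₀, dif_pos]
    exact hr.fun_mul (temperate_sin_cos.1.comp h1)
  by_cases h₁ : μ = Fin.last d
  · simp only [chi, h₁, dif_pos]
    split_ifs
    · exact hr.fun_mul (temperate_sin_cos.1.comp h1)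
    · exact hr.fun_mul (temperate_sin_cos.2.comp h1)
  · simp only [chi, h₀, h₁, dif_neg, not_false_eq_true]
    exact (EuclideanSpace.proj (𝕜 := ℝ) (⟨μ, h₀, h₁⟩ : Spatial d)).hasTemperateGrowth.comp h2

lemma temperate_euclidean {E : Type*} [NormedAddCommGroup E] [NormedSpace ℝ E] {ι : Type*}
    [Fintype ι] [DecidableEq ι] {X : E → EuclideanSpace ℝ ι}
    (h : ∀ i, (fun e => X e i).HasTemperateGrowth) : X.HasTemperateGrowth := by
  have : X = fun e => ∑ i, (X e i) • (EuclideanSpace.single i (1 : ℝ)) := by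
    ext e j; simp [Pi.single_apply]
  rw [this]
  exact Function.HasTemperateGrowth.sum fun i _ => (h i).fun_smul (.const _)

lemma temperate_cover_isometry {d : ℕ} (hd : 2 ≤ d) (φ : isometries (chi d)) :
    Function.HasTemperateGrowth (φ.1 : CoverPt d → CoverPt d) := by
  obtain ⟨φ, Λ, -, hΛ⟩ := φ
  have hc : ∀ μ, (fun p => chi d (φ p) μ).HasTemperateGrowth := fun μ => by
    have : (fun p => chi d (φ p) μ) = fun p => ∑ ν, Λ.1 μ ν * chi d p ν := by
      ext p; rw [hΛ]; rfl
    rw [this]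
    exact Function.HasTemperateGrowth.sum fun ν _ =>
      (Function.HasTemperateGrowth.const _).fun_mul (temperate_chi ν)
  have hX : (fun p => (φ p).2).HasTemperateGrowth :=
    temperate_euclidean fun i => by simpa only [chi_spatial] using hc i
  have hr := temperate_radius (-(1 / 2)) hX
  have hne : ∀ p, (1 + ‖(φ p).2‖ ^ 2) ^ (-(1 / 2) : ℝ) * √(1 + ‖(φ p).2‖ ^ 2) = 1 := fun p => by
    have : (0 : ℝ) < 1 + ‖(φ p).2‖ ^ 2 := by positivity
    rw [Real.sqrt_eq_rpow, ← Real.rpow_add this]; simp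
  have hT : (fun p => (φ p).1).HasTemperateGrowth := by
    refine temperate_angle (continuous_fst.comp φ.continuous) ?_ ?_
    · have := hr.fun_mul (hc 0)
      simp only [chi_zero, ← mul_assoc, hne, one_mul] at this
      exact this
    · have := hr.fun_mul (hc (Fin.last d))
      simp only [chi_last hd, ← mul_assoc, hne, one_mul] at this
      exact this
  have : (φ : CoverPt d → CoverPt d) = fun p =>
      ContinuousLinearMap.inl ℝ ℝ (EuclideanSpace ℝ (Spatial d)) (φ p).1 +
      ContinuousLinearMap.inr ℝ ℝ (EuclideanSpace ℝ (Spatial d)) (φ p).2 := by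
    ext p <;> simp
  show Function.HasTemperateGrowth (φ : CoverPt d → CoverPt d)
  rw [this]
  exact ((ContinuousLinearMap.hasTemperateGrowth _).comp hT).fun_add
    ((ContinuousLinearMap.hasTemperateGrowth _).comp hX)

lemma cover_isometry_bound {d : ℕ} (hd : 2 ≤ d) (φ : isometries (chi d)) :
    ∃ (k : ℕ) (C : ℝ), ∀ p : CoverPt d, ‖p‖ ≤ C * (1 + ‖φ.1 p‖) ^ k := by
  obtain ⟨k, C, h⟩ := (temperate_cover_isometry hd φ⁻¹).2 0
  refine ⟨k, C, fun p => ?_⟩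
  have := h (φ.1 p)
  rw [norm_iteratedFDeriv_zero] at this
  rwa [show (φ⁻¹).1 (φ.1 p) = p from φ.1.symm_apply_apply p] at this


/-! ### space-times -/

/-- A space-time over the quadric, with a global chart for Schwartz functions and a complexification.
`vol` is the invariant measure, `chart` a proper embedding of the space-time in the vector space
`Chart`; `sheet` is the complexified space-time (or its covering) inside the vector space `Cplx`,
`projC` its projection to `ℂ^{d+1}`, `incl` the inclusion of the real space-time, and `flow A`
transports a point along `u ↦ exp(uA)`, `0 ≤ u ≤ 1`. Only the two instances `pureSpacetime` and
`coverSpacetime` below are used. -/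
structure Spacetime (d : ℕ) where
  Pt : Type
  [topPt : TopologicalSpace Pt]
  [measPt : MeasurableSpace Pt]
  vol : Measure Pt
  proj : Pt → Amb d
  spacelike : Pt → Pt → Prop
  exp : lieAlg d → isometries proj
  Chart : Type
  [normedChart : NormedAddCommGroup Chart]
  [spaceChart : NormedSpace ℝ Chart]
  chart : Pt → Chart
  temperate : ∀ φ : isometries proj, ∃ g : Chart → Chart, g.HasTemperateGrowth ∧
    (∃ (k : ℕ) (C : ℝ), ∀ x, ‖x‖ ≤ C * (1 + ‖g x‖) ^ k) ∧ ∀ p, g (chart p) = chart (φ.1 p)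
  Cplx : Type
  [normedCplx : NormedAddCommGroup Cplx]
  [spaceCplx : NormedSpace ℂ Cplx]
  [starCplx : Star Cplx]
  projC : Cplx → AmbC d
  sheet : Set Cplx
  incl : Pt → Cplx
  flow : Matrix (Fin (d + 1)) (Fin (d + 1)) ℂ → Cplx → Cplx

attribute [instance] Spacetime.topPt Spacetime.measPt Spacetime.normedChart Spacetime.spaceChart
  Spacetime.normedCplx Spacetime.spaceCplx Spacetime.starCplx

/-- The anti-de Sitter quadric `X_d = {x : (x, x) = 1}`. -/
abbrev PurePt (d : ℕ) : Type := {x : Amb d // form x x = 1}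

/-- The exponential map into `G₀`, acting on the quadric. -/
def pureExp {d : ℕ} (M : lieAlg d) : isometries (Subtype.val : PurePt d → Amb d) :=
  ⟨{ toFun := fun x => ⟨NormedSpace.exp M.1 *ᵥ x.1, (exp_form M _ _).trans x.2⟩
     invFun := fun x => ⟨NormedSpace.exp (-M).1 *ᵥ x.1, (exp_form (-M) _ _).trans x.2⟩
     left_inv := fun x => Subtype.ext <| by
       show NormedSpace.exp (-M.1) *ᵥ (NormedSpace.exp M.1 *ᵥ x.1) = x.1
       rw [Matrix.mulVec_mulVec,
         ← Matrix.exp_add_of_commute _ _ (Commute.neg_left (Commute.refl M.1))]; simp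
     right_inv := fun x => Subtype.ext <| by
       show NormedSpace.exp M.1 *ᵥ (NormedSpace.exp (-M.1) *ᵥ x.1) = x.1
       rw [Matrix.mulVec_mulVec,
         ← Matrix.exp_add_of_commute _ _ (Commute.neg_right (Commute.refl M.1))]; simp
     continuous_toFun := (continuous_const.matrix_mulVec continuous_subtype_val).subtype_mk _
     continuous_invFun := (continuous_const.matrix_mulVec continuous_subtype_val).subtype_mk _ },
   expGL M, expGL_mem M, fun _ => rfl⟩

lemma pure_temperate {d : ℕ} (φ : isometries (Subtype.val : PurePt d → Amb d)) :
    ∃ g : Amb d → Amb d, g.HasTemperateGrowth ∧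
    (∃ (k : ℕ) (C : ℝ), ∀ x, ‖x‖ ≤ C * (1 + ‖g x‖) ^ k) ∧ ∀ p : PurePt d, g p.1 = (φ.1 p).1 := by
  obtain ⟨φ, Λ, -, hΛ⟩ := φ
  let L : Amb d →L[ℝ] Amb d := LinearMap.toContinuousLinearMap (Matrix.mulVecLin Λ.1)
  let L' : Amb d →L[ℝ] Amb d := LinearMap.toContinuousLinearMap (Matrix.mulVecLin Λ⁻¹.1)
  refine ⟨L, L.hasTemperateGrowth, ⟨1, ‖L'‖, fun x => ?_⟩, fun p => (hΛ p).symm⟩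
  have h : L' (L x) = x := by simp [L, L', Matrix.mulVec_mulVec]
  calc ‖x‖ = ‖L' (L x)‖ := by rw [h]
    _ ≤ ‖L'‖ * ‖L x‖ := L'.le_opNorm _
    _ ≤ ‖L'‖ * (1 + ‖L x‖) ^ 1 := by gcongr; linarith

/-- The complex quadric. -/
def quadricC (d : ℕ) : Set (AmbC d) := {z | formC z z = 1}

/-- The anti-de Sitter quadric. Its invariant measure is `dt dx¹ … dx^{d-1}`; `x` and `y` are
space-like separated when `(x - y, x - y) < 0`, that is `(x, y) > 1`. -/
def pureSpacetime {d : ℕ} (hd : 2 ≤ d) : Spacetime d where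
  Pt := PurePt d
  vol := (volume.restrict (Set.Ioc (-Real.pi) Real.pi ×ˢ Set.univ)).map
    fun p : CoverPt d => (⟨chi d p, form_chi hd p⟩ : PurePt d)
  proj := Subtype.val
  spacelike x y := 1 < form x.1 y.1
  exp := pureExp
  Chart := Amb d
  chart := Subtype.val
  temperate := pure_temperate
  Cplx := AmbC d
  projC := id
  sheet := quadricC d
  incl x := toC x.1
  flow A z := NormedSpace.exp A *ᵥ z

/-- The covering of the quadric. A point of the complexification is a pair `(z, ζ)` with
`exp(-iζ) = z^d - i z⁰`, so that `ζ` is a logarithm of `z^d - i z⁰`; over a real point with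
coordinates `(t, x)` it is `t + i log √(1 + |x|²)`. -/
def coverSpacetime {d : ℕ} (hd : 2 ≤ d) : Spacetime d where
  Pt := CoverPt d
  vol := volume
  proj := chi d
  spacelike p q := 1 < form (chi d p) (chi d q) ∧ |p.1 - q.1| < Real.pi
  exp := coverExp hd
  Chart := CoverPt d
  chart := id
  temperate φ := ⟨φ.1, temperate_cover_isometry hd φ, cover_isometry_bound hd φ, fun _ => rfl⟩
  Cplx := AmbC d × ℂ
  projC := Prod.fst
  sheet := {z | z.1 ∈ quadricC d ∧ Complex.exp (-Complex.I * z.2) = clock z.1}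
  incl p := (toC (chi d p), p.1 + Complex.I * Real.log √(1 + ‖p.2‖ ^ 2))
  flow A z := (NormedSpace.exp A *ᵥ z.1, z.2 + clockShift A z.1)

/-- The two cases treated: the quadric itself and its covering. -/
inductive Kind
  | pure
  | cover

/-- The space-time under consideration. -/
def spacetime {d : ℕ} (hd : 2 ≤ d) : Kind → Spacetime d
  | .pure => pureSpacetime hd
  | .cover => coverSpacetime hd

/-! ### test functions -/

section Schwartz

lemma schwartz_tensor {E : Type*} [NormedAddCommGroup E] [NormedSpace ℝ E] {n m : ℕ}
    (F : 𝓢(Fin n → E, ℂ)) (G : 𝓢(Fin m → E, ℂ)) :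
    ∃ H : 𝓢(Fin (n + m) → E, ℂ), ∀ x, H x =
      F (fun j => x (Fin.castAdd m j)) * G (fun j => x (Fin.natAdd n j)) := by
  let L : (Fin (n + m) → E) →L[ℝ] (Fin n → E) :=
    ContinuousLinearMap.pi fun j => ContinuousLinearMap.proj (Fin.castAdd m j)
  let R : (Fin (n + m) → E) →L[ℝ] (Fin m → E) :=
    ContinuousLinearMap.pi fun j => ContinuousLinearMap.proj (Fin.natAdd n j)
  have hFL : ContDiff ℝ ∞ fun x => F (L x) := (F.smooth ⊤).comp L.contDiff
  have hGR : ContDiff ℝ ∞ fun x => G (R x) := (G.smooth ⊤).comp R.contDiff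
  refine ⟨⟨fun x => F (L x) * G (R x), hFL.mul hGR, fun k N => ?_⟩, fun x => rfl⟩
  have hx : ∀ x : Fin (n + m) → E, ‖x‖ ≤ (1 + ‖L x‖) * (1 + ‖R x‖) := fun x => by
    have h1 : ‖x‖ ≤ ‖L x‖ + ‖R x‖ := by
      refine (pi_norm_le_iff_of_nonneg (by positivity)).2 fun i => ?_
      refine Fin.addCases (fun j => ?_) (fun j => ?_) i
      · exact (norm_le_pi_norm (L x) j).trans (by simp)
      · exact (norm_le_pi_norm (R x) j).trans (by simp)
    nlinarith [norm_nonneg (L x), norm_nonneg (R x), mul_nonneg (norm_nonneg (L x)) (norm_nonneg (R x))]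
  have hF : ∀ i, ∃ C, 0 ≤ C ∧ ∀ x, (1 + ‖L x‖) ^ k * ‖iteratedFDeriv ℝ i (fun x => F (L x)) x‖ ≤ C := by
    intro i
    refine ⟨2 ^ k * ((Finset.Iic (k, i)).sup fun m => SchwartzMap.seminorm ℝ m.1 m.2) F * ‖L‖ ^ i,
      by positivity, fun x => ?_⟩
    have h1 := SchwartzMap.one_add_le_sup_seminorm_apply (𝕜 := ℝ) (m := (k, i)) le_rfl le_rfl F (L x)
    have h2 : ‖iteratedFDeriv ℝ i (fun x => F (L x)) x‖ ≤ ‖iteratedFDeriv ℝ i F (L x)‖ * ‖L‖ ^ i := by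
      have := L.iteratedFDeriv_comp_right (F.smooth ⊤) x (i := i) (by exact_mod_cast le_top)
      rw [show (fun x => F (L x)) = F ∘ L from rfl, this]
      refine (ContinuousMultilinearMap.norm_compContinuousLinearMap_le _ _).trans_eq (by simp)
    calc _ ≤ (1 + ‖L x‖) ^ k * (‖iteratedFDeriv ℝ i F (L x)‖ * ‖L‖ ^ i) := by gcongr
      _ = ((1 + ‖L x‖) ^ k * ‖iteratedFDeriv ℝ i F (L x)‖) * ‖L‖ ^ i := by ring
      _ ≤ _ := by gcongr
  have hG : ∀ i, ∃ C, 0 ≤ C ∧ ∀ x, (1 + ‖R x‖) ^ k * ‖iteratedFDeriv ℝ i (fun x => G (R x)) x‖ ≤ C := by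
    intro i
    refine ⟨2 ^ k * ((Finset.Iic (k, i)).sup fun m => SchwartzMap.seminorm ℝ m.1 m.2) G * ‖R‖ ^ i,
      by positivity, fun x => ?_⟩
    have h1 := SchwartzMap.one_add_le_sup_seminorm_apply (𝕜 := ℝ) (m := (k, i)) le_rfl le_rfl G (R x)
    have h2 : ‖iteratedFDeriv ℝ i (fun x => G (R x)) x‖ ≤ ‖iteratedFDeriv ℝ i G (R x)‖ * ‖R‖ ^ i := by
      have := R.iteratedFDeriv_comp_right (G.smooth ⊤) x (i := i) (by exact_mod_cast le_top)
      rw [show (fun x => G (R x)) = G ∘ R from rfl, this]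
      refine (ContinuousMultilinearMap.norm_compContinuousLinearMap_le _ _).trans_eq (by simp)
    calc _ ≤ (1 + ‖R x‖) ^ k * (‖iteratedFDeriv ℝ i G (R x)‖ * ‖R‖ ^ i) := by gcongr
      _ = ((1 + ‖R x‖) ^ k * ‖iteratedFDeriv ℝ i G (R x)‖) * ‖R‖ ^ i := by ring
      _ ≤ _ := by gcongr
  choose CF hCF0 hCF using hF
  choose CG hCG0 hCG using hG
  refine ⟨∑ i ∈ Finset.range (N + 1), (N.choose i : ℝ) * CF i * CG (N - i), fun x => ?_⟩
  have hmul := norm_iteratedFDeriv_mul_le hFL hGR x (n := N) (by exact_mod_cast le_top)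
  calc ‖x‖ ^ k * ‖iteratedFDeriv ℝ N (fun x => F (L x) * G (R x)) x‖
      ≤ ((1 + ‖L x‖) * (1 + ‖R x‖)) ^ k * ∑ i ∈ Finset.range (N + 1), (N.choose i : ℝ) *
        ‖iteratedFDeriv ℝ i (fun x => F (L x)) x‖ *
        ‖iteratedFDeriv ℝ (N - i) (fun x => G (R x)) x‖ := by
        gcongr; exact hx x
    _ = ∑ i ∈ Finset.range (N + 1), (N.choose i : ℝ) *
        ((1 + ‖L x‖) ^ k * ‖iteratedFDeriv ℝ i (fun x => F (L x)) x‖) *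
        ((1 + ‖R x‖) ^ k * ‖iteratedFDeriv ℝ (N - i) (fun x => G (R x)) x‖) := by
        rw [Finset.mul_sum]
        refine Finset.sum_congr rfl fun i _ => ?_
        rw [mul_pow]; ring
    _ ≤ _ := by
        gcongr with i hi
        · exact mul_nonneg (by positivity) (hCF0 i)
        · exact hCF i x
        · exact hCG (N - i) x

lemma schwartz_conj {E : Type*} [NormedAddCommGroup E] [NormedSpace ℝ E] (F : 𝓢(E, ℂ)) :
    ∃ H : 𝓢(E, ℂ), ∀ x, H x = (starRingEnd ℂ) (F x) :=
  ⟨SchwartzMap.postcompCLM (𝕜 := ℝ) (Complex.conjCLE : ℂ →L[ℝ] ℂ) F, fun _ => rfl⟩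

lemma schwartz_perm {E : Type*} [NormedAddCommGroup E] [NormedSpace ℝ E] {n : ℕ}
    (σ : Equiv.Perm (Fin n)) (F : 𝓢(Fin n → E, ℂ)) :
    ∃ H : 𝓢(Fin n → E, ℂ), ∀ x, H x = F (fun j => x (σ j)) :=
  ⟨SchwartzMap.compCLMOfContinuousLinearEquiv ℂ
    (ContinuousLinearEquiv.piCongrLeft ℝ (fun _ => E) σ).symm F, fun x => by
      simp only [SchwartzMap.compCLMOfContinuousLinearEquiv_apply, Function.comp]
      rfl⟩

lemma schwartz_pi {E : Type*} [NormedAddCommGroup E] [NormedSpace ℝ E] {n : ℕ}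
    (g : Fin n → E → E) (hg : ∀ j, (g j).HasTemperateGrowth)
    (hb : ∀ j, ∃ (k : ℕ) (C : ℝ), ∀ x, ‖x‖ ≤ C * (1 + ‖g j x‖) ^ k) (F : 𝓢(Fin n → E, ℂ)) :
    ∃ H : 𝓢(Fin n → E, ℂ), ∀ x, H x = F (fun j => g j (x j)) := by
  have h1 : (fun (x : Fin n → E) j => g j (x j)).HasTemperateGrowth := by
    have : (fun (x : Fin n → E) j => g j (x j)) = fun x =>
        ∑ i, ContinuousLinearMap.single ℝ (fun _ : Fin n => E) i (g i (x i)) := by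
      ext x j
      simp [Finset.sum_apply, Pi.single_apply]
    rw [this]
    refine Function.HasTemperateGrowth.sum fun i _ => ?_
    exact (ContinuousLinearMap.hasTemperateGrowth _).comp
      ((hg i).comp (ContinuousLinearMap.proj (R := ℝ) (φ := fun _ : Fin n => E) i).hasTemperateGrowth)
  choose k C hC using hb
  have h2 : ∃ (k : ℕ) (C : ℝ), ∀ x : Fin n → E, ‖x‖ ≤ C * (1 + ‖fun j => g j (x j)‖) ^ k := by
    refine ⟨∑ j, k j, ∑ j, |C j|, fun x => ?_⟩
    refine (pi_norm_le_iff_of_nonneg (by positivity)).2 fun i => (hC i (x i)).trans ?_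
    have ha : ‖g i (x i)‖ ≤ ‖fun j => g j (x j)‖ := norm_le_pi_norm (fun j => g j (x j)) i
    have hb : C i ≤ ∑ j, |C j| := (le_abs_self _).trans
      (Finset.single_le_sum (f := fun j => |C j|) (fun _ _ => abs_nonneg _) (Finset.mem_univ i))
    have hc : k i ≤ ∑ j, k j := Finset.single_le_sum (fun _ _ => Nat.zero_le _) (Finset.mem_univ i)
    calc C i * (1 + ‖g i (x i)‖) ^ k i ≤ (∑ j, |C j|) * (1 + ‖fun j => g j (x j)‖) ^ k i := by
          gcongr
      _ ≤ _ := by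
          gcongr
          simp
  exact ⟨SchwartzMap.compCLM ℂ h1 h2 F, fun _ => rfl⟩

end Schwartz

variable {d : ℕ} (𝒳 : Spacetime d)

/-- Restriction of functions of the chart variables to the space-time. -/
def restrict (n : ℕ) : 𝓢(Fin n → 𝒳.Chart, ℂ) →ₗ[ℂ] ((Fin n → 𝒳.Pt) → ℂ) where
  toFun F x := F fun j => 𝒳.chart (x j)
  map_add' _ _ := rfl
  map_smul' _ _ := rfl

/-- Schwartz functions on `n` copies of the space-time (restrictions of Schwartz functions in the
chart), with the quotient topology. -/
def TestFn (n : ℕ) : Type := LinearMap.range (restrict 𝒳 n)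

instance (n : ℕ) : AddCommGroup (TestFn 𝒳 n) :=
  inferInstanceAs (AddCommGroup (LinearMap.range (restrict 𝒳 n)))
instance (n : ℕ) : Module ℂ (TestFn 𝒳 n) :=
  inferInstanceAs (Module ℂ (LinearMap.range (restrict 𝒳 n)))
instance (n : ℕ) : TopologicalSpace (TestFn 𝒳 n) :=
  TopologicalSpace.coinduced (restrict 𝒳 n).rangeRestrict inferInstance
instance (n : ℕ) : FunLike (TestFn 𝒳 n) (Fin n → 𝒳.Pt) ℂ where
  coe f := f.1
  coe_injective _ _ h := Subtype.ext h

variable {𝒳}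

@[ext] lemma TestFn.ext {n : ℕ} {f g : TestFn 𝒳 n} (h : ∀ x, f x = g x) : f = g :=
  DFunLike.ext _ _ h

@[simp] lemma TestFn.add_apply {n : ℕ} (f g : TestFn 𝒳 n) (x : Fin n → 𝒳.Pt) :
    (f + g) x = f x + g x := rfl
@[simp] lemma TestFn.smul_apply {n : ℕ} (c : ℂ) (f : TestFn 𝒳 n) (x : Fin n → 𝒳.Pt) :
    (c • f) x = c * f x := rfl

/-- A test function, from a function that has a Schwartz extension. -/
def TestFn.mk {n : ℕ} (f : (Fin n → 𝒳.Pt) → ℂ)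
    (hf : ∃ F : 𝓢(Fin n → 𝒳.Chart, ℂ), ∀ x, F (fun j => 𝒳.chart (x j)) = f x) : TestFn 𝒳 n :=
  ⟨f, hf.imp fun _ h => funext h⟩

lemma TestFn.exists_ext {n : ℕ} (f : TestFn 𝒳 n) :
    ∃ F : 𝓢(Fin n → 𝒳.Chart, ℂ), ∀ x, F (fun j => 𝒳.chart (x j)) = f x := by
  obtain ⟨F, hF⟩ := f.2
  exact ⟨F, fun x => congrFun hF x⟩

/-- The tensor product of test functions. -/
def TestFn.tensor {n m : ℕ} (f : TestFn 𝒳 n) (g : TestFn 𝒳 m) : TestFn 𝒳 (n + m) :=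
  .mk (fun x => f (fun j => x (Fin.castAdd m j)) * g (fun j => x (Fin.natAdd n j))) <| by
    obtain ⟨F, hF⟩ := f.exists_ext
    obtain ⟨G, hG⟩ := g.exists_ext
    obtain ⟨H, hH⟩ := schwartz_tensor F G
    exact ⟨H, fun x => by rw [hH, ← hF, ← hG]⟩

/-- Permutation of the arguments. -/
def TestFn.perm {n : ℕ} (σ : Equiv.Perm (Fin n)) (f : TestFn 𝒳 n) : TestFn 𝒳 n :=
  .mk (fun x => f (fun j => x (σ j))) <| by
    obtain ⟨F, hF⟩ := f.exists_ext
    obtain ⟨H, hH⟩ := schwartz_perm σ F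
    exact ⟨H, fun x => by rw [hH, ← hF]⟩

/-- `f^⋆(x₁, …, xₙ)` is the conjugate of `f(xₙ, …, x₁)`. -/
def TestFn.star {n : ℕ} (f : TestFn 𝒳 n) : TestFn 𝒳 n :=
  .mk (fun x => (starRingEnd ℂ) (f (fun j => x (Fin.rev j)))) <| by
    obtain ⟨F, hF⟩ := (f.perm Fin.revPerm).exists_ext
    obtain ⟨H, hH⟩ := schwartz_conj F
    exact ⟨H, fun x => by rw [hH, hF]; rfl⟩

/-- `f_{Λ₁, …, Λₙ}(x₁, …, xₙ) = f(Λ₁⁻¹x₁, …, Λₙ⁻¹xₙ)`. -/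
def TestFn.act {n : ℕ} (φ : Fin n → isometries 𝒳.proj) (f : TestFn 𝒳 n) : TestFn 𝒳 n :=
  .mk (fun x => f (fun j => (φ j)⁻¹.1 (x j))) <| by
    obtain ⟨F, hF⟩ := f.exists_ext
    choose g hg hb he using fun j => 𝒳.temperate (φ j)⁻¹
    obtain ⟨H, hH⟩ := schwartz_pi g hg hb F
    exact ⟨H, fun x => by rw [hH, ← hF]; simp only [he]⟩

variable (𝒳) in
/-- The constant `1`, as a function of no variables. -/
def TestFn.one : TestFn 𝒳 0 :=
  .mk (fun _ => 1) ⟨HasCompactSupport.toSchwartzMap (f := fun _ => (1 : ℂ))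
    (HasCompactSupport.of_compactSpace _) contDiff_const, fun _ => rfl⟩


/-! ### Borchers algebra -/

variable (𝒳) in
/-- The Borchers algebra: terminating sequences `(f₀, f₁, f₂, …)` of test functions; functions of
no variables are scalars. -/
abbrev Borchers : Type := DirectSum ℕ fun n => TestFn 𝒳 n

/-- The tensor product as a bilinear map. -/
def tensorLM (n m : ℕ) : TestFn 𝒳 n →ₗ[ℂ] TestFn 𝒳 m →ₗ[ℂ] TestFn 𝒳 (n + m) :=
  LinearMap.mk₂ ℂ TestFn.tensor
    (fun _ _ _ => TestFn.ext fun _ => add_mul _ _ _)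
    (fun _ _ _ => TestFn.ext fun _ => mul_assoc _ _ _)
    (fun _ _ _ => TestFn.ext fun _ => mul_add _ _ _)
    (fun _ _ _ => TestFn.ext fun _ => mul_left_comm _ _ _)

namespace Borchers

/-- The product of the Borchers algebra. -/
def mul : Borchers 𝒳 →ₗ[ℂ] Borchers 𝒳 →ₗ[ℂ] Borchers 𝒳 :=
  DirectSum.toModule ℂ ℕ _ fun n => LinearMap.flip <| DirectSum.toModule ℂ ℕ _ fun m =>
    ((tensorLM n m).compr₂ (DirectSum.lof ℂ ℕ (fun n => TestFn 𝒳 n) (n + m))).flip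

/-- The star operation in degree `n`. -/
def starHom (n : ℕ) : TestFn 𝒳 n →+ TestFn 𝒳 n where
  toFun := TestFn.star
  map_zero' := TestFn.ext fun _ => map_zero (starRingEnd ℂ)
  map_add' f g := TestFn.ext fun x =>
    map_add (starRingEnd ℂ) (f fun j => x j.rev) (g fun j => x j.rev)

/-- The star operation of the Borchers algebra. -/
def star : Borchers 𝒳 →+ Borchers 𝒳 := DirectSum.map starHom

/-- The action of a group element in degree `n`. -/
def actLM (φ : isometries 𝒳.proj) (n : ℕ) : TestFn 𝒳 n →ₗ[ℂ] TestFn 𝒳 n where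
  toFun f := f.act fun _ => φ
  map_add' _ _ := TestFn.ext fun _ => rfl
  map_smul' _ _ := TestFn.ext fun _ => rfl

/-- The action `f ↦ f_{Λ}` on the Borchers algebra. -/
def act (φ : isometries 𝒳.proj) : Borchers 𝒳 →ₗ[ℂ] Borchers 𝒳 :=
  DirectSum.lmap (actLM φ)

variable (𝒳) in
/-- The unit of the Borchers algebra. -/
def one : Borchers 𝒳 := DirectSum.lof ℂ ℕ (fun n => TestFn 𝒳 n) 0 (TestFn.one 𝒳)

lemma mul_lof {n m : ℕ} (f : TestFn 𝒳 n) (g : TestFn 𝒳 m) :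
    mul (DirectSum.lof ℂ ℕ (fun n => TestFn 𝒳 n) n f) (DirectSum.lof ℂ ℕ (fun n => TestFn 𝒳 n) m g) =
      DirectSum.lof ℂ ℕ (fun n => TestFn 𝒳 n) (n + m) (f.tensor g) := by
  simp [mul, DirectSum.toModule_lof, tensorLM]

lemma star_lof {n : ℕ} (f : TestFn 𝒳 n) :
    star (DirectSum.lof ℂ ℕ (fun n => TestFn 𝒳 n) n f) =
      DirectSum.lof ℂ ℕ (fun n => TestFn 𝒳 n) n f.star :=
  DirectSum.map_of (f := starHom) n f

lemma act_lof (φ : isometries 𝒳.proj) {n : ℕ} (f : TestFn 𝒳 n) :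
    act φ (DirectSum.lof ℂ ℕ (fun n => TestFn 𝒳 n) n f) =
      DirectSum.lof ℂ ℕ (fun n => TestFn 𝒳 n) n (f.act fun _ => φ) :=
  DirectSum.lmap_lof _ _ _

lemma induction {p : Borchers 𝒳 → Prop} (f : Borchers 𝒳) (h0 : p 0)
    (h1 : ∀ n (g : TestFn 𝒳 n), p (DirectSum.lof ℂ ℕ (fun n => TestFn 𝒳 n) n g))
    (h2 : ∀ f g, p f → p g → p (f + g)) : p f :=
  DirectSum.induction_on f h0 (fun n g => h1 n g) h2

lemma star_smul (c : ℂ) (f : Borchers 𝒳) : star (c • f) = (starRingEnd ℂ) c • star f := by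
  induction f using induction with
  | h0 => simp
  | h1 n g =>
    rw [← map_smul, star_lof, star_lof, ← map_smul]
    congr 1
    exact TestFn.ext fun x => map_mul (starRingEnd ℂ) c (g fun j => x j.rev)
  | h2 f g hf hg => rw [smul_add, map_add, hf, hg, map_add, smul_add]

lemma act_star (φ : isometries 𝒳.proj) (f : Borchers 𝒳) : act φ (star f) = star (act φ f) := by
  induction f using induction with
  | h0 => simp
  | h1 n g => rw [star_lof, act_lof, act_lof, star_lof]; rfl
  | h2 f g hf hg => simp only [map_add, hf, hg]

lemma act_mul (φ : isometries 𝒳.proj) (f g : Borchers 𝒳) :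
    act φ (mul f g) = mul (act φ f) (act φ g) := by
  induction f using induction with
  | h0 => simp
  | h2 f g hf hg => simp only [map_add, LinearMap.add_apply, hf, hg]
  | h1 n f =>
    induction g using induction with
    | h0 => simp
    | h2 f g hf hg => simp only [map_add, hf, hg]
    | h1 m g => rw [mul_lof, act_lof, act_lof, act_lof, mul_lof]; rfl

end Borchers

/-! ### Wightman functionals -/

variable (𝒳) in
/-- A continuous linear functional on the Borchers algebra, given by its components. -/
structure WightmanFunctional where
  W : ∀ n, TestFn 𝒳 n →L[ℂ] ℂ

namespace WightmanFunctional

variable (𝒲 : WightmanFunctional 𝒳)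

/-- The value `⟨𝒲, f⟩`. -/
def eval : Borchers 𝒳 →ₗ[ℂ] ℂ := DirectSum.toModule ℂ ℕ ℂ fun n => (𝒲.W n).toLinearMap

/-- Normalization `𝒲₀ = 1`, that is `⟨𝒲, 1⟩ = 1`. -/
def Normalized : Prop := 𝒲.eval (Borchers.one 𝒳) = 1

/-- Covariance. -/
def Covariant : Prop :=
  ∀ (n : ℕ) (φ : isometries 𝒳.proj) (f : TestFn 𝒳 n), 𝒲.W n (f.act fun _ => φ) = 𝒲.W n f

/-- Locality: neighbouring arguments commute at space-like separation. -/
def Locality : Prop :=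
  ∀ (n : ℕ) (i j : Fin n), i.val + 1 = j.val → ∀ f : TestFn 𝒳 n,
    (∀ x ∈ tsupport f, 𝒳.spacelike (x i) (x j)) → 𝒲.W n (f.perm (Equiv.swap i j)) = 𝒲.W n f

/-- Positive definiteness: `⟨𝒲, f^⋆ f⟩ ≥ 0`. -/
def PosDef : Prop :=
  ∀ f : Borchers 𝒳, 0 ≤ (𝒲.eval (Borchers.mul (Borchers.star f) f)).re ∧
    (𝒲.eval (Borchers.mul (Borchers.star f) f)).im = 0

lemma eval_act (hcov : 𝒲.Covariant) (φ : isometries 𝒳.proj) (f : Borchers 𝒳) :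
    𝒲.eval (Borchers.act φ f) = 𝒲.eval f := by
  induction f using Borchers.induction with
  | h0 => simp
  | h1 n g =>
    rw [Borchers.act_lof]
    simp only [eval, DirectSum.toModule_lof]
    exact hcov n φ g
  | h2 f g hf hg => simp only [map_add, hf, hg]

set_option linter.unusedVariables false in
/-- The Borchers algebra, to be equipped with the semi-inner product `⟨𝒲, f^⋆ g⟩`. -/
def PreGNS (hpos : 𝒲.PosDef) : Type := Borchers 𝒳

variable {𝒲} in
instance (hpos : 𝒲.PosDef) : AddCommGroup (𝒲.PreGNS hpos) :=
  inferInstanceAs (AddCommGroup (Borchers 𝒳))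
variable {𝒲} in
instance (hpos : 𝒲.PosDef) : Module ℂ (𝒲.PreGNS hpos) :=
  inferInstanceAs (Module ℂ (Borchers 𝒳))

/-- The identity map to `PreGNS`. -/
def toPre (hpos : 𝒲.PosDef) : Borchers 𝒳 ≃ₗ[ℂ] 𝒲.PreGNS hpos := LinearEquiv.refl ℂ _

/-- The sesquilinear form `⟨𝒲, f^⋆ g⟩`. -/
def sesq (f g : Borchers 𝒳) : ℂ := 𝒲.eval (Borchers.mul (Borchers.star f) g)

lemma sesq_symm (hpos : 𝒲.PosDef) (f g : Borchers 𝒳) :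
    (starRingEnd ℂ) (𝒲.sesq g f) = 𝒲.sesq f g := by
  have hadd : ∀ a b c : Borchers 𝒳, 𝒲.sesq (a + b) c = 𝒲.sesq a c + 𝒲.sesq b c := fun a b c => by
    simp [sesq]
  have hadd' : ∀ a b c : Borchers 𝒳, 𝒲.sesq a (b + c) = 𝒲.sesq a b + 𝒲.sesq a c := fun a b c => by
    simp [sesq]
  have hs : ∀ (c : ℂ) (a b : Borchers 𝒳), 𝒲.sesq (c • a) b = (starRingEnd ℂ) c * 𝒲.sesq a b :=
    fun c a b => by simp [sesq, Borchers.star_smul]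
  have hs' : ∀ (c : ℂ) (a b : Borchers 𝒳), 𝒲.sesq a (c • b) = c * 𝒲.sesq a b :=
    fun c a b => by simp [sesq]
  have him : ∀ a : Borchers 𝒳, (𝒲.sesq a a).im = 0 := fun a => (hpos a).2
  have h1 := him (f + g)
  have h2 := him (f + Complex.I • g)
  simp only [hadd, hadd', hs, hs', Complex.add_im, him, Complex.conj_I, Complex.mul_im,
    Complex.neg_re, Complex.neg_im, Complex.I_re, Complex.I_im, Complex.mul_re] at h1 h2
  apply Complex.ext
  · simp only [Complex.conj_re]; linarith
  · simp only [Complex.conj_im]; linarith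

/-- The semi-inner product `⟨𝒲, f^⋆ g⟩`. -/
abbrev preCore (hpos : 𝒲.PosDef) : PreInnerProductSpace.Core ℂ (𝒲.PreGNS hpos) where
  inner f g := 𝒲.sesq ((𝒲.toPre hpos).symm f) ((𝒲.toPre hpos).symm g)
  conj_inner_symm f g := 𝒲.sesq_symm hpos _ _
  re_inner_nonneg f := (hpos ((𝒲.toPre hpos).symm f)).1
  add_left f g h := by simp [sesq]
  smul_left f g c := by simp [sesq, Borchers.star_smul]

variable {𝒲} in
instance (hpos : 𝒲.PosDef) : SeminormedAddCommGroup (𝒲.PreGNS hpos) :=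
  InnerProductSpace.Core.toSeminormedAddCommGroup (c := 𝒲.preCore hpos)
variable {𝒲} in
instance (hpos : 𝒲.PosDef) : InnerProductSpace ℂ (𝒲.PreGNS hpos) :=
  InnerProductSpace.ofCore (𝒲.preCore hpos)

/-- The Hilbert space of the GNS construction: the Hausdorff completion of the Borchers algebra. -/
abbrev GNS (hpos : 𝒲.PosDef) : Type := UniformSpace.Completion (𝒲.PreGNS hpos)

/-- The vector `Φ(f)Ω` -/
def vec (hpos : 𝒲.PosDef) (f : Borchers 𝒳) : 𝒲.GNS hpos := (𝒲.toPre hpos f : 𝒲.PreGNS hpos)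

/-- The vacuum vector `Ω`. -/
def vacuum (hpos : 𝒲.PosDef) : 𝒲.GNS hpos := 𝒲.vec hpos (Borchers.one 𝒳)

/-- The isometry of the pre-Hilbert space induced by a group element. -/
def preU (hpos : 𝒲.PosDef) (hcov : 𝒲.Covariant) (φ : isometries 𝒳.proj) :
    𝒲.PreGNS hpos →ₗᵢ[ℂ] 𝒲.PreGNS hpos where
  toLinearMap := (𝒲.toPre hpos).toLinearMap ∘ₗ Borchers.act φ ∘ₗ (𝒲.toPre hpos).symm.toLinearMap
  norm_map' f := by
    rw [← sq_eq_sq₀ (norm_nonneg _) (norm_nonneg _), ← inner_self_eq_norm_sq (𝕜 := ℂ),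
      ← inner_self_eq_norm_sq (𝕜 := ℂ)]
    congr 1
    show 𝒲.eval (Borchers.mul (Borchers.star (Borchers.act φ _)) (Borchers.act φ _)) = _
    rw [← Borchers.act_star, ← Borchers.act_mul, 𝒲.eval_act hcov]
    rfl

/-- The representation `U(Λ)`, with `U(Λ) Φ(f)Ω = Φ(f_{Λ})Ω`. -/
def U (hpos : 𝒲.PosDef) (hcov : 𝒲.Covariant) (φ : isometries 𝒳.proj) :
    𝒲.GNS hpos →L[ℂ] 𝒲.GNS hpos :=
  (𝒲.preU hpos hcov φ).toContinuousLinearMap.completion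

/-- Uniqueness of the vacuum: the `U`-invariant vectors are the multiples of `Ω`. -/
def UniqueVacuum (hpos : 𝒲.PosDef) (hcov : 𝒲.Covariant) : Prop :=
  {Ψ : 𝒲.GNS hpos | ∀ φ : isometries 𝒳.proj, 𝒲.U hpos hcov φ Ψ = Ψ} = (ℂ ∙ 𝒲.vacuum hpos)

/-- The strong spectral condition: for `M ∈ 𝒞₊` the generator of `t ↦ U(exp tM)` is non-negative,
expressed through Fourier transforms of test functions supported in `(-∞, 0)`. -/
def StrongSpectral (hpos : 𝒲.PosDef) (hcov : 𝒲.Covariant) : Prop :=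
  ∀ M ∈ conePlus d, ∀ Ψ : 𝒲.GNS hpos, ∀ φ : ℝ → ℂ, ContDiff ℝ ∞ φ → HasCompactSupport φ →
    tsupport φ ⊆ Set.Iio 0 →
    ∫ t : ℝ, (∫ p : ℝ, φ p * Complex.exp (-Complex.I * t * p)) •
      𝒲.U hpos hcov (𝒳.exp (t • M)) Ψ = 0

end WightmanFunctional

/-- `G₀⁺`: products of one or more `exp(τM)` with `Im τ > 0`, `M ∈ 𝒞₊`. -/
def semigroupPlus (d : ℕ) : Subsemigroup (Matrix (Fin (d + 1)) (Fin (d + 1)) ℂ) :=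
  Subsemigroup.closure {A | ∃ τ : ℂ, 0 < τ.im ∧ ∃ M ∈ conePlus d, A = NormedSpace.exp (τ • matC M.1)}

/-- The future tuboid `𝒯_{n+}`: `z_j = Λ₁ ⋯ Λ_j c_j` with `Λ_j ∈ G₀⁺` and `c_j` real. -/
def tuboid (d n : ℕ) : Set (Fin n → AmbC d) :=
  {z | ∃ Λ : Fin n → Matrix (Fin (d + 1)) (Fin (d + 1)) ℂ, (∀ j, Λ j ∈ semigroupPlus d) ∧
    ∃ c : Fin n → PurePt d, ∀ j, z j = Fin.partialProd Λ j.succ *ᵥ toC (c j).1}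

/-- `𝒯_{m-} × 𝒯_{n+}`, where `𝒯_{m-}` is the complex conjugate of `𝒯_{m+}`. -/
def tuboidPair (d m n : ℕ) : Set ((Fin m → AmbC d) × (Fin n → AmbC d)) :=
  {p | Star.star p.1 ∈ tuboid d m ∧ p.2 ∈ tuboid d n}

namespace Spacetime

variable (𝒳)

/-- The tuboid over the space-time: for the covering, the preimage of `𝒯_{n+}`. -/
def liftedTuboid (n : ℕ) : Set (Fin n → 𝒳.Cplx) :=
  {z | (∀ j, z j ∈ 𝒳.sheet) ∧ (fun j => 𝒳.projC (z j)) ∈ tuboid d n}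

/-- `𝒯_{m-} × 𝒯_{n+}` over the space-time. -/
def liftedTuboidPair (m n : ℕ) : Set ((Fin m → 𝒳.Cplx) × (Fin n → 𝒳.Cplx)) :=
  {p | (fun j => Star.star (p.1 j)) ∈ 𝒳.liftedTuboid m ∧ p.2 ∈ 𝒳.liftedTuboid n}

/-- Projection of a pair of complex configurations to the ambient space. -/
def projPair {m n : ℕ} (p : (Fin m → 𝒳.Cplx) × (Fin n → 𝒳.Cplx)) :
    (Fin m → AmbC d) × (Fin n → AmbC d) :=
  (fun j => 𝒳.projC (p.1 j), fun j => 𝒳.projC (p.2 j))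

/-- Distance, in the complex quadric, to the complement of `𝒯_{m-} × 𝒯_{n+}`. -/
def boundaryDist {m n : ℕ} (p : (Fin m → 𝒳.Cplx) × (Fin n → 𝒳.Cplx)) : ℝ :=
  Metric.infDist (𝒳.projPair p)
    (({z | ∀ j, z j ∈ quadricC d} ×ˢ {z | ∀ j, z j ∈ quadricC d}) \ tuboidPair d m n)

/-- At most polynomial growth at infinity and at the boundary. -/
def TemperedGrowth {m n : ℕ} (F : (Fin m → 𝒳.Cplx) × (Fin n → 𝒳.Cplx) → ℂ) : Prop :=
  ∃ (C : ℝ) (k : ℕ), ∀ p ∈ 𝒳.liftedTuboidPair m n,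
    ‖F p‖ ≤ C * (1 + ‖p‖) ^ k * (1 + (𝒳.boundaryDist p)⁻¹) ^ k

/-- Holomorphy on `𝒯_{m-} × 𝒯_{n+}` (a complex submanifold of a vector space): locally the
restriction of a holomorphic function of the ambient variables. -/
def HolomorphicPair {m n : ℕ} (F : (Fin m → 𝒳.Cplx) × (Fin n → 𝒳.Cplx) → ℂ) : Prop :=
  ∀ p ∈ 𝒳.liftedTuboidPair m n, ∃ V : Set ((Fin m → 𝒳.Cplx) × (Fin n → 𝒳.Cplx)),
    IsOpen V ∧ p ∈ V ∧ ∃ H : (Fin m → 𝒳.Cplx) × (Fin n → 𝒳.Cplx) → ℂ,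
      DifferentiableOn ℂ H V ∧ ∀ q ∈ V ∩ 𝒳.liftedTuboidPair m n, F q = H q

/-- `exp(iεM₁) ⋯ exp(iεM_j) c`, for the `j`-th variable (`j` counted from `0` in the code). -/
def pathPoint {n : ℕ} (M : Fin n → lieAlg d) (ε : ℝ) (j : Fin n) (c : 𝒳.Pt) : 𝒳.Cplx :=
  ((List.ofFn M).take (j + 1)).foldr
    (fun N z => 𝒳.flow ((Complex.I * ε) • matC N.1) z) (𝒳.incl c)

/-- The point of `𝒯_{m-} × 𝒯_{n+}` above the real configuration `(w_m, …, w₁, z₁, …, zₙ)`: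
`w_j` is moved by the conjugates of `exp(iεN₁) ⋯ exp(iεN_j)`, `z_j` by `exp(iεM₁) ⋯ exp(iεM_j)`. -/
def approach {m n : ℕ} (N : Fin m → lieAlg d) (M : Fin n → lieAlg d) (ε : ℝ)
    (x : Fin (m + n) → 𝒳.Pt) : (Fin m → 𝒳.Cplx) × (Fin n → 𝒳.Cplx) :=
  (fun j => Star.star (𝒳.pathPoint N ε j (x (Fin.castAdd n j.rev))),
    fun j => 𝒳.pathPoint M ε j (x (Fin.natAdd m j)))

end Spacetime

namespace WightmanFunctional

variable (𝒲 : WightmanFunctional 𝒳)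

/-- `𝒲_{m+n}(w_m, …, w₁, z₁, …, zₙ)` is the boundary value of `F(w, z)` from `𝒯_{m-} × 𝒯_{n+}`,
in the sense of tempered distributions. -/
def IsBoundaryValue {m n : ℕ} (F : (Fin m → 𝒳.Cplx) × (Fin n → 𝒳.Cplx) → ℂ) : Prop :=
  ∀ (N : Fin m → lieAlg d) (M : Fin n → lieAlg d), (∀ j, N j ∈ conePlus d) →
    (∀ j, M j ∈ conePlus d) → ∀ f : TestFn 𝒳 (m + n),
    (∀ᶠ ε : ℝ in 𝓝[>] 0, Integrable (fun x => F (𝒳.approach N M ε x) * f x)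
      (Measure.pi fun _ => 𝒳.vol)) ∧
    Tendsto (fun ε : ℝ => ∫ x, F (𝒳.approach N M ε x) * f x ∂(Measure.pi fun _ => 𝒳.vol))
      (𝓝[>] 0) (𝓝 (𝒲.W (m + n) f))

/-- The tempered spectral condition. In the second part, `Φ` is the extension to `Im τ_j ≥ 0` of
`τ ↦ ⟨𝒲ₙ, f_{Λ₁, …, Λₙ}⟩`, `Λ_j = exp(τ₁M₁) ⋯ exp(τ_jM_j)`. -/
def TemperedSpectral : Prop :=
  (∀ m n : ℕ, ∃ F : (Fin m → 𝒳.Cplx) × (Fin n → 𝒳.Cplx) → ℂ,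
    𝒳.HolomorphicPair F ∧ 𝒳.TemperedGrowth F ∧ 𝒲.IsBoundaryValue F) ∧
  ∀ (n : ℕ) (f : TestFn 𝒳 n) (M : Fin n → lieAlg d), (∀ j, M j ∈ coneOne d) →
    ∃ Φ : (Fin n → ℂ) → ℂ,
      (∀ τ : Fin n → ℝ, Φ (fun j => (τ j : ℂ)) =
        𝒲.W n (f.act fun j => Fin.partialProd (fun i => 𝒳.exp (τ i • M i)) j.succ)) ∧
      DifferentiableOn ℂ Φ {τ | ∀ j, 0 < (τ j).im} ∧
      ContDiffOn ℝ ∞ Φ {τ | ∀ j, 0 ≤ (τ j).im} ∧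
      ∃ (C : ℝ) (k : ℕ), ∀ τ : Fin n → ℂ, (∀ j, 0 ≤ (τ j).im) → ‖Φ τ‖ ≤ C * (1 + ‖τ‖) ^ k

end WightmanFunctional

/-- The boost generator `M_{d(d-1)}`. -/
def boostGen (d : ℕ) : lieAlg d := stdGen (Fin.last d) ⟨d - 1, by omega⟩

end AdS

end

noncomputable section
open scoped ContDiff Topology SchwartzMap Matrix
open MeasureTheory Filter

namespace AdS

/-! ### The form, wedge products and exponentials -/

section LieAlgebra

variable {d : ℕ}

/-! In the GNS space the averaged quantity is $(a,u_tb)-(a,\Omega)(\Omega,b)$ with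
$a=\Phi(f)\Omega$, $b=\Phi(g)\Omega$ and $u_t=U(\exp tM_{d(d-1)})$. By the mean ergodic theorem
(`tendsto_correlationMean`) these averages tend to zero as soon as the only vectors fixed by all
$u_t$ are the multiples of $\Omega$. Uniqueness of the vacuum speaks of vectors fixed by the whole
group, so the point is that a vector fixed by the boosts alone is fixed by every isometry
(`StronglyContinuousOnCone.fixed_of_boost`).

This is the Mautner phenomenon. If conjugation by boosts contracts $\exp N$ to the identity, then
$\|U(\exp N)v-v\|$ does not change under the contraction while its limit is zero by strong
continuity, so $\exp N$ fixes $v$. It applies to the root vectors $(a\pm b)\wedge w$ of the boost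
$a\wedge b$, where $w$ is orthogonal to $a$ and $b$. These root vectors, the boost and brackets of
opposite root vectors span the Lie algebra (`span_eq_top_of_roots`), and a subgroup containing the
one-parameter groups of a spanning set is everything (`Spacetime.Regular.eq_top_of_span`). On the
covering the last step also needs the deck transformations, which are time translations by multiples
of $2\pi$ and hence exponentials of $M_{0d}$.

Strong continuity comes from the tempered spectral condition: the extension $\Phi$ is continuous up
to the real boundary, which makes matrix elements continuous along $\exp(tN)$ for $N\in\mathcal C_1$
(`continuous_sesq_act_exp`). Since $\mathcal C_1$ spans the Lie algebra (`span_coneOne`), and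
isometries near the identity are products of small exponentials of any spanning family
(`eventually_eq_expProd`, an inverse function argument), continuity extends to all directions.

Conversely, for an invariant $\Psi$ the averages do not depend on $T$, so if they vanish in the
limit then $(a,\Psi)=(a,\Omega)(\Omega,\Psi)$ for all $a$ in a dense set, that is
$\Psi=(\Omega,\Psi)\Omega$. -/

lemma form_comm (x y : Amb d) : form x y = form y x :=
  Finset.sum_congr rfl fun _ _ => by ring

lemma form_add_left (x y z : Amb d) : form (x + y) z = form x z + form y z := by
  simp only [form, ← Finset.sum_add_distrib]
  exact Finset.sum_congr rfl fun _ _ => by rw [Pi.add_apply]; ring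

lemma form_smul_left (c : ℝ) (x z : Amb d) : form (c • x) z = c * form x z := by
  simp only [form, Finset.mul_sum]
  exact Finset.sum_congr rfl fun _ _ => by rw [Pi.smul_apply, smul_eq_mul]; ring

lemma form_add_right (x y z : Amb d) : form z (x + y) = form z x + form z y := by
  rw [form_comm, form_add_left, form_comm x, form_comm y]

lemma form_smul_right (c : ℝ) (x z : Amb d) : form z (c • x) = c * form z x := by
  rw [form_comm, form_smul_left, form_comm]

lemma form_single (μ : Fin (d + 1)) (x : Amb d) : form (Pi.single μ 1) x = sgn d μ * x μ := by
  simp [form, Pi.single_apply]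

lemma form_single_single (μ ν : Fin (d + 1)) :
    form (Pi.single μ 1 : Amb d) (Pi.single ν 1) = if μ = ν then sgn d μ else 0 := by
  rw [form_single, Pi.single_apply]; simp

lemma wedge_mulVec (a b x : Amb d) :
    (wedge a b).1 *ᵥ x = form b x • a - form a x • b := by
  ext ρ
  simp only [wedge, Matrix.mulVec, dotProduct, Matrix.of_apply, Pi.sub_apply, Pi.smul_apply,
    smul_eq_mul, form, Finset.sum_mul, ← Finset.sum_sub_distrib]
  exact Finset.sum_congr rfl fun _ _ => by ring

lemma wedge_ext {M N : lieAlg d} (h : ∀ x : Amb d, M.1 *ᵥ x = N.1 *ᵥ x) : M = N :=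
  Subtype.ext (Matrix.mulVec_injective (funext h))

lemma wedge_add_left (a a' b : Amb d) : wedge (a + a') b = wedge a b + wedge a' b := by
  refine wedge_ext fun x => ?_
  rw [Submodule.coe_add, Matrix.add_mulVec]
  simp only [wedge_mulVec, form_add_left]; module

lemma wedge_smul_left (c : ℝ) (a b : Amb d) : wedge (c • a) b = c • wedge a b := by
  refine wedge_ext fun x => ?_
  rw [Submodule.coe_smul, Matrix.smul_mulVec]
  simp only [wedge_mulVec, form_smul_left]; module

lemma wedge_swap (a b : Amb d) : wedge a b = -wedge b a := by
  refine wedge_ext fun x => ?_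
  rw [Submodule.coe_neg, Matrix.neg_mulVec]
  simp only [wedge_mulVec]; module

lemma wedge_self (a : Amb d) : wedge a a = 0 := by
  refine wedge_ext fun x => ?_
  simp [wedge_mulVec]

lemma wedge_add_right (a b b' : Amb d) : wedge a (b + b') = wedge a b + wedge a b' := by
  rw [wedge_swap, wedge_add_left, wedge_swap b, wedge_swap b']; abel

lemma wedge_smul_right (c : ℝ) (a b : Amb d) : wedge a (c • b) = c • wedge a b := by
  rw [wedge_swap, wedge_smul_left, wedge_swap b]; simp

/-- The adjoint action on wedge products. -/
lemma conj_wedge {A B : Matrix (Fin (d + 1)) (Fin (d + 1)) ℝ}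
    (hA : ∀ x y : Amb d, form (A *ᵥ x) (A *ᵥ y) = form x y) (hAB : A * B = 1) (a b : Amb d) :
    A * (wedge a b).1 * B = (wedge (A *ᵥ a) (A *ᵥ b)).1 := by
  refine Matrix.mulVec_injective (funext fun x => ?_)
  have h : ∀ c : Amb d, form (A *ᵥ c) x = form c (B *ᵥ x) := fun c => by
    rw [← hA c, Matrix.mulVec_mulVec, hAB, Matrix.one_mulVec]
  rw [← Matrix.mulVec_mulVec, ← Matrix.mulVec_mulVec, wedge_mulVec, wedge_mulVec, h, h,
    Matrix.mulVec_sub, Matrix.mulVec_smul, Matrix.mulVec_smul]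

lemma exp_mul_exp_neg (M : Matrix (Fin (d + 1)) (Fin (d + 1)) ℝ) :
    NormedSpace.exp M * NormedSpace.exp (-M) = 1 := by
  rw [← Matrix.exp_add_of_commute _ _ (Commute.neg_right (Commute.refl M))]; simp

/-- Since $M$ commutes with its exponentials, $e^{-cs}\exp(sM)x$ has zero derivative in $s$. -/
lemma exp_smul_mulVec_eigenvector {M : Matrix (Fin (d + 1)) (Fin (d + 1)) ℝ} {x : Amb d} {c : ℝ}
    (h : M *ᵥ x = c • x) (s : ℝ) :
    NormedSpace.exp (s • M) *ᵥ x = Real.exp (c * s) • x := by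
  have hcomm : ∀ s : ℝ, M *ᵥ (NormedSpace.exp (s • M) *ᵥ x) = c • (NormedSpace.exp (s • M) *ᵥ x) := by
    intro s
    rw [Matrix.mulVec_mulVec, (((Commute.refl M).smul_right s).exp_right).eq,
      ← Matrix.mulVec_mulVec, h, Matrix.mulVec_smul]
  ext μ
  have hd : ∀ s, HasDerivAt
      (fun s : ℝ => Real.exp (-(c * s)) * (NormedSpace.exp (s • M) *ᵥ x) μ) 0 s := by
    intro s
    have h1 := hasDerivAt_exp_smul_mulVec M x s μ
    have h2 : HasDerivAt (fun s : ℝ => -(c * s)) (-(c * 1)) s :=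
      ((hasDerivAt_id s).const_mul c).neg
    refine (h2.exp.mul h1).congr_deriv ?_
    rw [hcomm, Pi.smul_apply, smul_eq_mul]; ring
  have h0 := is_const_of_deriv_eq_zero (fun s => (hd s).differentiableAt) (fun s => (hd s).deriv) s 0
  simp only [mul_zero, neg_zero, Real.exp_zero, zero_smul, NormedSpace.exp_zero,
    Matrix.one_mulVec, one_mul] at h0
  rw [Pi.smul_apply, smul_eq_mul, ← h0, ← mul_assoc, ← Real.exp_add]; simp

/-- The coefficients are the matrix entries with the second index lowered by the metric; the factor
$1/2$ is there because the sum runs over ordered pairs and so meets each generator twice. -/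
lemma span_stdGen : Submodule.span ℝ (Set.range fun q : Fin (d + 1) × Fin (d + 1) =>
    stdGen q.1 q.2) = ⊤ := by
  refine eq_top_iff.2 fun M _ => ?_
  have h : M = ∑ q : Fin (d + 1) × Fin (d + 1), (1 / 2 * M.1 q.1 q.2 * sgn d q.2) • stdGen q.1 q.2 := by
    ext ρ σ
    have hM : M.1 σ ρ * sgn d σ = -(sgn d ρ * M.1 ρ σ) := by
      have := congrFun (congrFun (show M.1ᵀ * eta d = -(eta d * M.1) from M.2) ρ) σ
      simpa [eta] using this
    have hs : ∀ μ, sgn d μ * sgn d μ = 1 := fun μ => by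
      simp only [sgn]; split_ifs <;> norm_num
    rw [Fintype.sum_prod_type]
    simp only [AddSubmonoidClass.coe_finsetSum, Matrix.sum_apply, Submodule.coe_smul,
      Matrix.smul_apply, stdGen, wedge, Matrix.of_apply, Pi.single_apply, smul_eq_mul]
    simp only [mul_sub, Finset.sum_sub_distrib, mul_ite, mul_one, mul_zero, ite_mul, zero_mul,
      one_mul, Finset.sum_ite_eq, Finset.mem_univ, if_true]
    simp
    have e1 := hs σ
    have e2 := hs ρ
    linear_combination (1 / 2 * sgn d ρ) * hM - (1 / 2 * M.1 ρ σ) * e1 - (1 / 2 * M.1 ρ σ) * e2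
  rw [h]
  exact Submodule.sum_mem _ fun q _ => Submodule.smul_mem _ _ (Submodule.subset_span ⟨q, rfl⟩)

lemma sgn_zero : sgn d 0 = 1 := by simp [sgn]
lemma sgn_last : sgn d (Fin.last d) = 1 := by simp [sgn]
lemma sgn_spatial {i : Fin (d + 1)} (h : i ≠ 0 ∧ i ≠ Fin.last d) : sgn d i = -1 := by
  simp [sgn, h.1, h.2]

end LieAlgebra

/-! ### Spanning sets of the Lie algebra -/

section Spanning

variable {d : ℕ}

/-- Tilting $e_0$ or $e_d$ hyperbolically towards space-like directions stays in $\mathcal C_1$.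
Expanding such wedge products bilinearly and subtracting the generators already obtained yields
$e_0\wedge e_d$, then $e_i\wedge e_d$ and $e_0\wedge e_i$, then $e_i\wedge e_j$. -/
lemma span_coneOne (hd : 2 ≤ d) : Submodule.span ℝ (coneOne d) = ⊤ := by
  set S := Submodule.span ℝ (coneOne d) with hS
  have hl := last_ne_zero hd
  let e : Fin (d + 1) → Amb d := fun μ => Pi.single μ 1
  have hcone : ∀ i j : Fin (d + 1), (i ≠ 0 ∧ i ≠ Fin.last d) → (j ≠ 0 ∧ j ≠ Fin.last d) →
      i ≠ j → ∀ r₁ s₁ r₂ s₂ : ℝ, r₁ ^ 2 - s₁ ^ 2 = 1 → r₂ ^ 2 - s₂ ^ 2 = 1 → 0 < r₁ * r₂ →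
      wedge (r₁ • e 0 + s₁ • e i) (r₂ • e (Fin.last d) + s₂ • e j) ∈ S := by
    intro i j hi hj hij r₁ s₁ r₂ s₂ h₁ h₂ h
    refine Submodule.subset_span ⟨_, _, ?_, ?_, ?_, ?_, rfl⟩
    · simp only [e, form_add_left, form_add_right, form_smul_left, form_smul_right,
        form_single_single, sgn_zero, sgn_spatial hi, hi.1, hi.1.symm, if_true, if_false]
      linarith
    · simp only [e, form_add_left, form_add_right, form_smul_left, form_smul_right,
        form_single_single, sgn_last, sgn_spatial hj, hj.2, hj.2.symm, if_true, if_false]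
      linarith
    · simp only [e, form_add_left, form_add_right, form_smul_left, form_smul_right,
        form_single_single, hl.symm, hi.2, hj.1.symm, hij, if_false]
      ring
    · simpa [e, Pi.single_apply, hl, hl.symm, hi.1.symm, hi.2.symm, hj.1.symm, hj.2.symm] using h
  have hcone' : ∀ i : Fin (d + 1), (i ≠ 0 ∧ i ≠ Fin.last d) → ∀ r s : ℝ, r ^ 2 - s ^ 2 = 1 → 0 < r →
      wedge (r • e 0 + s • e i) (e (Fin.last d)) ∈ S ∧
      wedge (e 0) (r • e (Fin.last d) + s • e i) ∈ S := by
    intro i hi r s h₁ h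
    refine ⟨Submodule.subset_span ⟨_, _, ?_, ?_, ?_, ?_, rfl⟩,
      Submodule.subset_span ⟨_, _, ?_, ?_, ?_, ?_, rfl⟩⟩
    · simp only [e, form_add_left, form_add_right, form_smul_left, form_smul_right,
        form_single_single, sgn_zero, sgn_spatial hi, hi.1, hi.1.symm, if_true, if_false]
      linarith
    · simp only [e, form_single_single, sgn_last, if_true]
    · simp only [e, form_add_left, form_smul_left, form_single_single, hl.symm, hi.2, if_false]
      ring
    · simpa [e, Pi.single_apply, hl, hl.symm, hi.1.symm, hi.2.symm] using h
    · simp only [e, form_single_single, sgn_zero, if_true]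
    · simp only [e, form_add_left, form_add_right, form_smul_left, form_smul_right,
        form_single_single, sgn_last, sgn_spatial hi, hi.2, hi.2.symm, if_true, if_false]
      linarith
    · simp only [e, form_add_right, form_smul_right, form_single_single, hl.symm, hi.1.symm,
        if_false]
      ring
    · simpa [e, Pi.single_apply, hl, hl.symm, hi.1.symm, hi.2.symm] using h
  have h0d : wedge (e 0) (e (Fin.last d)) ∈ S := by
    refine Submodule.subset_span ⟨_, _, ?_, ?_, ?_, ?_, rfl⟩
    · simp only [e, form_single_single, sgn_zero, if_true]
    · simp only [e, form_single_single, sgn_last, if_true]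
    · simp only [e, form_single_single, hl.symm, if_false]
    · simp [e, hl, hl.symm]
  have hcancel : ∀ (M N : lieAlg d) (r s : ℝ), s ≠ 0 → M ∈ S → r • M + s • N ∈ S → N ∈ S := by
    intro M N r s hs hM hN
    have := S.smul_mem s⁻¹ (S.sub_mem hN (S.smul_mem r hM))
    rwa [add_sub_cancel_left, smul_smul, inv_mul_cancel₀ hs, one_smul] at this
  have hid : ∀ i : Fin (d + 1), (i ≠ 0 ∧ i ≠ Fin.last d) → wedge (e i) (e (Fin.last d)) ∈ S := by
    intro i hi
    -- $(5/4,3/4)$ is a rational point of the hyperbola $r^2-s^2=1$ with $s\ne0$.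
    have := (hcone' i hi (5 / 4) (3 / 4) (by norm_num) (by norm_num)).1
    rw [wedge_add_left, wedge_smul_left, wedge_smul_left] at this
    exact hcancel _ _ _ _ (by norm_num) h0d this
  have h0i : ∀ i : Fin (d + 1), (i ≠ 0 ∧ i ≠ Fin.last d) → wedge (e 0) (e i) ∈ S := by
    intro i hi
    have := (hcone' i hi (5 / 4) (3 / 4) (by norm_num) (by norm_num)).2
    rw [wedge_add_right, wedge_smul_right, wedge_smul_right] at this
    exact hcancel _ _ _ _ (by norm_num) h0d this
  have hij : ∀ i j : Fin (d + 1), (i ≠ 0 ∧ i ≠ Fin.last d) → (j ≠ 0 ∧ j ≠ Fin.last d) →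
      wedge (e i) (e j) ∈ S := by
    intro i j hi hj
    by_cases h : i = j
    · rw [h, wedge_self]; exact S.zero_mem
    have := hcone i j hi hj h (5 / 4) (3 / 4) (5 / 4) (3 / 4) (by norm_num) (by norm_num)
      (by norm_num)
    simp only [wedge_add_left, wedge_add_right, wedge_smul_left, wedge_smul_right] at this
    have h2 := S.sub_mem (S.sub_mem (S.sub_mem this (S.smul_mem (5 / 4) (S.smul_mem (5 / 4) h0d)))
      (S.smul_mem (5 / 4) (S.smul_mem (3 / 4) (h0i j hj))))
      (S.smul_mem (3 / 4) (S.smul_mem (5 / 4) (hid i hi)))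
    -- After the three subtractions only $(3/4)^2\,e_i\wedge e_j$ is left.
    refine hcancel 0 _ 0 (9 / 16) (by norm_num) S.zero_mem ?_
    convert h2 using 1
    module
  refine eq_top_iff.2 (span_stdGen.symm.le.trans (Submodule.span_le.2 ?_))
  rintro _ ⟨⟨μ, ν⟩, rfl⟩
  show wedge (e μ) (e ν) ∈ S
  by_cases m0 : μ = 0 <;> by_cases n0 : ν = 0 <;> by_cases ml : μ = Fin.last d <;>
    by_cases nl : ν = Fin.last d
  all_goals first
    | exact hij μ ν ⟨m0, ml⟩ ⟨n0, nl⟩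
    | (subst m0 n0; rw [wedge_self]; exact S.zero_mem)
    | (subst m0 nl; exact h0d)
    | (subst ml n0; rw [wedge_swap]; exact S.neg_mem h0d)
    | (rw [ml, nl, wedge_self]; exact S.zero_mem)
    | (subst m0; exact h0i ν ⟨n0, nl⟩)
    | (subst n0; rw [wedge_swap]; exact S.neg_mem (h0i μ ⟨m0, ml⟩))
    | (subst nl; exact hid μ ⟨m0, ml⟩)
    | (subst ml; rw [wedge_swap]; exact S.neg_mem (hid ν ⟨n0, nl⟩))

/-- Difference quotients of the curve lie in the subspace, which is closed in finite dimension. -/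
lemma mem_of_hasDerivAt {E : Type*} [NormedAddCommGroup E] [NormedSpace ℝ E]
    [FiniteDimensional ℝ E] {S : Submodule ℝ E} {f : ℝ → E} {f' : E} {t : ℝ}
    (hf : ∀ t, f t ∈ S) (h : HasDerivAt f f' t) : f' ∈ S := by
  refine (Submodule.closed_of_finiteDimensional S).mem_of_tendsto (hasDerivAt_iff_tendsto_slope.1 h)
    (Eventually.of_forall fun s => ?_)
  exact S.smul_mem _ (S.sub_mem (hf s) (hf t))

/-- The conclusion is the bracket $[N,a\wedge b]$, the derivative at $t=0$ of the conjugates of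
$a\wedge b$ by $\exp(tN)$. It makes brackets available for a subspace known only to contain these
conjugates. -/
lemma bracket_wedge_mem {S : Submodule ℝ (lieAlg d)} {N : lieAlg d} {a b : Amb d}
    (h : ∀ t : ℝ, wedge (NormedSpace.exp (t • N.1) *ᵥ a) (NormedSpace.exp (t • N.1) *ᵥ b) ∈ S) :
    wedge (N.1 *ᵥ a) b + wedge a (N.1 *ᵥ b) ∈ S := by
  -- Entries are read in a function space so that the derivative can be taken coordinate by
  -- coordinate.
  let L : lieAlg d →ₗ[ℝ] Fin (d + 1) → Fin (d + 1) → ℝ :=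
    (Matrix.ofLinearEquiv ℝ).symm.toLinearMap ∘ₗ (lieAlg d).subtype
  have hv : ∀ (c : Amb d) (μ : Fin (d + 1)),
      HasDerivAt (fun t : ℝ => (NormedSpace.exp (t • N.1) *ᵥ c) μ) ((N.1 *ᵥ c) μ) 0 :=
    fun c μ => by simpa using hasDerivAt_exp_smul_mulVec N.1 c 0 μ
  have hd : HasDerivAt (fun t : ℝ =>
      L (wedge (NormedSpace.exp (t • N.1) *ᵥ a) (NormedSpace.exp (t • N.1) *ᵥ b)))
      (L (wedge (N.1 *ᵥ a) b + wedge a (N.1 *ᵥ b))) 0 := by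
    refine hasDerivAt_pi.2 fun ρ => hasDerivAt_pi.2 fun σ => ?_
    refine ((((hv a ρ).mul ((hv b σ).const_mul (sgn d σ)))).sub
      ((hv b ρ).mul ((hv a σ).const_mul (sgn d σ)))).congr_deriv ?_
    simp [wedge, L]; ring
  obtain ⟨M, hM, he⟩ := mem_of_hasDerivAt (S := S.map L) (fun t => ⟨_, h t, rfl⟩) hd
  have hM' : M = wedge (N.1 *ᵥ a) b + wedge a (N.1 *ᵥ b) := Subtype.ext he
  rwa [← hM']

/-- A conjugation-invariant set containing a boost and its root vectors spans the Lie algebra. -/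
lemma span_eq_top_of_roots {a b : Amb d} {I : Set (lieAlg d)} {μ ν : Fin (d + 1)} (hμν : μ ≠ ν)
    (hμ : sgn d μ = 1) (hν : sgn d ν = -1) (ha : a = Pi.single μ 1) (hb : b = Pi.single ν 1)
    (hK : wedge a b ∈ I)
    (hroot : ∀ c : ℝ, c ^ 2 = 1 → ∀ w : Amb d, form a w = 0 → form b w = 0 → wedge (a + c • b) w ∈ I)
    (hconj : ∀ N ∈ I, ∀ x y : Amb d, wedge x y ∈ I → ∀ t : ℝ,
      wedge (NormedSpace.exp (t • N.1) *ᵥ x) (NormedSpace.exp (t • N.1) *ᵥ y) ∈ I) :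
    Submodule.span ℝ I = ⊤ := by
  set S := Submodule.span ℝ I with hS
  have haa : form a a = 1 := by rw [ha, form_single_single, if_pos rfl, hμ]
  have hbb : form b b = -1 := by rw [hb, form_single_single, if_pos rfl, hν]
  have hab : form a b = 0 := by rw [ha, hb, form_single_single, if_neg hμν]
  have hba : form b a = 0 := by rw [form_comm, hab]
  have hsub : ∀ {N}, N ∈ I → N ∈ S := fun h => Submodule.subset_span h
  -- Half the sum and half the difference of the root vectors for $c=1$ and $c=-1$.
  have hrootS : ∀ w : Amb d, form a w = 0 → form b w = 0 → wedge a w ∈ S ∧ wedge b w ∈ S := by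
    intro w hw hw'
    have h1 := hsub (hroot 1 (by norm_num) w hw hw')
    have h2 := hsub (hroot (-1) (by norm_num) w hw hw')
    rw [wedge_add_left, wedge_smul_left] at h1 h2
    constructor
    · convert S.smul_mem (1 / 2 : ℝ) (S.add_mem h1 h2) using 1; module
    · convert S.smul_mem (1 / 2 : ℝ) (S.sub_mem h1 h2) using 1; module
  -- The bracket of the opposite root vectors $(a+b)\wedge w$ and $(a-b)\wedge w'$ is $-2\,w\wedge
  -- w'+2(w,w')\,a\wedge b$, and $a\wedge b$ is already in the span.
  have hww : ∀ w w' : Amb d, form a w = 0 → form b w = 0 → form a w' = 0 → form b w' = 0 →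
      wedge w w' ∈ S := by
    intro w w' h1 h2 h3 h4
    have hn := hroot 1 (by norm_num) w h1 h2
    have hn' := hroot (-1) (by norm_num) w' h3 h4
    have := bracket_wedge_mem (S := S) fun t => hsub (hconj _ hn _ _ hn' t)
    have e1 : (wedge (a + (1 : ℝ) • b) w).1 *ᵥ (a + (-1 : ℝ) • b) = (-2 : ℝ) • w := by
      simp only [wedge_mulVec, form_add_left, form_add_right, form_smul_left, form_smul_right, haa,
        hbb, hab, hba, form_comm w a, form_comm w b, h1, h2]
      module
    have e2 : (wedge (a + (1 : ℝ) • b) w).1 *ᵥ w' = form w w' • (a + (1 : ℝ) • b) := by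
      simp only [wedge_mulVec, form_add_left, form_smul_left, h3, h4]
      module
    rw [e1, e2, wedge_smul_left, wedge_smul_right, wedge_add_left a, wedge_add_right a,
      wedge_add_right ((-1 : ℝ) • b), wedge_self] at this
    simp only [wedge_smul_left, wedge_smul_right, wedge_self, wedge_swap b a] at this
    have e : wedge w w' = (-(1 / 2) : ℝ) • ((-2 : ℝ) • wedge w w' + form w w' •
        (0 + (1 : ℝ) • wedge a b + ((-1 : ℝ) • -wedge a b + (1 : ℝ) • (-1 : ℝ) • 0))) +
        form w w' • wedge a b := by
      module
    rw [e]
    refine S.add_mem (S.smul_mem _ ?_) (S.smul_mem _ (hsub hK))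
    convert this using 3
  have hperp : ∀ i, i ≠ μ → i ≠ ν → form a (Pi.single i 1) = 0 ∧ form b (Pi.single i 1) = 0 :=
    fun i h h' => by
      rw [ha, hb, form_single_single, form_single_single, if_neg h.symm, if_neg h'.symm]; simp
  refine eq_top_iff.2 (span_stdGen.symm.le.trans (Submodule.span_le.2 ?_))
  rintro _ ⟨⟨i, j⟩, rfl⟩
  show wedge (Pi.single i 1) (Pi.single j 1) ∈ S
  have hcol : ∀ i, wedge a (Pi.single i 1) ∈ S ∧ wedge b (Pi.single i 1) ∈ S := by
    intro i
    by_cases h : i = μ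
    · rw [h, ← ha, wedge_self, wedge_swap b]; exact ⟨S.zero_mem, S.neg_mem (hsub hK)⟩
    by_cases h' : i = ν
    · rw [h', ← hb, wedge_self]; exact ⟨hsub hK, S.zero_mem⟩
    · exact hrootS _ (hperp i h h').1 (hperp i h h').2
  by_cases h : i = μ
  · rw [h, ← ha]; exact (hcol j).1
  by_cases h' : i = ν
  · rw [h', ← hb]; exact (hcol j).2
  by_cases k : j = μ
  · rw [k, ← ha, wedge_swap]; exact S.neg_mem (hcol i).1
  by_cases k' : j = ν
  · rw [k', ← hb, wedge_swap]; exact S.neg_mem (hcol i).2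
  exact hww _ _ (hperp i h h').1 (hperp i h h').2 (hperp j k k').1 (hperp j k k').2

end Spanning

/-! ### Products of exponentials near the identity -/

section LocalProduct

variable {d : ℕ}

/-- The adjoint of a matrix with respect to the form. -/
def formAdjoint (A : Matrix (Fin (d + 1)) (Fin (d + 1)) ℝ) : Matrix (Fin (d + 1)) (Fin (d + 1)) ℝ :=
  eta d * Aᵀ * eta d

lemma formAdjoint_mul (A B : Matrix (Fin (d + 1)) (Fin (d + 1)) ℝ) :
    formAdjoint (A * B) = formAdjoint B * formAdjoint A := by
  simp only [formAdjoint, Matrix.transpose_mul]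
  calc _ = eta d * Bᵀ * 1 * Aᵀ * eta d := by simp only [mul_one, mul_assoc]
    _ = _ := by rw [← eta_mul_eta]; simp only [mul_assoc]

lemma formAdjoint_add (A B : Matrix (Fin (d + 1)) (Fin (d + 1)) ℝ) :
    formAdjoint (A + B) = formAdjoint A + formAdjoint B := by
  simp [formAdjoint, Matrix.transpose_add, mul_add, add_mul]

lemma formAdjoint_smul (c : ℝ) (A : Matrix (Fin (d + 1)) (Fin (d + 1)) ℝ) :
    formAdjoint (c • A) = c • formAdjoint A := by
  simp [formAdjoint, Matrix.transpose_smul]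

lemma formAdjoint_one : formAdjoint (1 : Matrix (Fin (d + 1)) (Fin (d + 1)) ℝ) = 1 := by
  simp [formAdjoint, eta_mul_eta]

lemma formAdjoint_formAdjoint (A : Matrix (Fin (d + 1)) (Fin (d + 1)) ℝ) :
    formAdjoint (formAdjoint A) = A := by
  have h : (eta d)ᵀ = eta d := by simp [eta]
  simp only [formAdjoint, Matrix.transpose_mul, h, Matrix.transpose_transpose]
  calc _ = (eta d * eta d) * A * (eta d * eta d) := by simp only [mul_assoc]
    _ = A := by rw [eta_mul_eta, one_mul, mul_one]

lemma form_mulVec_left (A : Matrix (Fin (d + 1)) (Fin (d + 1)) ℝ) (x y : Amb d) :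
    form (A *ᵥ x) y = form x (formAdjoint A *ᵥ y) := by
  rw [form_eq, form_eq, Matrix.mulVec_mulVec, formAdjoint, ← mul_assoc, ← mul_assoc, eta_mul_eta,
    one_mul, ← Matrix.mulVec_mulVec _ (Aᵀ), Matrix.dotProduct_mulVec x, Matrix.vecMul_transpose]

lemma formAdjoint_mul_self {A : Matrix (Fin (d + 1)) (Fin (d + 1)) ℝ}
    (h : ∀ x y : Amb d, form (A *ᵥ x) (A *ᵥ y) = form x y) : formAdjoint A * A = 1 := by
  refine Matrix.mulVec_injective (funext fun y => ?_)
  ext μ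
  have h1 := h (Pi.single μ 1) y
  rw [form_mulVec_left, Matrix.mulVec_mulVec, form_single, form_single] at h1
  have : sgn d μ ≠ 0 := by simp only [sgn]; split_ifs <;> norm_num
  rw [mul_left_cancel₀ this h1, Matrix.one_mulVec]

lemma mem_lieAlg_iff (A : Matrix (Fin (d + 1)) (Fin (d + 1)) ℝ) :
    A ∈ lieAlg d ↔ formAdjoint A = -A := by
  constructor
  · intro h
    have h' : Aᵀ * eta d = -(eta d * A) := h
    rw [formAdjoint, mul_assoc, h', mul_neg, ← mul_assoc, eta_mul_eta, one_mul]
  · intro h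
    show Aᵀ * eta d = -(eta d * A)
    rw [← mul_neg, ← h, formAdjoint, ← mul_assoc, ← mul_assoc, eta_mul_eta, one_mul]

/-- The matrix `exp(t₁N₁) ⋯ exp(t_kN_k)`. -/
def expProd {k : ℕ} (N : Fin k → lieAlg d) (t : Fin k → ℝ) :
    Matrix (Fin (d + 1)) (Fin (d + 1)) ℝ :=
  ((List.finRange k).map fun i => NormedSpace.exp (t i • (N i).1)).prod

lemma form_expProd {k : ℕ} (N : Fin k → lieAlg d) (t : Fin k → ℝ) (x y : Amb d) :
    form (expProd N t *ᵥ x) (expProd N t *ᵥ y) = form x y := by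
  rw [expProd]
  generalize List.finRange k = l
  induction l with
  | nil => simp
  | cons i l ih =>
    rw [List.map_cons, List.prod_cons, ← Matrix.mulVec_mulVec, ← Matrix.mulVec_mulVec,
      ← Submodule.coe_smul, exp_form, ih]

/-! ### The inverse function argument for products of exponentials -/

/-- At $t=0$ every factor is $1$ and the $i$-th one has derivative $c\mapsto c_iN_i$, so the product
rule leaves the plain sum whatever the order of the factors. -/
lemma hasStrictFDerivAt_prod_exp {𝔸 : Type*} [NormedRing 𝔸] [NormedAlgebra ℝ 𝔸] [CompleteSpace 𝔸]
    {k : ℕ} (N : Fin k → 𝔸) :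
    ∃ L : (Fin k → ℝ) →L[ℝ] 𝔸, HasStrictFDerivAt (fun t : Fin k → ℝ =>
      ((List.finRange k).map fun i => NormedSpace.exp (t i • N i)).prod) L 0 ∧
      ∀ c, L c = ∑ i, c i • N i := by
  have h1 : ∀ i : Fin k, HasStrictFDerivAt (fun t : Fin k → ℝ => NormedSpace.exp (t i • N i))
      ((ContinuousLinearMap.proj i : (Fin k → ℝ) →L[ℝ] ℝ).smulRight (N i)) 0 := by
    intro i
    have e := hasStrictFDerivAt_exp_zero (𝕂 := ℝ) (𝔸 := 𝔸)
    have hl : HasStrictFDerivAt (fun t : Fin k → ℝ => t i • N i)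
        ((ContinuousLinearMap.proj i : (Fin k → ℝ) →L[ℝ] ℝ).smulRight (N i)) 0 :=
      ((ContinuousLinearMap.proj i : (Fin k → ℝ) →L[ℝ] ℝ).smulRight (N i)).hasStrictFDerivAt
    have e' : HasStrictFDerivAt NormedSpace.exp (1 : 𝔸 →L[ℝ] 𝔸) ((0 : Fin k → ℝ) i • N i) := by
      simpa using e
    exact e'.comp (0 : Fin k → ℝ) hl
  have h2 : ∀ l : List (Fin k), ∃ L : (Fin k → ℝ) →L[ℝ] 𝔸, HasStrictFDerivAt (fun t : Fin k → ℝ =>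
        (l.map fun i => NormedSpace.exp (t i • N i)).prod) L 0 ∧
      ∀ c, L c = (l.map fun i => c i • N i).sum := by
    intro l
    induction l with
    | nil =>
      refine ⟨0, ?_, fun c => by simp⟩
      simpa using hasStrictFDerivAt_const (1 : 𝔸) (0 : Fin k → ℝ)
    | cons i l ih =>
      obtain ⟨L, hL, hc⟩ := ih
      have hone : (l.map fun i => NormedSpace.exp ((0 : Fin k → ℝ) i • N i)).prod = 1 :=
        List.prod_eq_one (by simp)
      refine ⟨L + (ContinuousLinearMap.proj i : (Fin k → ℝ) →L[ℝ] ℝ).smulRight (N i),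
        ((h1 i).mul' hL).congr_fderiv ?_, fun c => ?_⟩
      · rw [hone]
        ext c
        simp
      · simp [hc, add_comm]
  obtain ⟨L, hL, hc⟩ := h2 (List.finRange k)
  refine ⟨L, hL, fun c => ?_⟩
  rw [hc, ← List.sum_ofFn, List.ofFn_eq_map]

/-- The map $(t,Y)\mapsto\prod_i\exp(t_iN_i)\,(1+J_0Y)$ sends $0$ to $1$ and has a surjective strict
derivative there, so it maps neighbourhoods of $0$ onto neighbourhoods of $1$. The extra factor
fills the directions transverse to the Lie algebra; invertibility of $2+J_0Y$, true for small $Y$,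
serves to eliminate it when the matrix preserves the form. -/
lemma eventually_eq_prod_exp_mul {𝔸 : Type*} [NormedRing 𝔸] [NormedAlgebra ℝ 𝔸]
    [FiniteDimensional ℝ 𝔸] {k : ℕ} (N : Fin k → 𝔸) (J₀ : 𝔸 →ₗ[ℝ] 𝔸)
    (hsurj : ∀ X, ∃ c : Fin k → ℝ, ∃ Y, ∑ i, c i • N i + J₀ Y = X)
    {T : Set (Fin k → ℝ)} (hT : T ∈ 𝓝 0) :
    ∀ᶠ A : 𝔸 in 𝓝 1, ∃ t ∈ T, ∃ Y, IsUnit (2 + J₀ Y) ∧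
      A = ((List.finRange k).map fun i => NormedSpace.exp (t i • N i)).prod * (1 + J₀ Y) := by
  have : CompleteSpace 𝔸 := FiniteDimensional.complete ℝ 𝔸
  obtain ⟨L, hL, hLc⟩ := hasStrictFDerivAt_prod_exp N
  let J : 𝔸 →L[ℝ] 𝔸 := LinearMap.toContinuousLinearMap J₀
  set P : (Fin k → ℝ) → 𝔸 :=
    fun t => ((List.finRange k).map fun i => NormedSpace.exp (t i • N i)).prod with hP
  let F : (Fin k → ℝ) × 𝔸 → 𝔸 := fun q => P q.1 * (1 + J q.2)
  have h0 : P 0 = 1 := by simp [hP]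
  obtain ⟨F', hF, hF'⟩ : ∃ F' : (Fin k → ℝ) × 𝔸 →L[ℝ] 𝔸,
      HasStrictFDerivAt F F' 0 ∧ ∀ q, F' q = L q.1 + J q.2 := by
    have h1 : HasStrictFDerivAt (fun q : (Fin k → ℝ) × 𝔸 => P q.1)
        (L.comp (ContinuousLinearMap.fst ℝ _ _)) 0 :=
      hL.comp (0 : (Fin k → ℝ) × 𝔸) hasStrictFDerivAt_fst
    have h2 : HasStrictFDerivAt (fun q : (Fin k → ℝ) × 𝔸 => 1 + J q.2)
        (J.comp (ContinuousLinearMap.snd ℝ _ _)) 0 :=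
      ((J.comp (ContinuousLinearMap.snd ℝ _ _)).hasStrictFDerivAt
        (x := (0 : (Fin k → ℝ) × 𝔸))).const_add 1
    refine ⟨_, h1.mul' h2, fun q => ?_⟩
    simp [h0, add_comm]
  have hrange : F'.range = ⊤ := by
    refine LinearMap.range_eq_top.2 fun X => ?_
    obtain ⟨c, Y, h⟩ := hsurj X
    exact ⟨(c, Y), by rw [← h, ← hLc]; exact hF' _⟩
  have hmap := hF.map_nhds_eq_of_surj hrange
  have hF0 : F 0 = 1 := by simp [F, h0]
  rw [hF0] at hmap
  have hunit : ∀ᶠ q : (Fin k → ℝ) × 𝔸 in 𝓝 0, IsUnit (2 + J q.2) := by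
    have hc : Continuous fun q : (Fin k → ℝ) × 𝔸 => 2 + J q.2 := by fun_prop
    refine hc.continuousAt.eventually (Units.isOpen.mem_nhds ?_)
    have h2 : (2 : 𝔸) + J (0 : (Fin k → ℝ) × 𝔸).2 = (algebraMap ℝ 𝔸) 2 := by
      rw [map_ofNat]; simp
    show IsUnit (2 + J (0 : (Fin k → ℝ) × 𝔸).2)
    rw [h2]
    exact (IsUnit.mk0 (2 : ℝ) (by norm_num)).map (algebraMap ℝ 𝔸)
  rw [← hmap, eventually_map]
  filter_upwards [hunit, continuous_fst.continuousAt.eventually hT] with q hq hqT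
  exact ⟨q.1, hqT, q.2, hq, rfl⟩

section
attribute [local instance] Matrix.linftyOpNormedRing Matrix.linftyOpNormedAlgebra

/-- Elements of the pseudo-orthogonal group near `1` are products of exponentials of small
multiples of any spanning family of the Lie algebra. -/
lemma eventually_eq_expProd {k : ℕ} {N : Fin k → lieAlg d}
    (hN : Submodule.span ℝ (Set.range N) = ⊤) {T : Set (Fin k → ℝ)} (hT : T ∈ 𝓝 0) :
    ∀ᶠ A : Matrix (Fin (d + 1)) (Fin (d + 1)) ℝ in 𝓝 1,
      (∀ x y : Amb d, form (A *ᵥ x) (A *ᵥ y) = form x y) → ∃ t ∈ T, A = expProd N t := by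
  -- $J$ is twice the projection to self-adjoint matrices. Its range complements the Lie algebra,
  -- which consists of the skew-adjoint ones.
  let J : Matrix (Fin (d + 1)) (Fin (d + 1)) ℝ →ₗ[ℝ] Matrix (Fin (d + 1)) (Fin (d + 1)) ℝ :=
    { toFun := fun X => X + formAdjoint X
      map_add' := fun X Y => by rw [formAdjoint_add]; abel
      map_smul' := fun c X => by rw [formAdjoint_smul, RingHom.id_apply, smul_add] }
  have hJ : ∀ X, J X = X + formAdjoint X := fun X => rfl
  have hsurj : ∀ X, ∃ c : Fin k → ℝ, ∃ Y, ∑ i, c i • (N i).1 + J Y = X := by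
    intro X
    have hA : (1 / 2 : ℝ) • (X - formAdjoint X) ∈ lieAlg d := by
      rw [mem_lieAlg_iff, formAdjoint_smul, sub_eq_add_neg, formAdjoint_add,
        ← neg_one_smul ℝ (formAdjoint X), formAdjoint_smul, formAdjoint_formAdjoint]
      module
    have : (⟨_, hA⟩ : lieAlg d) ∈ Submodule.span ℝ (Set.range N) := by rw [hN]; trivial
    obtain ⟨c, hc⟩ := (Submodule.mem_span_range_iff_exists_fun ℝ).1 this
    have hc' : ∑ i, c i • (N i).1 = (1 / 2 : ℝ) • (X - formAdjoint X) := by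
      simpa using congrArg Subtype.val hc
    refine ⟨c, (1 / 2 : ℝ) • X, ?_⟩
    rw [hc', hJ, formAdjoint_smul]
    module
  have key : ∀ᶠ A : Matrix (Fin (d + 1)) (Fin (d + 1)) ℝ in 𝓝 1, ∃ t ∈ T, ∃ Y, IsUnit (2 + J Y) ∧
      A = expProd N t * (1 + J Y) := eventually_eq_prod_exp_mul (fun i => (N i).1) J hsurj hT
  filter_upwards [key]
  rintro A ⟨t, ht, Y, hY, rfl⟩ hform
  refine ⟨t, ht, ?_⟩
  have e1 := formAdjoint_mul_self hform
  have e2 := formAdjoint_mul_self (form_expProd N t)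
  set S := J Y with hS
  have hSadj : formAdjoint S = S := by
    rw [hS, hJ, formAdjoint_add, formAdjoint_formAdjoint]; exact add_comm _ _
  -- Both the matrix and the product of exponentials preserve the form, hence so does $1+S$. As $S$
  -- is self-adjoint this says $(1+S)^2=1$, and invertibility of $2+S$ then forces $S=0$.
  have e3 : S * (2 + S) = 0 := by
    have : (1 + S) * (1 + S) = 1 := by
      refine Eq.trans ?_ e1
      rw [formAdjoint_mul, formAdjoint_add, hSadj, formAdjoint_one, mul_assoc,
        ← mul_assoc (formAdjoint (expProd N t)), e2, one_mul]
    calc S * (2 + S) = (1 + S) * (1 + S) - 1 := by noncomm_ring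
      _ = 0 := by rw [this, sub_self]
  rw [(hY.mul_left_eq_zero).1 e3, add_zero, mul_one]

end

end LocalProduct

/-! ### The isometry group of a space-time -/

/-- The properties of the quadric and of its covering used for the structure of the isometry group. -/
structure Spacetime.Regular {d : ℕ} (𝒳 : Spacetime d) : Prop where
  t2 : T2Space 𝒳.Pt
  nonempty : Nonempty 𝒳.Pt
  proj_exp : ∀ (M : lieAlg d) (p : 𝒳.Pt),
    𝒳.proj ((𝒳.exp M).1 p) = NormedSpace.exp M.1 *ᵥ 𝒳.proj p
  exp_zero : 𝒳.exp 0 = 1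
  continuous_exp : ∀ M : lieAlg d, Continuous fun q : ℝ × 𝒳.Pt => (𝒳.exp (q.1 • M)).1 q.2
  separated : ∀ q : 𝒳.Pt, ∃ V ∈ 𝓝 q, ∀ φ ψ : isometries 𝒳.proj,
    (∀ p, 𝒳.proj (φ.1 p) = 𝒳.proj (ψ.1 p)) → ∀ p, φ.1 p ∈ V → ψ.1 p ∈ V → φ = ψ
  deck_eq_exp : ∀ φ : isometries 𝒳.proj, (∀ p, 𝒳.proj (φ.1 p) = 𝒳.proj p) → ∃ M, φ = 𝒳.exp M

namespace Spacetime.Regular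

variable {d : ℕ} {𝒳 : Spacetime d} (h𝒳 : 𝒳.Regular)
include h𝒳

/-- Paths of isometries over the same path of matrices agree if they start at the same point. -/
lemma path_eq {c₁ c₂ : ℝ → isometries 𝒳.proj}
    (hproj : ∀ u p, 𝒳.proj ((c₁ u).1 p) = 𝒳.proj ((c₂ u).1 p)) (p₀ : 𝒳.Pt)
    (h₁ : Continuous fun u => (c₁ u).1 p₀) (h₂ : Continuous fun u => (c₂ u).1 p₀)
    (h0 : c₁ 0 = c₂ 0) (u : ℝ) : c₁ u = c₂ u := by
  have := h𝒳.t2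
  -- Two isometries over the same matrix agree once they agree at a single point, so the agreement
  -- set is closed; separation makes it open, and $\mathbb R$ is connected.
  have hiff : ∀ u, c₁ u = c₂ u ↔ (c₁ u).1 p₀ = (c₂ u).1 p₀ := by
    refine fun u => ⟨fun h => by rw [h], fun h => ?_⟩
    obtain ⟨V, hV, hsep⟩ := h𝒳.separated ((c₁ u).1 p₀)
    exact hsep _ _ (hproj u) p₀ (mem_of_mem_nhds hV) (h ▸ mem_of_mem_nhds hV)
  have hset : {u | c₁ u = c₂ u} = Set.univ := by
    refine IsClopen.eq_univ ⟨?_, ?_⟩ ⟨0, h0⟩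
    · simp only [hiff]
      exact isClosed_eq h₁ h₂
    · refine isOpen_iff_mem_nhds.2 fun u hu => ?_
      obtain ⟨V, hV, hsep⟩ := h𝒳.separated ((c₁ u).1 p₀)
      have e : (c₁ u).1 p₀ = (c₂ u).1 p₀ := (hiff u).1 hu
      filter_upwards [h₁.continuousAt.eventually hV,
        h₂.continuousAt.eventually (show V ∈ 𝓝 ((c₂ u).1 p₀) from e ▸ hV)] with v hv₁ hv₂
      exact hsep _ _ (hproj v) p₀ hv₁ hv₂
  exact hset.symm.subset (Set.mem_univ u)

lemma continuous_exp_apply (M : lieAlg d) (r : ℝ) (p : 𝒳.Pt) :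
    Continuous fun u : ℝ => (𝒳.exp ((u * r) • M)).1 p :=
  (h𝒳.continuous_exp M).comp (Continuous.prodMk (by fun_prop) continuous_const)

/-- On the covering the exponential is defined as the endpoint of a lifted path, so the group law is
obtained from unique lifting: with $s$ and $t$ scaled by $u$, both sides lift the same path of
matrices and start at the identity. -/
lemma exp_add_smul (M : lieAlg d) (s t : ℝ) :
    𝒳.exp ((s + t) • M) = 𝒳.exp (s • M) * 𝒳.exp (t • M) := by
  obtain ⟨p₀⟩ := h𝒳.nonempty
  have := h𝒳.path_eq (c₁ := fun u => 𝒳.exp ((u * (s + t)) • M))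
    (c₂ := fun u => 𝒳.exp ((u * s) • M) * 𝒳.exp ((u * t) • M)) (fun u p => ?_) p₀
    (h𝒳.continuous_exp_apply M _ p₀) ?_ ?_ 1
  · simpa using this
  · show _ = 𝒳.proj ((𝒳.exp ((u * s) • M)).1 ((𝒳.exp ((u * t) • M)).1 p))
    rw [h𝒳.proj_exp, h𝒳.proj_exp, h𝒳.proj_exp, Matrix.mulVec_mulVec,
      ← Matrix.exp_add_of_commute]
    · congr 2
      simp only [Submodule.coe_smul, mul_add, add_smul]
      rfl
    · exact (Commute.refl M.1).smul_left _ |>.smul_right _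
  · exact (h𝒳.continuous_exp M).comp
      (Continuous.prodMk (by fun_prop) (h𝒳.continuous_exp_apply M t p₀))
  · simp [h𝒳.exp_zero]

lemma exp_neg (M : lieAlg d) : 𝒳.exp (-M) = (𝒳.exp M)⁻¹ := by
  refine eq_inv_of_mul_eq_one_left ?_
  have := h𝒳.exp_add_smul M (-1) 1
  have e : (-1 : ℝ) • M = -M := by module
  rwa [e, one_smul, neg_add_cancel, zero_smul, h𝒳.exp_zero, eq_comm] at this

lemma exp_pow (M : lieAlg d) (n : ℕ) : 𝒳.exp M ^ n = 𝒳.exp ((n : ℝ) • M) := by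
  induction n with
  | zero => simp [h𝒳.exp_zero]
  | succ n ih => rw [pow_succ, ih, Nat.cast_succ, h𝒳.exp_add_smul, one_smul]

/-- Unique lifting again: $\exp(uN')$ and the conjugate of $\exp(uN)$ cover the same path of
matrices and coincide at $u=0$. -/
lemma exp_conj {M N N' : lieAlg d}
    (h : N'.1 = NormedSpace.exp M.1 * N.1 * NormedSpace.exp (-M.1)) :
    𝒳.exp N' = 𝒳.exp M * 𝒳.exp N * (𝒳.exp M)⁻¹ := by
  obtain ⟨p₀⟩ := h𝒳.nonempty
  have hexp : ∀ u : ℝ, NormedSpace.exp (u • N').1 =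
      NormedSpace.exp M.1 * NormedSpace.exp (u • N).1 * NormedSpace.exp (-M.1) := fun u => by
    have h1 := exp_mul_exp_neg M.1
    have hinv : NormedSpace.exp (-M.1) = (NormedSpace.exp M.1)⁻¹ := (Matrix.inv_eq_right_inv h1).symm
    rw [Submodule.coe_smul, h, hinv, ← Matrix.exp_conj _ _ (IsUnit.of_mul_eq_one _ h1)]
    congr 1
    simp
  have := h𝒳.path_eq (c₁ := fun u => 𝒳.exp (u • N'))
    (c₂ := fun u => 𝒳.exp M * 𝒳.exp (u • N) * (𝒳.exp M)⁻¹) (fun u p => ?_) p₀ ?_ ?_ ?_ 1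
  · simpa using this
  · rw [← h𝒳.exp_neg]
    show _ = 𝒳.proj ((𝒳.exp M).1 ((𝒳.exp (u • N)).1 ((𝒳.exp (-M)).1 p)))
    simp only [h𝒳.proj_exp, Matrix.mulVec_mulVec, hexp, Submodule.coe_neg]
    rw [mul_assoc]
  · simpa using h𝒳.continuous_exp_apply N' 1 p₀
  · refine (𝒳.exp M).1.continuous.comp ((h𝒳.continuous_exp N).comp
      (Continuous.prodMk continuous_id continuous_const))
  · simp [h𝒳.exp_zero]

omit h𝒳 in
/-- The element `exp(t₁N₁) ⋯ exp(t_kN_k)` of the isometry group. -/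
def _root_.AdS.Spacetime.isoProd (𝒳 : Spacetime d) {k : ℕ} (N : Fin k → lieAlg d) (t : Fin k → ℝ) :
    isometries 𝒳.proj :=
  ((List.finRange k).map fun i => 𝒳.exp (t i • N i)).prod

lemma proj_isoProd {k : ℕ} (N : Fin k → lieAlg d) (t : Fin k → ℝ) (p : 𝒳.Pt) :
    𝒳.proj ((𝒳.isoProd N t).1 p) = expProd N t *ᵥ 𝒳.proj p := by
  rw [Spacetime.isoProd, expProd]
  generalize List.finRange k = l
  induction l with
  | nil => simp
  | cons i l ih =>
    rw [List.map_cons, List.prod_cons, List.map_cons, List.prod_cons, ← Matrix.mulVec_mulVec, ← ih]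
    exact h𝒳.proj_exp _ _

lemma continuous_isoProd {k : ℕ} (N : Fin k → lieAlg d) (p : 𝒳.Pt) :
    Continuous fun t => (𝒳.isoProd N t).1 p := by
  simp only [Spacetime.isoProd]
  generalize List.finRange k = l
  induction l with
  | nil => simpa using continuous_const
  | cons i l ih =>
    simp only [List.map_cons, List.prod_cons]
    exact (h𝒳.continuous_exp (N i)).comp (Continuous.prodMk (continuous_apply i) ih)

lemma isoProd_zero {k : ℕ} (N : Fin k → lieAlg d) : 𝒳.isoProd N 0 = 1 :=
  List.prod_eq_one (by simp [h𝒳.exp_zero])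

/-- Isometries converging to `1` are eventually products of small exponentials. -/
lemma eventually_eq_isoProd {k : ℕ} {N : Fin k → lieAlg d}
    (hN : Submodule.span ℝ (Set.range N) = ⊤) {ι : Type*} {l : Filter ι}
    {φ : ι → isometries 𝒳.proj} {Λ : ι → Matrix (Fin (d + 1)) (Fin (d + 1)) ℝ}
    (hφ : ∀ s p, 𝒳.proj ((φ s).1 p) = Λ s *ᵥ 𝒳.proj p)
    (hΛ : ∀ s, ∀ x y : Amb d, form (Λ s *ᵥ x) (Λ s *ᵥ y) = form x y)
    (hlim : Tendsto Λ l (𝓝 1)) {p₀ : 𝒳.Pt} (hp : Tendsto (fun s => (φ s).1 p₀) l (𝓝 p₀))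
    {T : Set (Fin k → ℝ)} (hT : T ∈ 𝓝 0) : ∀ᶠ s in l, ∃ t ∈ T, φ s = 𝒳.isoProd N t := by
  obtain ⟨V, hV, hsep⟩ := h𝒳.separated p₀
  -- The parameters are also restricted so that the product keeps $p_0$ in $V$; otherwise it could
  -- differ from the given isometry by a deck transformation.
  have hT' : {t | (𝒳.isoProd N t).1 p₀ ∈ V} ∈ 𝓝 0 := by
    refine (h𝒳.continuous_isoProd N p₀).continuousAt ?_
    rw [h𝒳.isoProd_zero]
    exact hV
  filter_upwards [hlim.eventually (eventually_eq_expProd hN (inter_mem hT hT')), hp hV] with s hs hsV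
  obtain ⟨t, ht, he⟩ := hs (hΛ s)
  refine ⟨t, ht.1, hsep _ _ (fun p => ?_) p₀ hsV ht.2⟩
  rw [hφ, h𝒳.proj_isoProd, he]

omit h𝒳 in
lemma _root_.AdS.exists_spanning_family {I : Set (lieAlg d)} (hI : Submodule.span ℝ I = ⊤) :
    ∃ (k : ℕ) (N : Fin k → lieAlg d), (∀ i, N i ∈ I) ∧ Submodule.span ℝ (Set.range N) = ⊤ := by
  obtain ⟨f, hf, hspan, -⟩ := Submodule.exists_fun_fin_finrank_span_eq ℝ I
  exact ⟨_, f, hf, hspan.trans hI⟩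

omit h𝒳 in
lemma _root_.AdS.tendsto_exp_smul_one {ι : Type*} {l : Filter ι} {r : ι → ℝ}
    (hr : Tendsto r l (𝓝 0)) (M : lieAlg d) :
    Tendsto (fun s => NormedSpace.exp (r s • M).1) l (𝓝 1) := by
  have := (continuous_exp_smul M.1).tendsto 0
  rw [zero_smul, NormedSpace.exp_zero] at this
  exact this.comp hr

/-- A subgroup containing the one-parameter groups of a spanning set is the full group. -/
lemma eq_top_of_span {H : Subgroup (isometries 𝒳.proj)} {I : Set (lieAlg d)}
    (hI : Submodule.span ℝ I = ⊤) (hH : ∀ N ∈ I, ∀ t : ℝ, 𝒳.exp (t • N) ∈ H) : H = ⊤ := by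
  obtain ⟨k, N, hNI, hN⟩ := exists_spanning_family hI
  obtain ⟨p₀⟩ := h𝒳.nonempty
  have hprod : ∀ t, 𝒳.isoProd N t ∈ H := fun t =>
    H.list_prod_mem fun x hx => by
      obtain ⟨i, -, rfl⟩ := List.mem_map.1 hx
      exact hH _ (hNI i) _
  -- For large $n$ the element $\exp(M/(n+1))$ is close enough to $1$ to be a product of elements of
  -- $H$, and its $(n+1)$-st power is $\exp M$.
  have hexp : ∀ M : lieAlg d, 𝒳.exp M ∈ H := by
    intro M
    have hp : Tendsto (fun n : ℕ => (𝒳.exp ((1 / ((n : ℝ) + 1)) • M)).1 p₀) atTop (𝓝 p₀) := by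
      have := (h𝒳.continuous_exp_apply M 1 p₀).tendsto 0
      simp only [mul_one, zero_smul, h𝒳.exp_zero] at this
      exact this.comp tendsto_one_div_add_atTop_nhds_zero_nat
    have := h𝒳.eventually_eq_isoProd hN (φ := fun n : ℕ => 𝒳.exp ((1 / ((n : ℝ) + 1)) • M))
      (fun n p => h𝒳.proj_exp _ _) (fun n => exp_form _)
      (tendsto_exp_smul_one tendsto_one_div_add_atTop_nhds_zero_nat M) hp univ_mem
    obtain ⟨n, t, -, he⟩ := this.exists
    have hn : 𝒳.exp M = 𝒳.exp ((1 / ((n : ℝ) + 1)) • M) ^ (n + 1) := by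
      rw [h𝒳.exp_pow, smul_smul]
      have : ((n : ℝ) + 1) ≠ 0 := by positivity
      push_cast
      rw [mul_one_div_cancel this, one_smul]
    rw [hn]
    exact H.pow_mem (he ▸ hprod t) _
  -- The matrices covered by an element of $H$. This subgroup contains a neighbourhood of $1$, so it
  -- is open and closed and contains the identity component.
  let K : Subgroup (fullGroup d) :=
    { carrier := {Λ | ∃ φ ∈ H, ∀ p, 𝒳.proj (φ.1 p) = Λ.1.1 *ᵥ 𝒳.proj p}
      one_mem' := ⟨1, H.one_mem, fun p => by simp⟩
      mul_mem' := by
        rintro Λ Λ' ⟨φ, hφ, h⟩ ⟨φ', hφ', h'⟩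
        refine ⟨φ * φ', H.mul_mem hφ hφ', fun p => ?_⟩
        show 𝒳.proj (φ.1 (φ'.1 p)) = (Λ.1.1 * Λ'.1.1) *ᵥ 𝒳.proj p
        rw [h, h', Matrix.mulVec_mulVec]
      inv_mem' := by
        rintro Λ ⟨φ, hφ, h⟩
        refine ⟨φ⁻¹, H.inv_mem hφ, fun p => ?_⟩
        have := h (φ⁻¹.1 p)
        rw [show φ.1 (φ⁻¹.1 p) = p from φ.1.apply_symm_apply p] at this
        rw [this, Matrix.mulVec_mulVec]
        simp }
  have hK : (K : Set (fullGroup d)) ∈ 𝓝 1 := by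
    have hc : Continuous fun Λ : fullGroup d => Λ.1.1 :=
      Units.continuous_val.comp continuous_subtype_val
    have h1 := eventually_eq_expProd hN (univ_mem : (Set.univ : Set (Fin k → ℝ)) ∈ 𝓝 0)
    have h2 := (hc.tendsto 1).eventually h1
    filter_upwards [h2] with Λ hΛ
    obtain ⟨t, -, he⟩ := hΛ Λ.2
    exact ⟨_, hprod t, fun p => by rw [h𝒳.proj_isoProd, he]⟩
  have hopen : IsOpen (K : Set (fullGroup d)) := K.isOpen_of_mem_nhds hK
  have hcomp : Subgroup.connectedComponentOfOne (fullGroup d) ≤ K := by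
    have hclopen : IsClopen (K : Set (fullGroup d)) := ⟨K.isClosed_of_isOpen hopen, hopen⟩
    exact hclopen.connectedComponent_subset K.one_mem
  refine eq_top_iff.2 fun φ _ => ?_
  obtain ⟨_, ⟨Λ, hΛ, rfl⟩, hφ⟩ := φ.2
  obtain ⟨ψ, hψ, hψp⟩ := hcomp hΛ
  -- So far $\varphi$ is matched by some $\psi\in H$ over the same matrix; the remaining deck
  -- transformation is itself an exponential.
  obtain ⟨M, hM⟩ := h𝒳.deck_eq_exp (φ * ψ⁻¹) fun p => by
    show 𝒳.proj (φ.1 (ψ⁻¹.1 p)) = _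
    refine (hφ _).trans ((hψp _).symm.trans ?_)
    rw [show ψ.1 (ψ⁻¹.1 p) = p from ψ.1.apply_symm_apply p]
  rw [show φ = φ * ψ⁻¹ * ψ by group, hM]
  exact H.mul_mem (hexp M) hψ

end Spacetime.Regular

/-! ### The quadric and its covering are regular -/

section Regular

variable {d : ℕ}

lemma continuous_exp_smul_smul_mulVec (M : lieAlg d) :
    Continuous fun q : ℝ × Amb d => NormedSpace.exp (q.1 • M.1) *ᵥ q.2 :=
  (continuous_exp_smul_mulVec M.1).comp continuous_swap

/-- The projection is injective here, so an isometry is determined by its matrix and there are no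
nontrivial deck transformations. -/
lemma pure_regular (hd : 2 ≤ d) : (pureSpacetime hd).Regular where
  t2 := inferInstanceAs (T2Space (PurePt d))
  nonempty := ⟨(⟨chi d 0, form_chi hd 0⟩ : PurePt d)⟩
  proj_exp M p := rfl
  exp_zero := by
    refine Subtype.ext (Homeomorph.ext fun p => Subtype.ext ?_)
    show NormedSpace.exp (0 : lieAlg d).1 *ᵥ p.1 = p.1
    simp
  continuous_exp M := by
    refine Continuous.subtype_mk ((continuous_exp_smul_smul_mulVec M).comp
      (continuous_fst.prodMk (continuous_subtype_val.comp continuous_snd))) _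
  separated q := ⟨Set.univ, univ_mem, fun φ ψ h p _ _ =>
    Subtype.ext (Homeomorph.ext fun p => Subtype.ext (h p))⟩
  deck_eq_exp φ h := by
    refine ⟨0, Subtype.ext (Homeomorph.ext fun p => Subtype.ext ?_)⟩
    refine (h p).trans ?_
    show p.1 = NormedSpace.exp (0 : lieAlg d).1 *ᵥ p.1
    simp

/-- Two continuous lifts differ by a multiple of `2π` in the time coordinate. -/
lemma eq_add_of_chi_eq (hd : 2 ≤ d) {f g : CoverPt d → CoverPt d} (hf : Continuous f)
    (hg : Continuous g) (h : ∀ p, chi d (f p) = chi d (g p)) :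
    ∃ k : ℤ, ∀ p, f p = ((g p).1 + k * (2 * Real.pi), (g p).2) := by
  have hsnd : ∀ p, (f p).2 = (g p).2 := fun p => by
    ext i
    rw [← chi_spatial, h, chi_spatial]
  have hint : ∀ p, ∃ k : ℤ, ((f p).1 - (g p).1) / (2 * Real.pi) = k := fun p => by
    have hr : √(1 + ‖(g p).2‖ ^ 2) ≠ 0 := by positivity
    have h0 : Real.sin (f p).1 = Real.sin (g p).1 := by
      have := congrFun (h p) 0
      rw [chi_zero, chi_zero, hsnd] at this
      exact mul_left_cancel₀ hr this
    have h1 : Real.cos (f p).1 = Real.cos (g p).1 := by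
      have := congrFun (h p) (Fin.last d)
      rw [chi_last hd, chi_last hd, hsnd] at this
      exact mul_left_cancel₀ hr this
    have hc : Real.cos ((f p).1 - (g p).1) = 1 := by
      rw [Real.cos_sub, h0, h1]
      nlinarith [Real.sin_sq_add_cos_sq (g p).1]
    obtain ⟨k, hk⟩ := (Real.cos_eq_one_iff _).1 hc
    refine ⟨k, ?_⟩
    rw [← hk]
    field_simp
  choose k hk using hint
  have hcont : Continuous k := by
    refine Int.isClosedEmbedding_coe_real.isEmbedding.continuous_iff.2 ?_
    have : (Int.cast ∘ k : CoverPt d → ℝ) = fun p => ((f p).1 - (g p).1) / (2 * Real.pi) :=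
      funext fun p => (hk p).symm
    rw [this]
    fun_prop
  refine ⟨k 0, fun p => Prod.ext ?_ (hsnd p)⟩
  -- A continuous integer-valued function on a connected space is constant.
  have hkp : k p = k 0 := PreconnectedSpace.constant inferInstance hcont
  have := hk p
  rw [hkp, div_eq_iff (by positivity)] at this
  show (f p).1 = (g p).1 + _
  linarith

lemma stdGen_zero_last_mulVec (x : Amb d) :
    (stdGen 0 (Fin.last d) : lieAlg d).1 *ᵥ x =
      x (Fin.last d) • Pi.single 0 1 - x 0 • Pi.single (Fin.last d) 1 := by
  rw [stdGen, wedge_mulVec, form_single, form_single, sgn_zero, sgn_last, one_mul, one_mul]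

/-- The generator `M_{0d}` generates the time translations of the covering. -/
lemma coverFlow_time (hd : 2 ≤ d) (s : ℝ) (p : CoverPt d) :
    coverFlow (s • stdGen 0 (Fin.last d)) p = (p.1 + s, p.2) := by
  have hl := last_ne_zero hd
  -- Along $M_{0d}$ the function $z^d-iz^0$ is multiplied by a phase: its logarithmic derivative is
  -- the constant $-is$, so the lifted time advances by exactly $s$.
  have hmul : ∀ x : Amb d, form x x = 1 →
      clock (toC ((s • (stdGen 0 (Fin.last d) : lieAlg d)).1 *ᵥ x)) / clock (toC x) =
        -Complex.I * s := by
    intro x hx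
    rw [div_eq_iff (clock_ne_zero hd hx), Submodule.coe_smul, Matrix.smul_mulVec,
      stdGen_zero_last_mulVec]
    simp [clock, toC, hl, hl.symm]
    linear_combination (-(s : ℂ) * x 0) * Complex.I_mul_I
  refine Prod.ext ?_ ?_
  · show p.1 + _ = p.1 + s
    rw [clockShift_toC]
    have : ∀ u : ℝ, clock (toC ((s • (stdGen 0 (Fin.last d) : lieAlg d)).1 *ᵥ
        (NormedSpace.exp (u • (s • (stdGen 0 (Fin.last d) : lieAlg d)).1) *ᵥ chi d p))) /
        clock (toC (NormedSpace.exp (u • (s • (stdGen 0 (Fin.last d) : lieAlg d)).1) *ᵥ chi d p)) =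
        -Complex.I * s := fun u => hmul _ (by rw [form_exp_smul, form_chi hd])
    simp only [this]
    simp [← mul_assoc]
  · ext i
    show (NormedSpace.exp (s • (stdGen 0 (Fin.last d) : lieAlg d).1) *ᵥ chi d p) i = p.2 i
    have hder : ∀ u : ℝ, HasDerivAt (fun u : ℝ =>
        (NormedSpace.exp (u • (stdGen 0 (Fin.last d) : lieAlg d).1) *ᵥ chi d p) i) 0 u := fun u => by
      refine (hasDerivAt_exp_smul_mulVec _ (chi d p) u i).congr_deriv ?_
      rw [stdGen_zero_last_mulVec]
      simp [i.2.1, i.2.2]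
    rw [is_const_of_deriv_eq_zero (fun u => (hder u).differentiableAt) (fun u => (hder u).deriv) s 0]
    simp [chi_spatial]

/-- The time shift is an integral over $[0,1]$ of a function jointly continuous in all variables,
its denominator never vanishing on the quadric. -/
lemma continuous_coverFlow_smul (hd : 2 ≤ d) (M : lieAlg d) :
    Continuous fun q : ℝ × CoverPt d => coverFlow (q.1 • M) q.2 := by
  have hy : Continuous fun q : (ℝ × CoverPt d) × ℝ =>
      NormedSpace.exp ((q.2 * q.1.1) • M.1) *ᵥ chi d q.1.2 :=
    (continuous_exp_smul_smul_mulVec M).comp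
      ((by fun_prop : Continuous fun q : (ℝ × CoverPt d) × ℝ => q.2 * q.1.1).prodMk
        ((continuous_chi d).comp (by fun_prop)))
  have hrate : Continuous fun q : (ℝ × CoverPt d) × ℝ =>
      clock (toC (q.1.1 • M.1 *ᵥ (NormedSpace.exp ((q.2 * q.1.1) • M.1) *ᵥ chi d q.1.2))) /
        clock (toC (NormedSpace.exp ((q.2 * q.1.1) • M.1) *ᵥ chi d q.1.2)) := by
    refine (continuous_clock.comp ((by fun_prop : Continuous fun q : (ℝ × CoverPt d) × ℝ =>
      q.1.1).smul (continuous_const.matrix_mulVec hy))).div (continuous_clock.comp hy) fun q =>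
        clock_ne_zero hd ?_
    rw [form_exp_smul, form_chi hd]
  have h1 := intervalIntegral.continuous_parametric_intervalIntegral_of_continuous'
    (μ := volume) (f := fun (q : ℝ × CoverPt d) (u : ℝ) =>
      clock (toC (q.1 • M.1 *ᵥ (NormedSpace.exp ((u * q.1) • M.1) *ᵥ chi d q.2))) /
        clock (toC (NormedSpace.exp ((u * q.1) • M.1) *ᵥ chi d q.2))) hrate 0 1
  have h2 : Continuous fun q : ℝ × CoverPt d => NormedSpace.exp (q.1 • M.1) *ᵥ chi d q.2 :=
    (continuous_exp_smul_smul_mulVec M).comp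
      (continuous_fst.prodMk ((continuous_chi d).comp continuous_snd))
  unfold coverFlow
  simp only [clockShift_toC, Submodule.coe_smul, Matrix.smul_mulVec, smul_smul]
  refine Continuous.prodMk ((continuous_fst.comp continuous_snd).add (Complex.continuous_re.comp
    (continuous_const.mul h1))) ?_
  exact (PiLp.continuous_toLp 2 _).comp (continuous_pi fun i => (continuous_apply _).comp h2)

lemma cover_regular (hd : 2 ≤ d) : (coverSpacetime hd).Regular where
  t2 := inferInstanceAs (T2Space (CoverPt d))
  nonempty := ⟨(0 : CoverPt d)⟩
  proj_exp M p := chi_coverFlow hd M p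
  exp_zero := by
    refine Subtype.ext (Homeomorph.ext fun p => ?_)
    have := coverFlow_time hd 0 p
    rw [zero_smul, add_zero] at this
    exact this
  continuous_exp M := continuous_coverFlow_smul hd M
  separated q := by
    let q : CoverPt d := q
    -- Two points of this slab differ in time by less than $\pi$, while distinct lifts differ by at
    -- least $2\pi$.
    refine ⟨{p : CoverPt d | |p.1 - q.1| < Real.pi / 2}, ?_, fun φ ψ h p hφ hψ => ?_⟩
    · have hc : Continuous fun p : CoverPt d => |p.1 - q.1| := by fun_prop
      refine (isOpen_lt hc continuous_const).mem_nhds ?_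
      show |q.1 - q.1| < Real.pi / 2
      rw [sub_self, abs_zero]
      positivity
    · obtain ⟨k, hk⟩ := eq_add_of_chi_eq hd φ.1.continuous ψ.1.continuous h
      have hp : (φ.1 p).1 = (ψ.1 p).1 + k * (2 * Real.pi) := congrArg Prod.fst (hk p)
      have h1 : |(φ.1 p).1 - q.1| < Real.pi / 2 := hφ
      have h2 : |(ψ.1 p).1 - q.1| < Real.pi / 2 := hψ
      rw [abs_lt] at h1 h2
      have hk0 : k = 0 := by
        have hpi := Real.pi_pos
        have h3 : (k : ℝ) < 1 := by nlinarith
        have h4 : (-1 : ℝ) < k := by nlinarith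
        have h3' : k < 1 := by exact_mod_cast h3
        have h4' : -1 < k := by exact_mod_cast h4
        omega
      refine Subtype.ext (Homeomorph.ext fun p => (hk p).trans ?_)
      rw [hk0, Int.cast_zero, zero_mul, add_zero]
      rfl
  deck_eq_exp φ h := by
    obtain ⟨k, hk⟩ := eq_add_of_chi_eq hd φ.1.continuous continuous_id h
    -- A deck transformation is a time translation by $2\pi k$.
    exact ⟨((k : ℝ) * (2 * Real.pi)) • stdGen 0 (Fin.last d),
      Subtype.ext (Homeomorph.ext fun p => (hk p).trans (coverFlow_time hd _ p).symm)⟩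

lemma spacetime_regular (hd : 2 ≤ d) : ∀ κ, (spacetime hd κ).Regular
  | .pure => pure_regular hd
  | .cover => cover_regular hd

end Regular

/-! ### Isometric representations -/

section Representation

variable {d : ℕ} {𝒳 : Spacetime d} {ℋ : Type*} [NormedAddCommGroup ℋ] [InnerProductSpace ℂ ℋ]
  {ρ : isometries 𝒳.proj →* (ℋ →ₗᵢ[ℂ] ℋ)}

/-- Strong continuity of the one-parameter groups with generators in `𝒞₁`. -/
def StronglyContinuousOnCone (ρ : isometries 𝒳.proj →* (ℋ →ₗᵢ[ℂ] ℋ)) : Prop :=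
  ∀ N ∈ coneOne d, ∀ v, Tendsto (fun t : ℝ => ρ (𝒳.exp (t • N)) v) (𝓝 0) (𝓝 v)

/-- For isometries $\|\rho(gh)v-v\|\le\|\rho(h)v-v\|+\|\rho(g)v-v\|$, so continuity passes to
products one factor at a time, at the fixed vector $v$. -/
lemma tendsto_isoProd {k : ℕ} {N : Fin k → lieAlg d}
    (h : ∀ i v, Tendsto (fun t : ℝ => ρ (𝒳.exp (t • N i)) v) (𝓝 0) (𝓝 v)) (v : ℋ) :
    Tendsto (fun t => ρ (𝒳.isoProd N t) v) (𝓝 0) (𝓝 v) := by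
  simp only [Spacetime.isoProd]
  generalize List.finRange k = l
  induction l with
  | nil => simp
  | cons i l ih =>
    simp only [List.map_cons, List.prod_cons, map_mul]
    have h1 : Tendsto (fun t : Fin k → ℝ => ρ (𝒳.exp (t i • N i)) v) (𝓝 0) (𝓝 v) :=
      (h i v).comp ((continuous_apply i).tendsto (0 : Fin k → ℝ))
    rw [tendsto_iff_norm_sub_tendsto_zero] at h1 ih ⊢
    refine squeeze_zero (fun _ => norm_nonneg _) (fun t => ?_) (by simpa using ih.add h1)
    refine (norm_sub_le_norm_sub_add_norm_sub _ (ρ (𝒳.exp (t i • N i)) v) _).trans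
      (add_le_add (le_of_eq ?_) le_rfl)
    show ‖ρ (𝒳.exp (t i • N i)) _ - _‖ = _
    rw [← map_sub, LinearIsometry.norm_map]
    rfl

variable (h𝒳 : 𝒳.Regular) (hρ : StronglyContinuousOnCone ρ) (hd : 2 ≤ d)
include h𝒳 hρ hd

/-- Because $\mathcal C_1$ contains a spanning family, isometries tending to $1$ are eventually
products of small exponentials from $\mathcal C_1$, where continuity is given. -/
lemma StronglyContinuousOnCone.tendsto {ι : Type*} {l : Filter ι}
    {φ : ι → isometries 𝒳.proj} {Λ : ι → Matrix (Fin (d + 1)) (Fin (d + 1)) ℝ}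
    (hφ : ∀ s p, 𝒳.proj ((φ s).1 p) = Λ s *ᵥ 𝒳.proj p)
    (hΛ : ∀ s, ∀ x y : Amb d, form (Λ s *ᵥ x) (Λ s *ᵥ y) = form x y)
    (hlim : Tendsto Λ l (𝓝 1)) {p₀ : 𝒳.Pt} (hp : Tendsto (fun s => (φ s).1 p₀) l (𝓝 p₀)) (v : ℋ) :
    Tendsto (fun s => ρ (φ s) v) l (𝓝 v) := by
  obtain ⟨k, N, hNI, hN⟩ := exists_spanning_family (span_coneOne hd)
  intro B hB
  have hT := tendsto_isoProd (fun i => hρ (N i) (hNI i)) v hB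
  refine mem_map.2 ?_
  filter_upwards [h𝒳.eventually_eq_isoProd hN hφ hΛ hlim hp hT] with s hs
  obtain ⟨t, ht, he⟩ := hs
  rw [Set.mem_preimage, he]
  exact ht

lemma StronglyContinuousOnCone.tendsto_exp {ι : Type*} {l : Filter ι} {r : ι → ℝ}
    (hr : Tendsto r l (𝓝 0)) (M : lieAlg d) (v : ℋ) :
    Tendsto (fun s => ρ (𝒳.exp (r s • M)) v) l (𝓝 v) := by
  obtain ⟨p₀⟩ := h𝒳.nonempty
  have hp := (h𝒳.continuous_exp_apply M 1 p₀).tendsto 0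
  simp only [mul_one, zero_smul, h𝒳.exp_zero] at hp
  exact hρ.tendsto h𝒳 hd (fun s => h𝒳.proj_exp (r s • M)) (fun s => exp_form (r s • M))
    (tendsto_exp_smul_one hr M) (hp.comp hr) v

lemma StronglyContinuousOnCone.continuous_exp (M : lieAlg d) (v : ℋ) :
    Continuous fun t : ℝ => ρ (𝒳.exp (t • M)) v := by
  refine continuous_iff_continuousAt.2 fun t => ?_
  have hr : Tendsto (fun s => s - t) (𝓝 t) (𝓝 0) := by
    simpa using (continuous_id.sub continuous_const).tendsto (f := fun s : ℝ => s - t) t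
  have h1 := ((ρ (𝒳.exp (t • M))).continuous.tendsto v).comp (hρ.tendsto_exp h𝒳 hd hr M v)
  refine h1.congr fun s => ?_
  show (ρ (𝒳.exp (t • M)) * ρ (𝒳.exp ((s - t) • M))) v = _
  rw [← map_mul, ← h𝒳.exp_add_smul, add_sub_cancel]

/-- The Mautner phenomenon: a vector fixed by a one-parameter group is fixed by the elements that
the group contracts to `1`. -/
lemma StronglyContinuousOnCone.fixed_of_contracted {K N : lieAlg d} {v : ℋ}
    (hv : ∀ t : ℝ, ρ (𝒳.exp (t • K)) v = v)
    (hN : ∀ r : ℝ, ∃ s : ℝ, 𝒳.exp (Real.exp (-r) • N) =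
      𝒳.exp (s • K) * 𝒳.exp N * (𝒳.exp (s • K))⁻¹) :
    ρ (𝒳.exp N) v = v := by
  have hr : Tendsto (fun r : ℝ => Real.exp (-r)) atTop (𝓝 0) :=
    Real.tendsto_exp_atBot.comp tendsto_neg_atTop_atBot
  have h1 := (tendsto_iff_norm_sub_tendsto_zero).1 (hρ.tendsto_exp h𝒳 hd hr N v)
  -- Conjugating by isometries that fix $v$ leaves the displacement of $v$ unchanged, so this norm
  -- does not depend on $r$, while it tends to zero as $r\to\infty$.
  have h2 : ∀ r : ℝ, ‖ρ (𝒳.exp (Real.exp (-r) • N)) v - v‖ = ‖ρ (𝒳.exp N) v - v‖ := by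
    intro r
    obtain ⟨s, hs⟩ := hN r
    have hinv : ρ (𝒳.exp (s • K))⁻¹ v = v := by
      have e : -(s • K) = (-s) • K := by module
      rw [← h𝒳.exp_neg, e]; exact hv _
    rw [hs, map_mul, map_mul]
    show ‖ρ (𝒳.exp (s • K)) (ρ (𝒳.exp N) (ρ (𝒳.exp (s • K))⁻¹ v)) - v‖ = _
    rw [hinv]
    nth_rw 2 [← hv s]
    rw [← map_sub, LinearIsometry.norm_map]
  simp only [h2] at h1
  have := tendsto_nhds_unique h1 tendsto_const_nhds
  exact sub_eq_zero.1 (norm_eq_zero.1 this.symm)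

/-- A vector fixed by the boosts `exp(tM_{d(d-1)})` is fixed by the whole group. -/
lemma StronglyContinuousOnCone.fixed_of_boost {v : ℋ}
    (hv : ∀ t : ℝ, ρ (𝒳.exp (t • boostGen d)) v = v) (φ : isometries 𝒳.proj) : ρ φ v = v := by
  let H : Subgroup (isometries 𝒳.proj) :=
    { carrier := {φ | ρ φ v = v}
      one_mem' := by simp
      mul_mem' := fun {φ ψ} hφ hψ => by
        show ρ (φ * ψ) v = v
        rw [map_mul]
        show ρ φ (ρ ψ v) = v
        rw [hψ, hφ]
      inv_mem' := fun {φ} hφ => by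
        show ρ φ⁻¹ v = v
        have : ρ (φ⁻¹ * φ) v = v := by simp
        rw [map_mul] at this
        rwa [show (ρ φ⁻¹ * ρ φ) v = ρ φ⁻¹ (ρ φ v) from rfl, hφ] at this }
  -- The generators whose one-parameter groups fix $v$. Not known to be a subspace, but stable under
  -- conjugation by its own one-parameter groups.
  let I : Set (lieAlg d) := {N | ∀ t : ℝ, 𝒳.exp (t • N) ∈ H}
  set i : Fin (d + 1) := ⟨d - 1, by omega⟩ with hi
  have hi0 : i ≠ 0 ∧ i ≠ Fin.last d := by
    constructor <;> intro h <;> have := congrArg Fin.val h <;> simp [hi] at this <;> omega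
  set a : Amb d := Pi.single (Fin.last d) 1 with ha
  set b : Amb d := Pi.single i 1 with hb
  have hK : boostGen d = wedge a b := rfl
  have haa : form a a = 1 := by rw [ha, form_single_single, if_pos rfl, sgn_last]
  have hbb : form b b = -1 := by rw [hb, form_single_single, if_pos rfl, sgn_spatial hi0]
  have hab : form a b = 0 := by rw [ha, hb, form_single_single, if_neg hi0.2.symm]
  have hconj : ∀ (M : lieAlg d) (x y : Amb d),
      𝒳.exp (wedge (NormedSpace.exp M.1 *ᵥ x) (NormedSpace.exp M.1 *ᵥ y)) =
        𝒳.exp M * 𝒳.exp (wedge x y) * (𝒳.exp M)⁻¹ := fun M x y =>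
    h𝒳.exp_conj (conj_wedge (exp_form M) (exp_mul_exp_neg M.1) x y).symm
  have hspan : Submodule.span ℝ I = ⊤ := by
    refine span_eq_top_of_roots (a := a) (b := b) hi0.2.symm sgn_last (sgn_spatial hi0) ha hb hv ?_ ?_
    · intro c hc w hw hw' t
      -- The vector $a+cb$ has eigenvalue $-c$ under the boost, so boost time $s=cr$ scales it by
      -- $e^{-c^2r}=e^{-r}$, while $w$ is left fixed.
      refine hρ.fixed_of_contracted h𝒳 hd hv fun r => ⟨c * r, ?_⟩
      have h1 : (boostGen d).1 *ᵥ (a + c • b) = (-c) • (a + c • b) := by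
        rw [hK, wedge_mulVec, form_add_right, form_add_right, form_smul_right, form_smul_right,
          form_comm b a, haa, hbb, hab]
        have : c • c • b = b := by rw [smul_smul, ← sq, hc, one_smul]
        rw [smul_add, neg_smul c (c • b), this]
        module
      have h2 : (boostGen d).1 *ᵥ (t • w) = (0 : ℝ) • (t • w) := by
        rw [hK, wedge_mulVec, form_smul_right, form_smul_right, hw, hw']; simp
      rw [← wedge_smul_right, ← hconj, Submodule.coe_smul, exp_smul_mulVec_eigenvector h1,
        exp_smul_mulVec_eigenvector h2, zero_mul, Real.exp_zero, one_smul, wedge_smul_left]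
      congr 3
      linear_combination r * hc
    · intro N hN x y hxy t s
      have h1 := hconj (t • N) x (s • y)
      rw [Matrix.mulVec_smul, wedge_smul_right, wedge_smul_right] at h1
      rw [← Submodule.coe_smul, h1]
      exact H.mul_mem (H.mul_mem (hN t) (hxy s)) (H.inv_mem (hN t))
  have htop : H = ⊤ := h𝒳.eq_top_of_span hspan fun N hN => hN
  have : φ ∈ H := by rw [htop]; trivial
  exact this

end Representation

/-! ### The mean ergodic theorem -/

/-- An $\varepsilon/2$ argument with a Lipschitz constant independent of the parameter. It reduces
strong continuity and vanishing of averages to dense sets of vectors. -/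
lemma isClosed_setOf_tendsto_zero {ι E F : Type*} [SeminormedAddCommGroup E]
    [SeminormedAddCommGroup F] {l : Filter ι} {A : ι → E → F} {C : ℝ}
    (h : ∀ᶠ s in l, ∀ x y, ‖A s x - A s y‖ ≤ C * ‖x - y‖) :
    IsClosed {x | Tendsto (fun s => A s x) l (𝓝 0)} := by
  refine isClosed_of_closure_subset fun x hx => ?_
  refine Metric.tendsto_nhds.2 fun ε hε => ?_
  obtain ⟨y, hy, hxy⟩ := Metric.mem_closure_iff.1 hx (ε / (2 * (|C| + 1))) (by positivity)
  filter_upwards [h, Metric.tendsto_nhds.1 hy (ε / 2) (by positivity)] with s hs hys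
  rw [dist_zero_right] at hys ⊢
  rw [dist_eq_norm, lt_div_iff₀ (by positivity)] at hxy
  have h1 := hs x y
  have h2 : C * ‖x - y‖ ≤ (|C| + 1) * ‖x - y‖ := by
    gcongr
    linarith [le_abs_self C]
  have h3 : ‖A s x‖ ≤ ‖A s x - A s y‖ + ‖A s y‖ := by
    simpa using norm_add_le (A s x - A s y) (A s y)
  linarith

section MeanErgodic

open scoped InnerProductSpace

variable {ℋ : Type*} [NormedAddCommGroup ℋ] [InnerProductSpace ℂ ℋ]

/-- The time average of the truncated correlation `(a, u_t b) - (a, Ω)(Ω, b)`. -/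
def correlationMean (u : ℝ → ℋ →ₗᵢ[ℂ] ℋ) (Ω a : ℋ) (T : ℝ) (b : ℋ) : ℂ :=
  ((1 / T : ℝ) : ℂ) * ∫ t in (0 : ℝ)..T, (⟪a, u t b⟫_ℂ - ⟪a, Ω⟫_ℂ * ⟪Ω, b⟫_ℂ)

variable {u : ℝ → ℋ →ₗᵢ[ℂ] ℋ} (hu : ∀ v, Continuous fun t => u t v) {Ω : ℋ} (a : ℋ)
include hu

lemma correlationMean_add (T : ℝ) (b c : ℋ) :
    correlationMean u Ω a T (b + c) = correlationMean u Ω a T b + correlationMean u Ω a T c := by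
  have hc : ∀ v, IntervalIntegrable (fun t => ⟪a, u t v⟫_ℂ - ⟪a, Ω⟫_ℂ * ⟪Ω, v⟫_ℂ) volume 0 T :=
    fun v => ((continuous_const.inner (hu v)).sub continuous_const).intervalIntegrable _ _
  rw [correlationMean, correlationMean, correlationMean, ← mul_add,
    ← intervalIntegral.integral_add (hc b) (hc c)]
  congr 2
  ext t
  simp only [map_add, inner_add_right]
  ring

omit hu in
lemma correlationMean_smul (T : ℝ) (z : ℂ) (b : ℋ) :
    correlationMean u Ω a T (z • b) = z * correlationMean u Ω a T b := by
  rw [correlationMean, correlationMean, mul_left_comm, ← intervalIntegral.integral_const_mul z]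
  congr 1
  refine intervalIntegral.integral_congr fun t _ => ?_
  simp only [map_smul, inner_smul_right]
  ring

omit hu in
-- The bound does not depend on $T$, which is what makes the set of vectors with vanishing averages
-- closed.
lemma norm_correlationMean_le {T : ℝ} (hT : 0 < T) (b : ℋ) :
    ‖correlationMean u Ω a T b‖ ≤ (‖a‖ + ‖a‖ * ‖Ω‖ * ‖Ω‖) * ‖b‖ := by
  have h := intervalIntegral.norm_integral_le_of_norm_le_const (a := 0) (b := T)
    (f := fun t => ⟪a, u t b⟫_ℂ - ⟪a, Ω⟫_ℂ * ⟪Ω, b⟫_ℂ)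
    (C := (‖a‖ + ‖a‖ * ‖Ω‖ * ‖Ω‖) * ‖b‖) fun t _ => by
      refine (norm_sub_le _ _).trans ?_
      rw [norm_mul, add_mul]
      refine add_le_add ((norm_inner_le_norm _ _).trans_eq (by rw [LinearIsometry.norm_map])) ?_
      refine (mul_le_mul (norm_inner_le_norm _ _) (norm_inner_le_norm _ _) (norm_nonneg _)
        (by positivity)).trans_eq (by ring)
  rw [correlationMean, norm_mul, Complex.norm_real, Real.norm_of_nonneg (by positivity)]
  rw [sub_zero, abs_of_pos hT] at h
  calc _ ≤ 1 / T * ((‖a‖ + ‖a‖ * ‖Ω‖ * ‖Ω‖) * ‖b‖ * T) := by gcongr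
    _ = _ := by field_simp

lemma isClosed_correlationMean :
    IsClosed {b | Tendsto (fun T => correlationMean u Ω a T b) atTop (𝓝 0)} := by
  refine isClosed_setOf_tendsto_zero (C := ‖a‖ + ‖a‖ * ‖Ω‖ * ‖Ω‖) ?_
  filter_upwards [eventually_gt_atTop 0] with T hT x y
  have : correlationMean u Ω a T x - correlationMean u Ω a T y = correlationMean u Ω a T (x - y) := by
    rw [sub_eq_iff_eq_add, ← correlationMean_add hu, sub_add_cancel]
  rw [this]
  exact norm_correlationMean_le a hT _

omit hu in
/-- Averages of truncated correlations with an invariant vector are constant. -/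
lemma inner_eq_of_tendsto_correlationMean {b : ℋ} (hb : ∀ t, u t b = b)
    (h : Tendsto (fun T => correlationMean u Ω a T b) atTop (𝓝 0)) :
    ⟪a, b⟫_ℂ = ⟪a, Ω⟫_ℂ * ⟪Ω, b⟫_ℂ := by
  have hconst : ∀ᶠ T : ℝ in atTop, correlationMean u Ω a T b =
      ⟪a, b⟫_ℂ - ⟪a, Ω⟫_ℂ * ⟪Ω, b⟫_ℂ := by
    filter_upwards [eventually_gt_atTop 0] with T hT
    have : (T : ℂ) ≠ 0 := by exact_mod_cast hT.ne'
    simp only [correlationMean, hb, intervalIntegral.integral_const, sub_zero]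
    rw [Complex.real_smul]
    push_cast
    field_simp
  exact sub_eq_zero.1 (tendsto_nhds_unique (tendsto_const_nhds.congr'
    (hconst.mono fun _ h => h.symm)) h)

/-- The mean ergodic theorem for a unitary one-parameter group with a single invariant vector. -/
lemma tendsto_correlationMean [CompleteSpace ℋ] (hadd : ∀ s t v, u (s + t) v = u s (u t v))
    (hΩ : ⟪Ω, Ω⟫_ℂ = 1) (hinv : ∀ t, u t Ω = Ω)
    (huniq : ∀ v, (∀ t, u t v = v) → ∃ c : ℂ, v = c • Ω) (b : ℋ) :
    Tendsto (fun T => correlationMean u Ω a T b) atTop (𝓝 0) := by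
  -- The vectors whose averages vanish form a closed subspace; it contains $\Omega$ and all
  -- coboundaries $c-u_sc$, and is shown to be dense.
  let Z : Submodule ℂ ℋ :=
    { carrier := {b | Tendsto (fun T => correlationMean u Ω a T b) atTop (𝓝 0)}
      zero_mem' := by
        have : ∀ T, correlationMean u Ω a T 0 = 0 := fun T => by
          simpa using correlationMean_smul (u := u) (Ω := Ω) a T 0 0
        simp [this]
      add_mem' := fun {x y} hx hy => by
        have := Tendsto.add (show Tendsto _ _ _ from hx) (show Tendsto _ _ _ from hy)
        simp only [← correlationMean_add hu, add_zero] at this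
        exact this
      smul_mem' := fun z x hx => by
        have := Tendsto.const_mul z (show Tendsto _ _ _ from hx)
        simp only [← correlationMean_smul, mul_zero] at this
        exact this }
  have hZΩ : Ω ∈ Z := by
    show Tendsto (fun T => correlationMean u Ω a T Ω) atTop (𝓝 0)
    simp only [correlationMean, hinv, hΩ, mul_one, sub_self, intervalIntegral.integral_zero,
      mul_zero, tendsto_const_nhds_iff]
  have hZsub : ∀ c s, c - u s c ∈ Z := by
    intro c s
    have h0 : ⟪Ω, c - u s c⟫_ℂ = 0 := by
      rw [inner_sub_right]
      nth_rw 2 [← hinv s]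
      rw [LinearIsometry.inner_map_map, sub_self]
    set F : ℝ → ℂ := fun t => ⟪a, u t c⟫_ℂ with hF
    have hFc : Continuous F := continuous_const.inner (hu c)
    have hbound : ∀ x y : ℝ, ‖∫ t in x..y, F t‖ ≤ ‖a‖ * ‖c‖ * |y - x| := fun x y =>
      intervalIntegral.norm_integral_le_of_norm_le_const fun t _ =>
        (norm_inner_le_norm _ _).trans_eq (by rw [LinearIsometry.norm_map])
    -- The integral of $F(t)-F(t+s)$ telescopes to two integrals over intervals of length $|s|$,
    -- bounded independently of $T$.
    have hint : ∀ T : ℝ, ∫ t in (0 : ℝ)..T, (⟪a, u t (c - u s c)⟫_ℂ - ⟪a, Ω⟫_ℂ * ⟪Ω, c - u s c⟫_ℂ) =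
        (∫ t in (0 : ℝ)..s, F t) - ∫ t in T..(T + s), F t := by
      intro T
      have e : ∀ t, ⟪a, u t (c - u s c)⟫_ℂ - ⟪a, Ω⟫_ℂ * ⟪Ω, c - u s c⟫_ℂ = F t - F (t + s) := fun t => by
        rw [h0, mul_zero, sub_zero, map_sub, inner_sub_right, ← hadd]
      simp only [e]
      have hFs : Continuous fun t => F (t + s) := hFc.comp (continuous_id.add continuous_const)
      rw [intervalIntegral.integral_sub (hFc.intervalIntegrable _ _) (hFs.intervalIntegrable _ _),
        intervalIntegral.integral_comp_add_right F s, zero_add]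
      exact intervalIntegral.integral_interval_sub_interval_comm (hFc.intervalIntegrable _ _)
        (hFc.intervalIntegrable _ _) (hFc.intervalIntegrable _ _)
    have hlim : Tendsto (fun T : ℝ => 1 / T * (2 * (‖a‖ * ‖c‖ * |s|))) atTop (𝓝 0) := by
      simpa using (tendsto_const_nhds (x := (1 : ℝ))).div_atTop tendsto_id |>.mul_const
        (2 * (‖a‖ * ‖c‖ * |s|))
    refine squeeze_zero_norm' ?_ hlim
    filter_upwards [eventually_gt_atTop 0] with T hT
    rw [correlationMean, hint, norm_mul, Complex.norm_real, Real.norm_of_nonneg (by positivity)]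
    gcongr
    refine (norm_sub_le _ _).trans ?_
    have h1 := hbound 0 s
    have h2 := hbound T (T + s)
    rw [sub_zero] at h1
    rw [add_sub_cancel_left] at h2
    linarith
  have hZ : Z.topologicalClosure = ⊤ := by
    rw [Submodule.topologicalClosure_eq_top_iff, eq_bot_iff]
    intro v hv
    rw [Submodule.mem_orthogonal] at hv
    -- Orthogonality to $v-u_sv$ gives $(u_sv,v)=(v,v)$; since $u_sv$ and $v$ have equal norms, they
    -- coincide.
    have hfix : ∀ s, u s v = v := by
      intro s
      have h1 := hv _ (hZsub v s)
      rw [inner_sub_left, sub_eq_zero] at h1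
      have h2 : ⟪v, u s v⟫_ℂ = ⟪v, v⟫_ℂ := by
        rw [← inner_conj_symm, ← h1, inner_conj_symm]
      have h3 : ⟪u s v - v, u s v - v⟫_ℂ = 0 := by
        rw [inner_sub_left, inner_sub_right, inner_sub_right, LinearIsometry.inner_map_map, h2, ← h1]
        ring
      exact sub_eq_zero.1 (inner_self_eq_zero.1 h3)
    obtain ⟨c, rfl⟩ := huniq v hfix
    -- The fixed vector is a multiple of $\Omega$ and also orthogonal to $\Omega$, hence zero.
    have := hv Ω hZΩ
    rw [inner_smul_right, hΩ, mul_one] at this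
    simp [this]
  have hcl : Z.topologicalClosure = Z :=
    IsClosed.submodule_topologicalClosure_eq (isClosed_correlationMean hu a)
  have : b ∈ Z := by rw [← hcl, hZ]; trivial
  exact this

end MeanErgodic

/-! ### The GNS representation -/

section GNSRepresentation

variable {d : ℕ} {𝒳 : Spacetime d}

/-! ### Group laws and the unit in the Borchers algebra -/

namespace Borchers

lemma act_one (f : Borchers 𝒳) : act 1 f = f := by
  induction f using induction with
  | h0 => simp
  | h1 n g => rw [act_lof]; rfl
  | h2 f g hf hg => simp only [map_add, hf, hg]

lemma act_mul_act (φ ψ : isometries 𝒳.proj) (f : Borchers 𝒳) :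
    act (φ * ψ) f = act φ (act ψ f) := by
  induction f using induction with
  | h0 => simp
  | h1 n g => rw [act_lof, act_lof, act_lof]; rfl
  | h2 f g hf hg => simp only [map_add, hf, hg]

lemma act_unit (φ : isometries 𝒳.proj) : act φ (one 𝒳) = one 𝒳 := by
  rw [one, act_lof]; rfl

lemma star_unit : star (one 𝒳) = one 𝒳 := by
  rw [one, star_lof]
  congr 1
  exact TestFn.ext fun x => map_one (starRingEnd ℂ)

end Borchers

namespace WightmanFunctional

variable (𝒲 : WightmanFunctional 𝒳)

lemma eval_lof {n : ℕ} (f : TestFn 𝒳 n) :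
    𝒲.eval (DirectSum.lof ℂ ℕ (fun n => TestFn 𝒳 n) n f) = 𝒲.W n f := by
  simp [eval, DirectSum.toModule_lof]

/-- Tensoring with the unit lands in degree $n+0$ or $0+n$; this moves the value to degree $n$ by
relabelling the arguments. -/
lemma W_cast {n m : ℕ} (h : n = m) {f : TestFn 𝒳 n} {g : TestFn 𝒳 m}
    (hfg : ∀ x : Fin m → 𝒳.Pt, f (fun j => x (Fin.cast h j)) = g x) : 𝒲.W n f = 𝒲.W m g := by
  subst h
  congr 1
  exact TestFn.ext hfg

lemma eval_mul_one (f : Borchers 𝒳) : 𝒲.eval (Borchers.mul f (Borchers.one 𝒳)) = 𝒲.eval f := by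
  induction f using Borchers.induction with
  | h0 => simp
  | h1 n g =>
    rw [Borchers.one, Borchers.mul_lof, eval_lof, eval_lof]
    exact 𝒲.W_cast (add_zero n) fun x => mul_one (g x)
  | h2 f g hf hg => simp only [map_add, LinearMap.add_apply, hf, hg]

lemma eval_one_mul (f : Borchers 𝒳) : 𝒲.eval (Borchers.mul (Borchers.one 𝒳) f) = 𝒲.eval f := by
  induction f using Borchers.induction with
  | h0 => simp
  | h1 n g =>
    rw [Borchers.one, Borchers.mul_lof, eval_lof, eval_lof]
    refine 𝒲.W_cast (zero_add n) fun x => ?_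
    refine (one_mul _).trans (congrArg g (funext fun j => congrArg x (Fin.ext ?_)))
    simp
  | h2 f g hf hg => simp only [map_add, hf, hg]

section GNS

variable {𝒲} (hpos : 𝒲.PosDef) (hcov : 𝒲.Covariant)

lemma inner_vec (f g : Borchers 𝒳) : inner ℂ (𝒲.vec hpos f) (𝒲.vec hpos g) = 𝒲.sesq f g :=
  UniformSpace.Completion.inner_coe _ _

lemma inner_vec_vacuum (f : Borchers 𝒳) :
    inner ℂ (𝒲.vec hpos f) (𝒲.vacuum hpos) = 𝒲.eval (Borchers.star f) :=
  (inner_vec hpos _ _).trans (𝒲.eval_mul_one _)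

lemma inner_vacuum_vec (f : Borchers 𝒳) :
    inner ℂ (𝒲.vacuum hpos) (𝒲.vec hpos f) = 𝒲.eval f := by
  refine (inner_vec hpos _ _).trans ?_
  rw [sesq, Borchers.star_unit, eval_one_mul]

lemma inner_vacuum_vacuum (hnorm : 𝒲.Normalized) :
    inner ℂ (𝒲.vacuum hpos) (𝒲.vacuum hpos) = 1 :=
  (inner_vacuum_vec hpos _).trans hnorm

lemma denseRange_vec : DenseRange (𝒲.vec hpos) :=
  show DenseRange fun x : 𝒲.PreGNS hpos => (x : 𝒲.GNS hpos) from
    UniformSpace.Completion.denseRange_coe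

lemma U_vec (φ : isometries 𝒳.proj) (f : Borchers 𝒳) :
    𝒲.U hpos hcov φ (𝒲.vec hpos f) = 𝒲.vec hpos (Borchers.act φ f) :=
  ContinuousLinearMap.completion_apply_coe _ _

/-- Density of the vectors $\Phi(f)\Omega$, in the form used to identify operators and functionals.
-/
lemma eq_of_forall_vec {E : Type*} [TopologicalSpace E] [T2Space E] {A B : 𝒲.GNS hpos → E}
    (hA : Continuous A) (hB : Continuous B) (h : ∀ f, A (𝒲.vec hpos f) = B (𝒲.vec hpos f))
    (v : 𝒲.GNS hpos) : A v = B v :=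
  congrFun ((denseRange_vec hpos).equalizer hA hB (funext h)) v

/-- The representation `U` by isometries of the GNS space. -/
def gnsRep : isometries 𝒳.proj →* (𝒲.GNS hpos →ₗᵢ[ℂ] 𝒲.GNS hpos) where
  toFun φ :=
    { toLinearMap := (𝒲.U hpos hcov φ).toLinearMap
      norm_map' := eq_of_forall_vec hpos (𝒲.U hpos hcov φ).continuous.norm continuous_norm
        fun f => by
          show ‖𝒲.U hpos hcov φ (𝒲.vec hpos f)‖ = _
          rw [U_vec]
          refine (UniformSpace.Completion.norm_coe _).trans
            (Eq.trans ?_ (UniformSpace.Completion.norm_coe _).symm)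
          exact (𝒲.preU hpos hcov φ).norm_map _ }
  map_one' := LinearIsometry.ext <| eq_of_forall_vec hpos (𝒲.U hpos hcov 1).continuous
    continuous_id fun f => by
      show 𝒲.U hpos hcov 1 (𝒲.vec hpos f) = _
      rw [U_vec, Borchers.act_one]; rfl
  map_mul' φ ψ := LinearIsometry.ext <| eq_of_forall_vec hpos (𝒲.U hpos hcov (φ * ψ)).continuous
    ((𝒲.U hpos hcov φ).continuous.comp (𝒲.U hpos hcov ψ).continuous) fun f => by
      show 𝒲.U hpos hcov (φ * ψ) (𝒲.vec hpos f) =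
        𝒲.U hpos hcov φ (𝒲.U hpos hcov ψ (𝒲.vec hpos f))
      rw [U_vec, U_vec, U_vec, Borchers.act_mul_act]

lemma gnsRep_apply (φ : isometries 𝒳.proj) (v : 𝒲.GNS hpos) :
    gnsRep hpos hcov φ v = 𝒲.U hpos hcov φ v := rfl

lemma U_vacuum (φ : isometries 𝒳.proj) : 𝒲.U hpos hcov φ (𝒲.vacuum hpos) = 𝒲.vacuum hpos := by
  rw [vacuum, U_vec, Borchers.act_unit]

end GNS

/-! ### Continuity of the representation -/

/-- The product of the first $k$ factors contains the factor of index $n$, counted from $0$, only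
when $k>n$. So exactly the first $n$ arguments of a test function are left in place. -/
lemma partialProd_ite {G : Type*} [Monoid G] {N n : ℕ} (x : G) (k : Fin (N + 1)) :
    Fin.partialProd (fun i : Fin N => if i.val = n then x else 1) k =
      if k.val ≤ n then 1 else x := by
  induction k using Fin.induction with
  | zero => simp
  | succ i ih =>
    rw [Fin.partialProd_succ, ih]
    simp only [Fin.val_castSucc, Fin.val_succ]
    rcases lt_trichotomy i.val n with h | h | h
    · rw [if_pos h.le, if_neg h.ne, if_pos (by omega), one_mul]
    · rw [if_pos h.le, if_pos h, if_neg (by omega), one_mul]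
    · rw [if_neg (by omega), if_neg h.ne', if_neg (by omega), mul_one]

variable {𝒲}

/-- For $f$, $g$ homogeneous of degrees $n$, $m$, the function $f^\star\otimes g_{\{\exp(tN)\}}$ is
$f^\star\otimes g$ with its variables moved by $\Lambda_1,\dots,\Lambda_{n+m}$, where every $\tau_j$
is zero except $\tau_{n+1}=t$. The tempered spectral condition makes its value the restriction to
real $\tau$ of a function continuous on the closed half-planes. -/
lemma continuous_sesq_act_exp (hexp : 𝒳.exp 0 = 1) (htemp : 𝒲.TemperedSpectral) {N : lieAlg d}
    (hN : N ∈ coneOne d) (f g : Borchers 𝒳) :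
    Continuous fun t : ℝ => 𝒲.sesq f (Borchers.act (𝒳.exp (t • N)) g) := by
  simp only [sesq]
  induction f using Borchers.induction with
  | h0 => simpa using continuous_const
  | h2 f₁ f₂ h₁ h₂ => simpa only [map_add, LinearMap.add_apply] using h₁.fun_add h₂
  | h1 n f =>
    induction g using Borchers.induction with
    | h0 => simpa using continuous_const
    | h2 g₁ g₂ h₁ h₂ => simpa only [map_add] using h₁.fun_add h₂
    | h1 m g =>
      obtain ⟨Φ, hΦ, -, hsmooth, -⟩ := htemp.2 (n + m) (f.star.tensor g) (fun _ => N) fun _ => hN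
      -- Index $n$ counted from $0$ is the first variable of $g$.
      have hτ : Continuous fun t : ℝ => fun j : Fin (n + m) =>
          (((if j.val = n then t else 0 : ℝ)) : ℂ) := by
        refine continuous_pi fun j => Complex.continuous_ofReal.comp ?_
        split_ifs <;> fun_prop
      refine (hsmooth.continuousOn.comp_continuous hτ fun t j => by simp).congr fun t => ?_
      refine (hΦ _).trans ?_
      rw [Borchers.star_lof, Borchers.act_lof, Borchers.mul_lof, eval_lof]
      congr 1
      have hone : ∀ i : Fin (n + m), 𝒳.exp ((if i.val = n then t else 0) • N) =
          if i.val = n then 𝒳.exp (t • N) else 1 := fun i => by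
        split_ifs
        · rfl
        · rw [zero_smul, hexp]
      have hpp : ∀ j : Fin (n + m), Fin.partialProd (fun i : Fin (n + m) =>
          𝒳.exp ((if i.val = n then t else 0) • N)) j.succ =
          if j.val + 1 ≤ n then 1 else 𝒳.exp (t • N) := fun j => by
        simp only [hone]
        exact partialProd_ite _ j.succ
      refine TestFn.ext fun x => ?_
      refine congrArg₂ (· * ·) (congrArg f.star (funext fun j => ?_))
        (congrArg g (funext fun j => ?_))
      · beta_reduce
        rw [hpp, if_pos (by simp only [Fin.val_castAdd]; omega)]; rfl
      · beta_reduce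
        rw [hpp, if_neg (by simp only [Fin.val_natAdd]; omega)]

/-- For isometries $\|Uw-w\|^2=2\|w\|^2-2\operatorname{Re}(w,Uw)$, so continuity of the matrix
element gives norm continuity on the vectors $\Phi(f)\Omega$, and density gives the rest. -/
lemma stronglyContinuousOnCone_gnsRep (hexp : 𝒳.exp 0 = 1) (htemp : 𝒲.TemperedSpectral)
    (hpos : 𝒲.PosDef) (hcov : 𝒲.Covariant) : StronglyContinuousOnCone (gnsRep hpos hcov) := by
  intro N hN v
  have hcl : IsClosed {v : 𝒲.GNS hpos | Tendsto
      (fun t : ℝ => gnsRep hpos hcov (𝒳.exp (t • N)) v - v) (𝓝 0) (𝓝 0)} := by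
    refine isClosed_setOf_tendsto_zero (C := 2) (Eventually.of_forall fun t x y => ?_)
    rw [sub_sub_sub_comm, ← map_sub]
    refine (norm_sub_le _ _).trans ?_
    rw [LinearIsometry.norm_map]
    linarith
  rw [tendsto_iff_norm_sub_tendsto_zero, ← tendsto_zero_iff_norm_tendsto_zero]
  refine (denseRange_vec hpos).induction_on (p := fun v => Tendsto
      (fun t : ℝ => gnsRep hpos hcov (𝒳.exp (t • N)) v - v) (𝓝 0) (𝓝 0)) v hcl fun f => ?_
  have hin : Continuous fun t : ℝ => inner ℂ (𝒲.vec hpos f)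
      (gnsRep hpos hcov (𝒳.exp (t • N)) (𝒲.vec hpos f)) := by
    simp only [gnsRep_apply, U_vec, inner_vec]
    exact continuous_sesq_act_exp hexp htemp hN f f
  set w := 𝒲.vec hpos f with hw
  have hsq : ∀ t : ℝ, ‖gnsRep hpos hcov (𝒳.exp (t • N)) w - w‖ ^ 2 =
      2 * ‖w‖ ^ 2 - 2 * (inner ℂ w (gnsRep hpos hcov (𝒳.exp (t • N)) w)).re := fun t => by
    rw [@norm_sub_sq ℂ, LinearIsometry.norm_map, ← inner_conj_symm, RCLike.conj_re]
    simp only [RCLike.re_to_complex]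
    ring
  have hlim : Tendsto (fun t : ℝ => ‖gnsRep hpos hcov (𝒳.exp (t • N)) w - w‖ ^ 2) (𝓝 0) (𝓝 0) := by
    simp only [hsq]
    have h0 : 2 * ‖w‖ ^ 2 - 2 * (inner ℂ w (gnsRep hpos hcov (𝒳.exp ((0 : ℝ) • N)) w)).re = 0 := by
      rw [← hsq, zero_smul, hexp, map_one]; simp
    have hc : Continuous fun t : ℝ =>
        2 * ‖w‖ ^ 2 - 2 * (inner ℂ w (gnsRep hpos hcov (𝒳.exp (t • N)) w)).re :=
      continuous_const.sub (continuous_const.mul (Complex.continuous_re.comp hin))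
    have := hc.tendsto 0
    rwa [h0] at this
  rw [tendsto_zero_iff_norm_tendsto_zero]
  have := hlim.sqrt
  simpa using this

end WightmanFunctional

end GNSRepresentation

end AdS

end

/-! ### The equivalence -/

open AdS WightmanFunctional Filter Topology in
theorem mainTheorem9 {d : ℕ} (hd : 2 ≤ d) (κ : AdS.Kind)
    (𝒲 : AdS.WightmanFunctional (AdS.spacetime hd κ)) (hnorm : 𝒲.Normalized)
    (hcov : 𝒲.Covariant) (hloc : 𝒲.Locality) (hpos : 𝒲.PosDef)
    (hspec : 𝒲.StrongSpectral hpos hcov) (htemp : 𝒲.TemperedSpectral) :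
    𝒲.UniqueVacuum hpos hcov ↔
      ∀ f g : AdS.Borchers (AdS.spacetime hd κ),
        Filter.Tendsto (fun T : ℝ => ((1 / T : ℝ) : ℂ) * ∫ t in (0 : ℝ)..T,
          (𝒲.eval (AdS.Borchers.mul (AdS.Borchers.star f)
              (AdS.Borchers.act ((AdS.spacetime hd κ).exp (t • AdS.boostGen d)) g)) -
            𝒲.eval (AdS.Borchers.star f) * 𝒲.eval g)) Filter.atTop (nhds 0) := by
  have h𝒳 := spacetime_regular hd κ
  have hρ := stronglyContinuousOnCone_gnsRep h𝒳.exp_zero htemp hpos hcov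
  let u : ℝ → 𝒲.GNS hpos →ₗᵢ[ℂ] 𝒲.GNS hpos := fun t =>
    gnsRep hpos hcov ((spacetime hd κ).exp (t • boostGen d))
  have hu : ∀ v, Continuous fun t => u t v := hρ.continuous_exp h𝒳 hd (boostGen d)
  have hmean : ∀ f g : Borchers (spacetime hd κ), (fun T : ℝ => ((1 / T : ℝ) : ℂ) *
      ∫ t in (0 : ℝ)..T, (𝒲.eval (Borchers.mul (Borchers.star f)
        (Borchers.act ((spacetime hd κ).exp (t • boostGen d)) g)) -
          𝒲.eval (Borchers.star f) * 𝒲.eval g)) =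
      fun T => correlationMean u (𝒲.vacuum hpos) (𝒲.vec hpos f) T (𝒲.vec hpos g) := by
    intro f g
    ext T
    simp only [correlationMean, u, gnsRep_apply, U_vec, inner_vec, inner_vec_vacuum,
      inner_vacuum_vec]
    rfl
  simp only [hmean]
  have hΩ := inner_vacuum_vacuum hpos hnorm
  constructor
  · intro huniq f g
    refine tendsto_correlationMean hu _ (fun s t v => ?_) hΩ (fun t => U_vacuum hpos hcov _)
      (fun v hv => ?_) _
    · simp only [u, h𝒳.exp_add_smul, map_mul]; rfl
    -- A vector fixed by the boosts is fixed by the whole group, so uniqueness of the vacuum applies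
    -- to it.
    · have hv' : v ∈ {Ψ : 𝒲.GNS hpos | ∀ φ, 𝒲.U hpos hcov φ Ψ = Ψ} :=
        hρ.fixed_of_boost h𝒳 hd hv
      rw [huniq] at hv'
      obtain ⟨c, hc⟩ := Submodule.mem_span_singleton.1 hv'
      exact ⟨c, hc.symm⟩
  · intro h
    refine Set.Subset.antisymm (fun Ψ hΨ => ?_) fun Ψ hΨ φ => ?_
    -- The hypothesis concerns only vectors $\Phi(g)\Omega$; closedness and density carry it to the
    -- invariant vector $\Psi$, which need not be of that form.
    · have hZ : ∀ f, Tendsto (fun T => correlationMean u (𝒲.vacuum hpos) (𝒲.vec hpos f) T Ψ)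
          atTop (𝓝 0) := fun f =>
        (denseRange_vec hpos).induction_on (p := fun v => Tendsto (fun T =>
          correlationMean u (𝒲.vacuum hpos) (𝒲.vec hpos f) T v) atTop (𝓝 0)) Ψ
          (isClosed_correlationMean hu _) (h f)
      -- For invariant $\Psi$ the average is constant in $T$, so the limit reads
      -- $(\Phi(f)\Omega,\Psi)=(\Phi(f)\Omega,\Omega)(\Omega,\Psi)$.
      have hin : ∀ f, inner ℂ (𝒲.vec hpos f) Ψ = inner ℂ (𝒲.vec hpos f)
          (inner ℂ (𝒲.vacuum hpos) Ψ • 𝒲.vacuum hpos) := fun f => by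
        rw [inner_eq_of_tendsto_correlationMean _ (fun t => hΨ _) (hZ f), inner_smul_right, mul_comm]
      have hall := eq_of_forall_vec hpos (A := fun v => inner ℂ v Ψ)
        (B := fun v => inner ℂ v (inner ℂ (𝒲.vacuum hpos) Ψ • 𝒲.vacuum hpos))
        (continuous_id.inner continuous_const) (continuous_id.inner continuous_const) hin
      exact Submodule.mem_span_singleton.2 ⟨_, (ext_inner_left ℂ hall).symm⟩
    · obtain ⟨c, rfl⟩ := Submodule.mem_span_singleton.1 hΨ
      rw [map_smul, U_vacuum]
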